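/- Let $d\ge 1$, $\lambda\in\mathbf R\setminus\{0\}$, $\sigma>0$, and let $P:\mathbf R^d\to\mathbf R$ be measurable. Assume that either $\sigma$ is an integer, or there is an integer $r$ with $2\sigma\ge r>d/2$. Consider, with $D=-i\nabla_x$, $$ i\partial_t u+P(D)u=\lambda|u|^{2\sigma}u,\qquad u_{\mid t=0}=u_0,\qquad (t,x)\in\mathbf R_+\times\mathbf R^d. \tag{E}$$ A solution of (E) on $[0,T]$ is a function $u\in C([0,T];H^{\rho}(\mathbf R^d))$, for some $\rho>d/2$, such that for all $t\in[0,T]$ $$u(t)=e^{itP(D)}u_0-i\lambda\int_0^t e^{i(t-\tau)P(D)}\bigl(|u(\tau)|^{2\sigma}u(\tau)\bigr)\,d\tau .$$ 1. Suppose that $P$ is $m$-homogeneous with a real $m\ge 1$, that is, $P(\mu\xi)=\mu^mP(\xi)$ for all $\xi\in\mathbf R^d$ and $\mu>0$, and that $s_0:=\frac d2-\frac m{2\sigma}>0$. Let $0<s<s_0$. Then there exist a family $(u_0^h)_{0<h\le 1}$ in $\mathcal S(\mathbf R^d)$ with $\|u_0^h\|_{H^s(\mathbf R^d)}\to 0$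 as $h\to 0$, times $t^h>0$ with $t^h\to 0$ as $h\to 0$, and, for each $h\in(0,1]$, a solution $u^h$ of (E) with initial datum $u_0^h$ on an interval $[0,T^h]$ with $T^h\ge t^h$, such that $$\|u^h(t^h)\|_{H^s(\mathbf R^d)}\to+\infty\quad\text{as } h\to 0.$$ 2. If $P$ is bounded, $P\in L^\infty(\mathbf R^d)$, then the same conclusion holds for every $0<s<d/2$. -/

import Mathlib

open MeasureTheory Filter Topology FourierTransform
open scoped ENNReal SchwartzMap

noncomputable section

namespace ModifiedDispersion

/-- `ℝ^d` with its Euclidean norm. -/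
abbrev Space (d : ℕ) : Type := EuclideanSpace ℝ (Fin d)

/-- `L²(ℝ^d; ℂ)`. -/
abbrev L2 (d : ℕ) : Type := Lp ℂ 2 (volume : Measure (Space d))

/-- The (possibly infinite) norm of `H^s(ℝ^d)`,
`‖f‖_{H^s} = ‖(1 + |D|²)^{s/2} f‖_{L²}`, where `D = -i∇`. Since `𝓕` is normalised with the kernel
`exp (-2πi x·ξ)`, the operator `D` corresponds to multiplication by `2πξ`. -/
def sobolevNorm {d : ℕ} (s : ℝ) (f : L2 d) : ℝ≥0∞ :=
  eLpNorm (fun ξ : Space d =>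
    (((1 + ‖(2 * Real.pi) • ξ‖ ^ 2) ^ (s / 2) : ℝ) : ℂ) * (𝓕 f : L2 d) ξ) 2 volume

/-- `P(μ ξ) = μ^m P(ξ)` for all `ξ` and all `μ > 0`. -/
def IsHomogeneousSymbol {d : ℕ} (P : Space d → ℝ) (m : ℝ) : Prop :=
  ∀ (ξ : Space d) (μ : ℝ), 0 < μ → P (μ • ξ) = μ ^ m * P ξ

lemma memLp_phase_mul {d : ℕ} {P : Space d → ℝ} (hP : AEMeasurable P volume) (t : ℝ) (f : L2 d) :
    MemLp (fun ξ : Space d =>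
      Complex.exp (Complex.I * (t * P ((2 * Real.pi) • ξ) : ℝ)) * f ξ) 2 volume := by
  have hq : Measure.QuasiMeasurePreserving (fun ξ : Space d => (2 * Real.pi) • ξ)
      volume volume := by
    refine ⟨measurable_const_smul _, ?_⟩
    rw [Measure.map_addHaar_smul volume (by positivity : (2 * Real.pi : ℝ) ≠ 0)]
    exact Measure.smul_absolutelyContinuous
  have hPm : AEMeasurable (fun ξ : Space d => P ((2 * Real.pi) • ξ)) volume :=
    hP.comp_quasiMeasurePreserving hq
  have hexp : AEMeasurable (fun ξ : Space d =>
      Complex.exp (Complex.I * (t * P ((2 * Real.pi) • ξ) : ℝ))) volume :=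
    Complex.measurable_exp.comp_aemeasurable
      ((Complex.measurable_ofReal.comp_aemeasurable (hPm.const_mul t)).const_mul _)
  refine (Lp.memLp f).of_le (hexp.aestronglyMeasurable.mul (Lp.aestronglyMeasurable f)) ?_
  refine Eventually.of_forall fun ξ => ?_
  rw [norm_mul, mul_comm Complex.I, Complex.norm_exp_ofReal_mul_I, one_mul]

/-- The free flow `exp (i t P(D))` of `i ∂ₜ u + P(D) u = 0` on `L²(ℝ^d)`: the Fourier multiplier by
`exp (i t P)`, with `D = -i∇` (hence the argument `2πξ`, see `sobolevNorm`). -/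
def freeFlow {d : ℕ} {P : Space d → ℝ} (hP : AEMeasurable P volume) (t : ℝ) (f : L2 d) : L2 d :=
  𝓕⁻ ((memLp_phase_mul hP t (𝓕 f : L2 d)).toLp)

/-- `u ∈ C([0,T]; H^r(ℝ^d))`. -/
def ContinuousInSobolev {d : ℕ} (r T : ℝ) (u : ℝ → L2 d) : Prop :=
  ∀ t₀ ∈ Set.Icc 0 T, sobolevNorm r (u t₀) < ∞ ∧
    Tendsto (fun t => sobolevNorm r (u t - u t₀)) (𝓝[Set.Icc 0 T] t₀) (𝓝 0)

/-- `u` is a solution on the time interval `[0,T]` of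
`i ∂ₜ u + P(D) u = lam |u|^{2σ} u`, `u(0) = u₀`:
it belongs to `C([0,T]; H^r(ℝ^d))` for some `r > d/2`, so that the nonlinear term `g` is a continuous
`L²`-valued function, and it satisfies Duhamel's formula
`u(t) = e^{itP(D)} u₀ - i lam ∫₀ᵗ e^{i(t-τ)P(D)} (|u|^{2σ} u)(τ) dτ` in `L²(ℝ^d)`. -/
def IsSolution {d : ℕ} {P : Space d → ℝ} (hP : AEMeasurable P volume) (lam σ : ℝ)
    (u₀ : 𝓢(Space d, ℂ)) (T : ℝ) (u : ℝ → L2 d) : Prop :=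
  (∃ r : ℝ, (d : ℝ) / 2 < r ∧ ContinuousInSobolev r T u) ∧
  ∃ g : ℝ → L2 d, ContinuousOn g (Set.Icc 0 T) ∧
    (∀ t ∈ Set.Icc 0 T,
      g t =ᵐ[volume] fun x : Space d => ((‖u t x‖ ^ (2 * σ) : ℝ) : ℂ) * u t x) ∧
    ∀ t ∈ Set.Icc 0 T,
      u t = freeFlow hP t (u₀.toLp 2 volume)
        - (Complex.I * (lam : ℂ)) • ∫ τ in (0 : ℝ)..t, freeFlow hP (t - τ) (g τ)

/-- Norm inflation in `H^s(ℝ^d)`: there are Schwartz data `u₀ h`, `0 < h ≤ 1`, tending to `0` in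
`H^s`, solutions `u h` on `[0, T h]` with these data, and times `0 < t h ≤ T h` tending to `0`, such
that the `H^s` norm of `u h (t h)` tends to infinity as `h → 0`. -/
def NormInflation {d : ℕ} {P : Space d → ℝ} (hP : AEMeasurable P volume) (lam σ s : ℝ) : Prop :=
  ∃ (u₀ : ℝ → 𝓢(Space d, ℂ)) (u : ℝ → ℝ → L2 d) (T t : ℝ → ℝ),
    (∀ h ∈ Set.Ioc (0 : ℝ) 1,
      0 < t h ∧ t h ≤ T h ∧ IsSolution hP lam σ (u₀ h) (T h) (u h)) ∧
    Tendsto (fun h => sobolevNorm s ((u₀ h).toLp 2 volume)) (𝓝[>] 0) (𝓝 0) ∧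
    Tendsto t (𝓝[>] 0) (𝓝 0) ∧
    Tendsto (fun h => sobolevNorm s (u h (t h))) (𝓝[>] 0) (𝓝 ∞)

end ModifiedDispersion

end

noncomputable section

namespace ModifiedDispersion

/-! The mechanism is that a suitable rescaling makes dispersion negligible, and the equation without
dispersion is an explicit ODE whose solutions oscillate more and more. If `w` solves (E) with symbol
`Q(ξ) = A^{-2σ} P(cξ)`, then `u(t, x) = A w(A^{2σ} t, c x)` solves (E) with symbol `P`
(`IsSolution.dilate`). With `A = κ c^{d/2 - s}` the `H^s` norm of `A f(c ·)` is at most `κ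
‖f‖_{H^s}` for `c ≥ 1`, and at least `κ` times the homogeneous norm of `f` (`sobolevNorm_dil_le`,
`le_sobolevNorm_dil`). As `c → ∞` times shrink by `A^{-2σ} → 0`, and `Q → 0` almost everywhere. In
the homogeneous case this holds because `Q = κ^{-2σ} c^{m - 2σ(d/2 - s)} P` has a negative power of
`c` when `s < d/2 - m/(2σ)`; for bounded `P` it holds as soon as `s < d/2`. Nothing else about `P`
is used.

When `Q = 0` the solution is `v = a₀ exp(-i lam t |a₀|^{2σ})`. Its `|D|^s` norm is unbounded in time
for every `s > 0` (`exists_homNorm_osc_gt`). Otherwise translating `v(n)` by `y/n` would change it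
by `o(1)` in `L²`, whereas the phase difference has the nontrivial limit `lam ∂_y |a₀|^{2σ}`.

The analytic core is `exists_isSolution_near_ode`: for fixed datum and fixed time, solutions with
symbols tending to `0` exist up to that time and approach `v` in `H^s`. On a ball of `H^ρ`, `d/2 < ρ
< k + 1`, the nonlinearity is replaced by a globally Lipschitz map of `L²` that is bounded linearly
in `H^{k+1}` (`exists_truncation`, from the tame estimate `hs_comp_le`). The Duhamel map then
preserves a closed set given by an exponential `H^{k+1}` bound and a small exponential `L²` distance
to `v`. Interpolation keeps this set inside the `H^ρ` ball, so the truncation is never felt. The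
`L²` error comes only from `exp(itQ) - 1` acting along `v`, which tends to `0` by dominated
convergence; no rate is needed.

In `exists_inflating_solution` the parameters are fixed in order: `κ` makes the data smaller than
`h`, then a time `n` makes `v(n)` large compared with `κ⁻¹ h⁻¹`, then `c` is taken large enough for
the approximation and for the rescaled time to be below `h`. -/

variable {d : ℕ}


/-! ### Sobolev norms through the integral Fourier transform. -/

/-- The square of the Japanese bracket, `1 + |2πξ|²`. -/
def bracket (ξ : Space d) : ℝ := 1 + ‖(2 * Real.pi) • ξ‖ ^ 2

lemma one_le_bracket (ξ : Space d) : 1 ≤ bracket ξ := by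
  unfold bracket; nlinarith [sq_nonneg ‖(2 * Real.pi) • ξ‖]

lemma bracket_pos (ξ : Space d) : 0 < bracket ξ := one_pos.trans_le (one_le_bracket ξ)

lemma continuous_bracket : Continuous (bracket : Space d → ℝ) := by
  unfold bracket; fun_prop

lemma continuous_bracket_rpow (s : ℝ) : Continuous (fun ξ : Space d => bracket ξ ^ s) :=
  continuous_bracket.rpow_const fun ξ => Or.inl (bracket_pos ξ).ne'

lemma eLpNorm_two_sq {α E : Type*} [MeasurableSpace α] [NormedAddCommGroup E] {μ : Measure α}
    (f : α → E) : eLpNorm f 2 μ ^ 2 = ∫⁻ x, ‖f x‖ₑ ^ 2 ∂μ := by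
  rw [eLpNorm_eq_lintegral_rpow_enorm_toReal (by norm_num) (by norm_num), ← ENNReal.rpow_natCast,
    ← ENNReal.rpow_mul]
  simp

/-- The `H^s` norm of an integrable function, through the integral Fourier transform. -/
def hs (s : ℝ) (g : Space d → ℂ) : ℝ≥0∞ :=
  eLpNorm (fun ξ : Space d => ((bracket ξ ^ (s / 2) : ℝ) : ℂ) * 𝓕 g ξ) 2 volume

/-- The `L²` transform and the integral transform define the same distribution: tested against a
smooth compactly supported `φ`, both give `∫ 𝓕φ · g`, by duality of the distributional transform on
one side and Fubini on the other. -/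
lemma fourier_toLp_ae {g : Space d → ℂ} (h1 : Integrable g) (h2 : MemLp g 2) :
    ((𝓕 (h2.toLp g) : L2 d) : Space d → ℂ) =ᵐ[volume] 𝓕 g := by
  have hcont : Continuous (𝓕 g) :=
    VectorFourier.fourierIntegral_continuous Real.continuous_fourierChar
      (by exact continuous_inner) h1
  apply ae_eq_of_integral_contDiff_smul_eq
  · exact (Lp.memLp _).locallyIntegrable (by norm_num)
  · exact hcont.locallyIntegrable
  · intro φ hφ hφc
    have hg₁ : HasCompactSupport (Complex.ofRealCLM ∘ φ) := hφc.comp_left rfl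
    have hg₂ : ContDiff ℝ ((⊤ : ℕ∞) : WithTop ℕ∞) (Complex.ofRealCLM ∘ φ) := by fun_prop
    set Φ : 𝓢(Space d, ℂ) := hg₁.toSchwartzMap hg₂ with hΦ
    have hΦx : ∀ x, Φ x = (φ x : ℂ) := fun x => by simp [hΦ]
    have e1 : ∫ x, φ x • (𝓕 (h2.toLp g) : L2 d) x =
        ((𝓕 (h2.toLp g) : L2 d) : 𝓢'(Space d, ℂ)) Φ := by
      rw [Lp.toTemperedDistribution_apply]; simp [hΦx]
    rw [e1, ← Lp.fourier_toTemperedDistribution_eq, TemperedDistribution.fourier_apply,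
      Lp.toTemperedDistribution_apply]
    have e2 := VectorFourier.integral_fourierIntegral_smul_eq_flip (μ := volume) (ν := volume)
      (L := innerₗ (Space d)) (f := (Φ : Space d → ℂ)) (g := g)
      Real.continuous_fourierChar (by exact continuous_inner) Φ.integrable h1
    rw [flip_innerₗ] at e2
    calc ∫ x, (𝓕 Φ) x • (h2.toLp g : L2 d) x = ∫ x, (𝓕 Φ) x • g x := by
          apply integral_congr_ae
          filter_upwards [h2.coeFn_toLp] with x hx
          rw [hx]
      _ = ∫ x, Φ x • 𝓕 g x := e2
      _ = _ := by simp [hΦx]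

lemma sobolevNorm_toLp {g : Space d → ℂ} (s : ℝ) (h1 : Integrable g) (h2 : MemLp g 2) :
    sobolevNorm s (h2.toLp g : L2 d) = hs s g := by
  apply eLpNorm_congr_ae
  filter_upwards [fourier_toLp_ae h1 h2] with ξ hξ
  rw [hξ]; rfl

lemma sobolevNorm_schwartz (s : ℝ) (f : 𝓢(Space d, ℂ)) :
    sobolevNorm s (f.toLp 2 volume) = hs s f :=
  sobolevNorm_toLp s f.integrable (f.memLp 2 volume)

lemma sobolevNorm_zero (f : L2 d) : sobolevNorm 0 f = ‖f‖ₑ := by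
  have : sobolevNorm 0 f = eLpNorm (𝓕 f : L2 d) 2 volume := by
    simp [sobolevNorm]
  rw [this, ← Lp.enorm_def, ← ofReal_norm, ← ofReal_norm, Lp.norm_fourier_eq]

lemma hs_zero {g : Space d → ℂ} (h1 : Integrable g) (h2 : MemLp g 2) :
    hs 0 g = eLpNorm g 2 volume := by
  rw [← sobolevNorm_toLp 0 h1 h2, sobolevNorm_zero, Lp.enorm_toLp]

lemma continuous_fourier {g : Space d → ℂ} (h1 : Integrable g) : Continuous (𝓕 g) :=
  VectorFourier.fourierIntegral_continuous Real.continuous_fourierChar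
      (by exact continuous_inner) h1

lemma continuous_weight (s : ℝ) : Continuous (fun ξ : Space d => ((bracket ξ ^ s : ℝ) : ℂ)) :=
  Complex.continuous_ofReal.comp (continuous_bracket_rpow s)

lemma aesm_hs (s : ℝ) {g : Space d → ℂ} (h1 : Integrable g) :
    AEStronglyMeasurable (fun ξ : Space d => ((bracket ξ ^ (s / 2) : ℝ) : ℂ) * 𝓕 g ξ) volume :=
  ((continuous_weight _).mul (continuous_fourier h1)).aestronglyMeasurable

lemma fourier_add_apply {f g : Space d → ℂ} (hf : Integrable f) (hg : Integrable g) (ξ : Space d) :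
    𝓕 (fun x => f x + g x) ξ = 𝓕 f ξ + 𝓕 g ξ := by
  have := VectorFourier.fourierIntegral_add (e := Real.fourierChar) (μ := (volume : Measure (Space d)))
    (L := innerₗ (Space d)) Real.continuous_fourierChar (by exact continuous_inner) hf hg
  exact congrFun this ξ

lemma hs_add_le (s : ℝ) {f g : Space d → ℂ} (hf : Integrable f) (hg : Integrable g) :
    hs s (fun x => f x + g x) ≤ hs s f + hs s g := by
  unfold hs
  refine le_trans (le_of_eq ?_) (eLpNorm_add_le (aesm_hs s hf) (aesm_hs s hg) (by norm_num))
  congr 1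
  ext ξ
  simp only [Pi.add_apply]
  rw [fourier_add_apply hf hg]; ring

lemma hs_mono {s s' : ℝ} (h : s ≤ s') (g : Space d → ℂ) : hs s g ≤ hs s' g := by
  apply eLpNorm_mono
  intro ξ
  rw [norm_mul, norm_mul, Complex.norm_real, Complex.norm_real]
  have := bracket_pos ξ
  rw [Real.norm_of_nonneg (by positivity), Real.norm_of_nonneg (by positivity)]
  gcongr
  exact one_le_bracket ξ

lemma fourier_fderiv_apply {g : Space d → ℂ} (h1 : Integrable g) (h2 : Differentiable ℝ g)
    (h3 : Integrable (fderiv ℝ g)) (e ξ : Space d) :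
    𝓕 (fun x => fderiv ℝ g x e) ξ = (2 * Real.pi * Complex.I * (inner ℝ ξ e : ℝ)) * 𝓕 g ξ := by
  rw [← Real.fourier_continuousLinearMap_apply (f := fun x => fderiv ℝ g x) h3]
  have h := congrFun (Real.fourier_fderiv h1 h2 h3) ξ
  have h' : 𝓕 (fun x => fderiv ℝ g x) ξ = 𝓕 (fderiv ℝ g) ξ := rfl
  rw [h', h]
  have h4 : (innerSL ℝ ξ) e = inner ℝ ξ e := rfl
  simp [h4]
  ring


lemma enorm_weight (s : ℝ) (ξ : Space d) :
    ‖((bracket ξ ^ s : ℝ) : ℂ)‖ₑ = ENNReal.ofReal (bracket ξ ^ s) := by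
  rw [← ofReal_norm, Complex.norm_real,
    Real.norm_of_nonneg (Real.rpow_nonneg (bracket_pos ξ).le _)]

lemma weight_sq (s : ℝ) (ξ : Space d) :
    ENNReal.ofReal (bracket ξ ^ (s / 2)) ^ 2 = ENNReal.ofReal (bracket ξ ^ s) := by
  rw [← ENNReal.ofReal_pow (Real.rpow_nonneg (bracket_pos ξ).le _), ← Real.rpow_natCast,
    ← Real.rpow_mul (bracket_pos ξ).le]
  norm_num

lemma hs_sq (s : ℝ) (g : Space d → ℂ) :
    hs s g ^ 2 = ∫⁻ ξ : Space d, ENNReal.ofReal (bracket ξ ^ s) * ‖𝓕 g ξ‖ₑ ^ 2 := by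
  rw [hs, eLpNorm_two_sq]
  congr 1 with ξ
  rw [enorm_mul, mul_pow, enorm_weight, weight_sq]

lemma norm_sq_eq_sum_inner (v : Space d) :
    ‖v‖ ^ 2 = ∑ j : Fin d, (inner ℝ v (EuclideanSpace.single j (1 : ℝ)) : ℝ) ^ 2 := by
  rw [EuclideanSpace.norm_sq_eq]
  simp [EuclideanSpace.inner_single_right]

/-- `(1 + |ζ|²)^{(s+1)/2} ≤ 2^{(s+1)/2} + √2 ∑ⱼ |ζⱼ| (1 + |ζ|²)^{s/2}` with `ζ = 2πξ`. -/
lemma bracket_rpow_succ_le {s : ℝ} (hs0 : 0 ≤ s) (ξ : Space d) :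
    bracket ξ ^ ((s + 1) / 2) ≤ 2 ^ ((s + 1) / 2) +
      2 * ∑ j : Fin d, |2 * Real.pi * inner ℝ ξ (EuclideanSpace.single j (1 : ℝ))|
        * bracket ξ ^ (s / 2) := by
  have hb := bracket_pos ξ
  set N := ‖(2 * Real.pi) • ξ‖ with hN
  have hN0 : 0 ≤ N := norm_nonneg _
  have hbN : bracket ξ = 1 + N ^ 2 := rfl
  have hsum : N ≤ ∑ j : Fin d, |2 * Real.pi * inner ℝ ξ (EuclideanSpace.single j (1 : ℝ))| := by
    have h1 : N ^ 2 = ∑ j : Fin d,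
        |2 * Real.pi * inner ℝ ξ (EuclideanSpace.single j (1 : ℝ))| ^ 2 := by
      rw [hN, norm_sq_eq_sum_inner]
      congr 1 with j
      rw [inner_smul_left, sq_abs]; simp
    have h2 := Finset.sum_sq_le_sq_sum_of_nonneg (s := Finset.univ)
      (f := fun j : Fin d => |2 * Real.pi * inner ℝ ξ (EuclideanSpace.single j (1 : ℝ))|)
      (fun i _ => abs_nonneg _)
    rw [← h1] at h2
    exact (sq_le_sq₀ hN0 (Finset.sum_nonneg fun i _ => abs_nonneg _)).1 h2
  rw [← Finset.sum_mul]
  have hp : 0 ≤ bracket ξ ^ (s / 2) := Real.rpow_nonneg hb.le _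
  -- Low frequencies are absorbed by the constant, since the bracket is at most `2` there. At high
  -- frequencies one factor `bracket ^ (1/2) ≤ 2N` is traded for the `ℓ¹` norm of the frequency.
  by_cases h : N ≤ 1
  · have : bracket ξ ^ ((s + 1) / 2) ≤ 2 ^ ((s + 1) / 2) := by
      apply Real.rpow_le_rpow hb.le _ (by linarith)
      rw [hbN]; nlinarith
    have : 0 ≤ 2 * ((∑ j : Fin d, |2 * Real.pi * inner ℝ ξ (EuclideanSpace.single j (1 : ℝ))|)
        * bracket ξ ^ (s / 2)) := by
      have := hN0.trans hsum
      positivity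
    linarith
  · push Not at h
    have h3 : bracket ξ ^ ((1 : ℝ) / 2) ≤ 2 * N := by
      rw [← Real.sqrt_eq_rpow, Real.sqrt_le_left (by linarith), hbN]
      nlinarith
    have h4 : bracket ξ ^ ((s + 1) / 2) = bracket ξ ^ ((1 : ℝ) / 2) * bracket ξ ^ (s / 2) := by
      rw [← Real.rpow_add hb]; congr 1; ring
    rw [h4]
    have h5 : (0 : ℝ) ≤ 2 ^ ((s + 1) / 2) := by positivity
    have : bracket ξ ^ ((1 : ℝ) / 2) * bracket ξ ^ (s / 2) ≤ 2 * N * bracket ξ ^ (s / 2) := by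
      gcongr
    have : 2 * N * bracket ξ ^ (s / 2) ≤
      2 * ((∑ j : Fin d, |2 * Real.pi * inner ℝ ξ (EuclideanSpace.single j (1 : ℝ))|)
        * bracket ξ ^ (s / 2)) := by
      rw [mul_assoc]; gcongr
    linarith


/-- The `j`-th basis vector of `ℝ^d`. -/
def basisVec (j : Fin d) : Space d := EuclideanSpace.single j (1 : ℝ)

/-- Multiply `bracket_rpow_succ_le` by `|𝓕 g|` and read `2πξⱼ 𝓕 g` as the transform of a partial
derivative. This drives the inductions on the order `k`. It is stated for merely differentiable `g`
because `F(u)` is not Schwartz. -/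
lemma hs_succ_le {s : ℝ} (hs0 : 0 ≤ s) {g : Space d → ℂ} (h1 : Integrable g)
    (h2 : Differentiable ℝ g) (h3 : Integrable (fderiv ℝ g)) :
    hs (s + 1) g ≤ ENNReal.ofReal (2 ^ ((s + 1) / 2)) * hs 0 g +
      2 * ∑ j : Fin d, hs s (fun x => fderiv ℝ g x (basisVec j)) := by
  have h4 : ∀ j : Fin d, Integrable (fun x => fderiv ℝ g x (basisVec j)) := fun j =>
    h3.apply_continuousLinearMap _
  set A : ℝ := 2 ^ ((s + 1) / 2) with hA
  have hA0 : 0 ≤ A := by positivity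
  set G : Fin d → Space d → ℂ := fun j ξ => (((bracket ξ ^ (s / 2) : ℝ) : ℂ) *
    𝓕 (fun x => fderiv ℝ g x (basisVec j)) ξ) with hG
  set G' : Fin d → Space d → ℝ := fun j ξ => ‖G j ξ‖ with hG'
  have hGm : ∀ j, AEStronglyMeasurable (G' j) volume := fun j => (aesm_hs s (h4 j)).norm
  have h0m : AEStronglyMeasurable (fun ξ => A * ‖𝓕 g ξ‖) volume :=
    ((continuous_fourier h1).norm.const_mul A).aestronglyMeasurable
  calc hs (s + 1) g ≤ eLpNorm ((fun ξ => A * ‖𝓕 g ξ‖) + (2 : ℝ) • ∑ j, G' j) 2 volume := by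
        apply eLpNorm_mono_real
        intro ξ
        have hb := bracket_pos ξ
        rw [norm_mul, Complex.norm_real, Real.norm_of_nonneg (by positivity)]
        simp only [Pi.add_apply, Pi.smul_apply, Finset.sum_apply, smul_eq_mul, hG', hG]
        have hterm : ∀ j : Fin d, ‖((bracket ξ ^ (s / 2) : ℝ) : ℂ) *
            𝓕 (fun x => fderiv ℝ g x (basisVec j)) ξ‖ =
            |2 * Real.pi * inner ℝ ξ (EuclideanSpace.single j (1 : ℝ))|
              * bracket ξ ^ (s / 2) * ‖𝓕 g ξ‖ := by
          intro j
          rw [fourier_fderiv_apply h1 h2 h3, norm_mul, norm_mul, Complex.norm_real,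
            Real.norm_of_nonneg (by positivity)]
          have : ‖(2 * Real.pi * Complex.I * (inner ℝ ξ (basisVec j) : ℝ) : ℂ)‖ =
            |2 * Real.pi * inner ℝ ξ (EuclideanSpace.single j (1 : ℝ))| := by
            simp [basisVec, abs_mul]
          rw [this]; ring
        simp_rw [hterm]
        rw [← Finset.sum_mul, ← mul_assoc, ← add_mul]
        gcongr
        exact bracket_rpow_succ_le hs0 ξ
    _ ≤ eLpNorm (fun ξ => A * ‖𝓕 g ξ‖) 2 volume + eLpNorm ((2 : ℝ) • ∑ j, G' j) 2 volume :=
        eLpNorm_add_le h0m ((Finset.aestronglyMeasurable_sum _ fun j _ => hGm j).const_smul _)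
          (by norm_num)
    _ ≤ _ := by
        gcongr
        · have : (fun ξ => A * ‖𝓕 g ξ‖) = A • (fun ξ => ‖𝓕 g ξ‖) := rfl
          rw [this, eLpNorm_const_smul, eLpNorm_norm, ← ofReal_norm, Real.norm_of_nonneg hA0]
          simp [hs]
        · rw [eLpNorm_const_smul]
          gcongr
          · rw [← ofReal_norm]; simp
          · refine (eLpNorm_sum_le (fun j _ => hGm j) (by norm_num)).trans ?_
            apply le_of_eq
            congr 1 with j
            rw [hG']; simp only; rw [eLpNorm_norm]; rfl

/-- The converse direction to `hs_succ_le`: `|2πξⱼ| ≤ bracket ^ (1/2)`. -/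
lemma hs_lineDeriv_le (s : ℝ) (f : 𝓢(Space d, ℂ)) (j : Fin d) :
    hs s (fun x => fderiv ℝ f x (basisVec j)) ≤ hs (s + 1) f := by
  apply eLpNorm_mono
  intro ξ
  have hf' : Integrable (fderiv ℝ f) := (SchwartzMap.fderivCLM ℝ (Space d) ℂ f).integrable
  have hb := bracket_pos ξ
  rw [fourier_fderiv_apply f.integrable f.differentiable hf', ← mul_assoc,
    norm_mul _ (𝓕 (f : Space d → ℂ) ξ), norm_mul _ (𝓕 (f : Space d → ℂ) ξ), norm_mul ((bracket ξ ^ (s / 2) : ℝ) : ℂ),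
    Complex.norm_real, Complex.norm_real, Real.norm_of_nonneg (by positivity),
    Real.norm_of_nonneg (by positivity)]
  gcongr
  have h1 : ‖(2 * Real.pi * Complex.I * (inner ℝ ξ (basisVec j) : ℝ) : ℂ)‖ ≤
      bracket ξ ^ ((1 : ℝ) / 2) := by
    have e : ‖(2 * Real.pi * Complex.I * (inner ℝ ξ (basisVec j) : ℝ) : ℂ)‖ =
        |inner ℝ ((2 * Real.pi) • ξ) (basisVec j)| := by
      rw [inner_smul_left]
      simp [abs_mul]
    rw [e, ← Real.sqrt_eq_rpow]
    apply Real.le_sqrt_of_sq_le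
    have h := abs_real_inner_le_norm ((2 * Real.pi) • ξ) (basisVec j)
    have h' : ‖basisVec j‖ = 1 := by simp [basisVec]
    rw [h', mul_one] at h
    unfold bracket
    nlinarith [abs_nonneg (inner ℝ ((2 * Real.pi) • ξ) (basisVec j))]
  calc _ ≤ bracket ξ ^ (s / 2) * bracket ξ ^ ((1 : ℝ) / 2) := by gcongr
    _ = _ := by rw [← Real.rpow_add hb]; congr 1; ring

lemma fourier_conj_apply (g : Space d → ℂ) (ξ : Space d) :
    𝓕 (fun x => (starRingEnd ℂ) (g x)) ξ = (starRingEnd ℂ) (𝓕 g (-ξ)) := by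
  rw [Real.fourier_eq', Real.fourier_eq', ← integral_conj]
  congr 1 with x
  simp only [smul_eq_mul, map_mul, ← Complex.exp_conj]
  congr 2
  simp [show (starRingEnd ℂ) 2 = 2 from Complex.conj_ofNat 2]

lemma hs_conj (s : ℝ) (g : Space d → ℂ) :
    hs s (fun x => (starRingEnd ℂ) (g x)) = hs s g := by
  have h : hs s (fun x => (starRingEnd ℂ) (g x)) ^ 2 = hs s g ^ 2 := by
    rw [hs_sq, hs_sq, ← lintegral_neg_eq_self]
    congr 1 with ξ
    rw [fourier_conj_apply, neg_neg]
    congr 2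
    · simp [bracket]
    · rw [← ofReal_norm, ← ofReal_norm, RCLike.norm_conj]
  exact (ENNReal.pow_right_strictMono two_ne_zero).injective h

/-! ### Sobolev embedding and product law for Schwartz functions. -/

/-- Integrability constant of the Sobolev embedding. -/
def bracketMass (d : ℕ) (ρ : ℝ) : ℝ≥0∞ := ∫⁻ ξ : Space d, ENNReal.ofReal (bracket ξ ^ (-ρ))

lemma bracketMass_lt_top {ρ : ℝ} (hρ : (d : ℝ) / 2 < ρ) : bracketMass d ρ < ∞ := by
  have h : Integrable (fun x : Space d => ((1 : ℝ) + ‖x‖ ^ 2) ^ (-(2 * ρ) / 2)) volume :=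
    integrable_rpow_neg_one_add_norm_sq (by simp; linarith)
  have h2 := (h.comp_smul (R := 2 * Real.pi) (by positivity)).lintegral_lt_top
  unfold bracketMass bracket
  convert h2 using 5
  ring

lemma norm_schwartz_le (f : 𝓢(Space d, ℂ)) (x : Space d) :
    ‖f x‖ₑ ≤ ∫⁻ ξ, ‖𝓕 (f : Space d → ℂ) ξ‖ₑ := by
  have h : f x = 𝓕⁻ (𝓕 (f : Space d → ℂ)) x := by
    have := congrArg (fun g : 𝓢(Space d, ℂ) => g x) 
      (FourierTransform.fourierInv_fourier_eq (F := 𝓢(Space d, ℂ)) f)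
    rw [← this]
    simp only [SchwartzMap.fourierInv_coe, SchwartzMap.fourier_coe]
  rw [h, Real.fourierInv_eq]
  refine (enorm_integral_le_lintegral_enorm _).trans (le_of_eq ?_)
  congr 1 with ξ
  rw [← ofReal_norm, ← ofReal_norm, Circle.norm_smul]

lemma lintegral_mul_sq_le {α : Type*} [MeasurableSpace α] {μ : Measure α} {f g : α → ℝ≥0∞}
    (hf : AEMeasurable f μ) (hg : AEMeasurable g μ) :
    (∫⁻ x, f x * g x ∂μ) ^ 2 ≤ (∫⁻ x, f x ^ 2 ∂μ) * ∫⁻ x, g x ^ 2 ∂μ := by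
  have h := ENNReal.lintegral_mul_le_Lp_mul_Lq μ Real.HolderConjugate.two_two hf hg
  simp only [Pi.mul_apply] at h
  calc _ ≤ ((∫⁻ x, f x ^ (2 : ℝ) ∂μ) ^ (1 / (2 : ℝ)) *
        (∫⁻ x, g x ^ (2 : ℝ) ∂μ) ^ (1 / (2 : ℝ))) ^ 2 := by gcongr
    _ = _ := by
      rw [mul_pow, ← ENNReal.rpow_natCast, ← ENNReal.rpow_natCast, ← ENNReal.rpow_mul,
        ← ENNReal.rpow_mul]
      norm_num

lemma sup_schwartz_le (ρ : ℝ) (f : 𝓢(Space d, ℂ)) (x : Space d) :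
    ‖f x‖ₑ ^ 2 ≤ bracketMass d ρ * hs ρ f ^ 2 := by
  have hm : Measurable (fun ξ : Space d => ENNReal.ofReal (bracket ξ ^ (ρ / 2)) *
      ‖𝓕 (f : Space d → ℂ) ξ‖ₑ) :=
    ((continuous_bracket_rpow _).measurable.ennreal_ofReal).mul
      (continuous_fourier f.integrable).measurable.enorm
  calc ‖f x‖ₑ ^ 2 ≤ (∫⁻ ξ, ‖𝓕 (f : Space d → ℂ) ξ‖ₑ) ^ 2 := by
        gcongr; exact norm_schwartz_le f x
    _ = (∫⁻ ξ : Space d, ENNReal.ofReal (bracket ξ ^ (-ρ / 2)) *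
          (ENNReal.ofReal (bracket ξ ^ (ρ / 2)) * ‖𝓕 (f : Space d → ℂ) ξ‖ₑ)) ^ 2 := by
        congr 2 with ξ
        have hb := bracket_pos ξ
        rw [← mul_assoc, ← ENNReal.ofReal_mul (by positivity), ← Real.rpow_add hb]
        ring_nf; simp
    _ ≤ _ := by
        refine (lintegral_mul_sq_le
          (continuous_bracket_rpow _).measurable.ennreal_ofReal.aemeasurable
          hm.aemeasurable).trans (le_of_eq ?_)
        rw [hs_sq, bracketMass]
        simp_rw [mul_pow, weight_sq]


/-- The convolution formula follows from the duality `∫ 𝓕φ · ψ = ∫ φ · 𝓕ψ`, applied to `f` modulated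
by the character of frequency `ξ` and to `ψ = 𝓕⁻ g`. -/
lemma fourier_mul_apply (f g : 𝓢(Space d, ℂ)) (ξ : Space d) :
    𝓕 (fun x => f x * g x) ξ =
      ∫ η, 𝓕 (f : Space d → ℂ) (ξ - η) * 𝓕 (g : Space d → ℂ) η := by
  set φ : Space d → ℂ := fun x => Real.fourierChar (-inner ℝ x ξ) • f x with hφ
  have hφi : Integrable φ := (Real.fourierIntegral_convergent_iff ξ).2 f.integrable
  have hgi : 𝓕 ((𝓕⁻ g : 𝓢(Space d, ℂ)) : Space d → ℂ) = g := by
    rw [← SchwartzMap.fourier_coe, FourierTransform.fourier_fourierInv_eq]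
  have key := VectorFourier.integral_fourierIntegral_smul_eq_flip (μ := volume) (ν := volume)
      (L := innerₗ (Space d)) (f := φ) (g := ((𝓕⁻ g : 𝓢(Space d, ℂ)) : Space d → ℂ))
      Real.continuous_fourierChar (by exact continuous_inner) hφi (𝓕⁻ g).integrable
  rw [flip_innerₗ] at key
  have key' : ∫ η, 𝓕 φ η * (𝓕⁻ g : 𝓢(Space d, ℂ)) η = ∫ x, φ x * g x := by
    rw [← hgi]; exact key
  have h1 : ∀ η, 𝓕 φ η = 𝓕 (f : Space d → ℂ) (ξ + η) := by
    intro η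
    rw [Real.fourier_eq, Real.fourier_eq]
    congr 1 with x
    simp only [hφ, smul_smul, inner_add_right, neg_add, AddChar.map_add_eq_mul]
    rw [mul_comm]
  have h2 : ∀ η, (𝓕⁻ g : 𝓢(Space d, ℂ)) η = 𝓕 (g : Space d → ℂ) (-η) := by
    intro η
    rw [SchwartzMap.fourierInv_coe, Real.fourierInv_eq_fourier_neg]
  calc 𝓕 (fun x => f x * g x) ξ = ∫ x, φ x * g x := by
        rw [Real.fourier_eq]
        congr 1 with x
        simp [hφ, Circle.smul_def, mul_assoc]
    _ = ∫ η, 𝓕 (f : Space d → ℂ) (ξ + η) * 𝓕 (g : Space d → ℂ) (-η) := by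
        rw [← key']; simp_rw [h1, h2]
    _ = _ := by
        rw [← integral_neg_eq_self]
        simp [sub_eq_add_neg]

lemma bracket_le (ξ η : Space d) : bracket ξ ≤ 4 * max (bracket (ξ - η)) (bracket η) := by
  have h1 : ‖(2 * Real.pi) • ξ‖ ≤ ‖(2 * Real.pi) • (ξ - η)‖ + ‖(2 * Real.pi) • η‖ := by
    refine le_trans (le_of_eq ?_) (norm_add_le _ _)
    rw [← smul_add, sub_add_cancel]
  have h2 := le_max_left (bracket (ξ - η)) (bracket η)
  have h3 := le_max_right (bracket (ξ - η)) (bracket η)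
  have h4 : bracket ξ ≤ 2 * bracket (ξ - η) + 2 * bracket η := by
    unfold bracket
    have := norm_nonneg ((2 * Real.pi) • ξ)
    nlinarith [sq_nonneg (‖(2 * Real.pi) • (ξ - η)‖ - ‖(2 * Real.pi) • η‖)]
  linarith

/-- Negative powers decrease, so the larger of `X`, `Y` may be replaced by the smaller. The mixed
kernel becomes a sum of functions of one variable, whose integrals do not depend on `ξ`. -/
lemma bracket_kernel_aux {X Y a b : ℝ} (hX : 1 ≤ X) (hY : 1 ≤ Y) (ha : 0 ≤ a) (hb : 0 ≤ b) :
    X ^ (-a) * Y ^ (-b) ≤ X ^ (-(a + b)) + Y ^ (-(a + b)) := by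
  have hX0 : 0 < X := by linarith
  have hY0 : 0 < Y := by linarith
  rcases le_total X Y with h | h
  · have : Y ^ (-b) ≤ X ^ (-b) := Real.rpow_le_rpow_of_nonpos hX0 h (by linarith)
    calc _ ≤ X ^ (-a) * X ^ (-b) := by gcongr
      _ = X ^ (-(a + b)) := by rw [← Real.rpow_add hX0]; congr 1; ring
      _ ≤ _ := by linarith [Real.rpow_nonneg hY0.le (-(a + b))]
  · have : X ^ (-a) ≤ Y ^ (-a) := Real.rpow_le_rpow_of_nonpos hY0 h (by linarith)
    calc _ ≤ Y ^ (-a) * Y ^ (-b) := by gcongr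
      _ = Y ^ (-(a + b)) := by rw [← Real.rpow_add hY0]; congr 1; ring
      _ ≤ _ := by linarith [Real.rpow_nonneg hX0.le (-(a + b))]

/-- By `bracket_le` the weight `bracket ξ ^ k` falls on one of the two factors and lowers its decay
from `sᵢ` to `sᵢ - k ≥ 0`. The total decay is `s₁ + s₂ - k` in either case. -/
lemma bracket_kernel_le {k s₁ s₂ : ℝ} (hk : 0 ≤ k) (h₁ : k ≤ s₁) (h₂ : k ≤ s₂) (ξ η : Space d) :
    bracket ξ ^ k * (bracket (ξ - η) ^ (-s₁) * bracket η ^ (-s₂)) ≤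
      2 * 4 ^ k * (bracket (ξ - η) ^ (-(s₁ + s₂ - k)) + bracket η ^ (-(s₁ + s₂ - k))) := by
  set X := bracket (ξ - η) with hX
  set Y := bracket η with hY
  have hX1 : 1 ≤ X := one_le_bracket _
  have hY1 : 1 ≤ Y := one_le_bracket _
  have hX0 : 0 < X := by linarith
  have hY0 : 0 < Y := by linarith
  have e1 : bracket ξ ^ k ≤ 4 ^ k * (X ^ k + Y ^ k) := by
    calc bracket ξ ^ k ≤ (4 * max X Y) ^ k :=
          Real.rpow_le_rpow (bracket_pos ξ).le (bracket_le ξ η) hk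
      _ = 4 ^ k * (max X Y) ^ k := Real.mul_rpow (by norm_num) (by positivity)
      _ ≤ _ := by
        gcongr
        rcases max_choice X Y with h | h <;> rw [h]
        · linarith [Real.rpow_nonneg hY0.le k]
        · linarith [Real.rpow_nonneg hX0.le k]
  have e2 : X ^ k * (X ^ (-s₁) * Y ^ (-s₂)) ≤ X ^ (-(s₁ + s₂ - k)) + Y ^ (-(s₁ + s₂ - k)) := by
    have := bracket_kernel_aux hX1 hY1 (a := s₁ - k) (b := s₂) (by linarith) (by linarith)
    rw [show s₁ - k + s₂ = s₁ + s₂ - k by ring] at this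
    rwa [← mul_assoc, ← Real.rpow_add hX0, show k + -s₁ = -(s₁ - k) by ring]
  have e3 : Y ^ k * (X ^ (-s₁) * Y ^ (-s₂)) ≤ X ^ (-(s₁ + s₂ - k)) + Y ^ (-(s₁ + s₂ - k)) := by
    have := bracket_kernel_aux hX1 hY1 (a := s₁) (b := s₂ - k) (by linarith) (by linarith)
    rw [show s₁ + (s₂ - k) = s₁ + s₂ - k by ring] at this
    rwa [mul_left_comm, ← Real.rpow_add hY0, show k + -s₂ = -(s₂ - k) by ring]
  calc _ ≤ 4 ^ k * (X ^ k + Y ^ k) * (X ^ (-s₁) * Y ^ (-s₂)) := by gcongr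
    _ = 4 ^ k * (X ^ k * (X ^ (-s₁) * Y ^ (-s₂)) + Y ^ k * (X ^ (-s₁) * Y ^ (-s₂))) := by ring
    _ ≤ 4 ^ k * ((X ^ (-(s₁ + s₂ - k)) + Y ^ (-(s₁ + s₂ - k))) +
        (X ^ (-(s₁ + s₂ - k)) + Y ^ (-(s₁ + s₂ - k)))) := by gcongr
    _ = _ := by ring

lemma lintegral_bracket_kernel_le {k s₁ s₂ : ℝ} (hk : 0 ≤ k) (h₁ : k ≤ s₁) (h₂ : k ≤ s₂)
    (ξ : Space d) :
    ∫⁻ η : Space d, ENNReal.ofReal (bracket ξ ^ k * (bracket (ξ - η) ^ (-s₁) * bracket η ^ (-s₂)))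
      ≤ ENNReal.ofReal (4 * 4 ^ k) * bracketMass d (s₁ + s₂ - k) := by
  have hm : Measurable fun η : Space d => ENNReal.ofReal (bracket η ^ (-(s₁ + s₂ - k))) :=
    (continuous_bracket_rpow _).measurable.ennreal_ofReal
  calc _ ≤ ∫⁻ η : Space d, ENNReal.ofReal (2 * 4 ^ k) *
        (ENNReal.ofReal (bracket (ξ - η) ^ (-(s₁ + s₂ - k))) +
          ENNReal.ofReal (bracket η ^ (-(s₁ + s₂ - k)))) := by
        apply lintegral_mono
        intro η
        dsimp only
        rw [← ENNReal.ofReal_add (Real.rpow_nonneg (bracket_pos _).le _)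
          (Real.rpow_nonneg (bracket_pos _).le _), ← ENNReal.ofReal_mul (by positivity)]
        exact ENNReal.ofReal_le_ofReal (bracket_kernel_le hk h₁ h₂ ξ η)
    _ = ENNReal.ofReal (2 * 4 ^ k) * (bracketMass d (s₁ + s₂ - k) + bracketMass d (s₁ + s₂ - k)) := by
        rw [lintegral_const_mul _
            (by exact (hm.comp (measurable_const.sub measurable_id)).add hm),
          lintegral_add_right _ hm]
        congr 2
        exact lintegral_sub_left_eq_self
          (fun η : Space d => ENNReal.ofReal (bracket η ^ (-(s₁ + s₂ - k)))) ξ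
    _ = _ := by
        rw [← two_mul, ← mul_assoc, show (4 : ℝ) * 4 ^ k = 2 * 4 ^ k * 2 by ring,
          ENNReal.ofReal_mul (p := 2 * 4 ^ k) (by positivity)]
        simp

/-- The product law `H^{s₁} · H^{s₂} ⊂ H^k` for `k ≤ s₁, s₂` and `s₁ + s₂ - k > d/2`. -/
lemma hs_mul_sq_le {k s₁ s₂ : ℝ} (hk : 0 ≤ k) (h₁ : k ≤ s₁) (h₂ : k ≤ s₂)
    (f g : 𝓢(Space d, ℂ)) :
    hs k (fun x => f x * g x) ^ 2 ≤ ENNReal.ofReal (4 * 4 ^ k) * bracketMass d (s₁ + s₂ - k) *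
      (hs s₁ f ^ 2 * hs s₂ g ^ 2) := by
  set A : Space d → ℝ≥0∞ := fun ξ =>
    ENNReal.ofReal (bracket ξ ^ s₁) * ‖𝓕 (f : Space d → ℂ) ξ‖ₑ ^ 2 with hA
  set B : Space d → ℝ≥0∞ := fun ξ =>
    ENNReal.ofReal (bracket ξ ^ s₂) * ‖𝓕 (g : Space d → ℂ) ξ‖ₑ ^ 2 with hB
  have hfm := (continuous_fourier f.integrable).measurable
  have hgm := (continuous_fourier g.integrable).measurable
  have hbm : ∀ s : ℝ, Measurable fun η : Space d => bracket η ^ s := fun s =>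
    (continuous_bracket_rpow s).measurable
  have hAm : Measurable A := (hbm s₁).ennreal_ofReal.mul (hfm.enorm.pow_const 2)
  have hBm : Measurable B := (hbm s₂).ennreal_ofReal.mul (hgm.enorm.pow_const 2)
  have hpt : ∀ ξ : Space d, ENNReal.ofReal (bracket ξ ^ k) * ‖𝓕 (fun x => f x * g x) ξ‖ₑ ^ 2 ≤
      ENNReal.ofReal (4 * 4 ^ k) * bracketMass d (s₁ + s₂ - k) * ∫⁻ η, A (ξ - η) * B η := by
    intro ξ
    -- Cauchy–Schwarz in the convolution variable, after inserting the weights of `H^{s₁}` and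
    -- `H^{s₂}`. The integral of inverse weights, times `bracket ξ ^ k`, is bounded uniformly in
    -- `ξ`; the integral of `A(ξ - η) B(η)` factorises by Tonelli.
    have hcs : ‖𝓕 (fun x => f x * g x) ξ‖ₑ ^ 2 ≤
        (∫⁻ η : Space d, ENNReal.ofReal (bracket (ξ - η) ^ (-s₁) * bracket η ^ (-s₂))) *
          ∫⁻ η, A (ξ - η) * B η := by
      rw [fourier_mul_apply]
      calc _ ≤ (∫⁻ η, ‖𝓕 (f : Space d → ℂ) (ξ - η) * 𝓕 (g : Space d → ℂ) η‖ₑ) ^ 2 := by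
            gcongr; exact enorm_integral_le_lintegral_enorm _
        _ = (∫⁻ η : Space d,
              ENNReal.ofReal (bracket (ξ - η) ^ (-s₁ / 2) * bracket η ^ (-s₂ / 2)) *
              (ENNReal.ofReal (bracket (ξ - η) ^ (s₁ / 2) * bracket η ^ (s₂ / 2)) *
              (‖𝓕 (f : Space d → ℂ) (ξ - η)‖ₑ * ‖𝓕 (g : Space d → ℂ) η‖ₑ))) ^ 2 := by
            congr 2 with η
            have hx := bracket_pos (ξ - η)
            have hy := bracket_pos η
            rw [enorm_mul, ← mul_assoc, ← ENNReal.ofReal_mul (by positivity),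
              mul_mul_mul_comm, ← Real.rpow_add hx, ← Real.rpow_add hy]
            ring_nf; simp
        _ ≤ _ := by
            refine (lintegral_mul_sq_le (Measurable.aemeasurable ?_)
              (Measurable.aemeasurable ?_)).trans (le_of_eq ?_)
            · exact (((hbm _).comp (measurable_const.sub measurable_id)).mul
                (hbm _)).ennreal_ofReal
            · exact (((hbm _).comp (measurable_const.sub measurable_id)).mul
                (hbm _)).ennreal_ofReal.mul
                ((hfm.comp (measurable_const.sub measurable_id)).enorm.mul hgm.enorm)
            · congr 2 with η
              · have hx := bracket_pos (ξ - η)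
                have hy := bracket_pos η
                rw [ENNReal.ofReal_mul (by positivity), mul_pow, weight_sq, weight_sq,
                  ENNReal.ofReal_mul (by positivity)]
              · have hx := bracket_pos (ξ - η)
                have hy := bracket_pos η
                rw [mul_pow, ENNReal.ofReal_mul (by positivity), mul_pow, weight_sq, weight_sq,
                  mul_pow]
                simp only [hA, hB]
                ring
    calc _ ≤ ENNReal.ofReal (bracket ξ ^ k) *
          ((∫⁻ η : Space d, ENNReal.ofReal (bracket (ξ - η) ^ (-s₁) * bracket η ^ (-s₂))) *
          ∫⁻ η, A (ξ - η) * B η) := by gcongr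
      _ = (∫⁻ η : Space d,
            ENNReal.ofReal (bracket ξ ^ k * (bracket (ξ - η) ^ (-s₁) * bracket η ^ (-s₂)))) *
          ∫⁻ η, A (ξ - η) * B η := by
          rw [← mul_assoc, ← lintegral_const_mul' (ENNReal.ofReal (bracket ξ ^ k)) _
            ENNReal.ofReal_ne_top]
          simp_rw [ENNReal.ofReal_mul (Real.rpow_nonneg (bracket_pos ξ).le k)]
      _ ≤ _ := by
          gcongr
          exact lintegral_bracket_kernel_le hk h₁ h₂ ξ
  rw [hs_sq]
  refine (lintegral_mono hpt).trans (le_of_eq ?_)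
  have hABm : Measurable (Function.uncurry fun ξ η : Space d => A (ξ - η) * B η) :=
    (hAm.comp (measurable_fst.sub measurable_snd)).mul (hBm.comp measurable_snd)
  rw [lintegral_const_mul _ (by exact hABm.lintegral_prod_right'),
    lintegral_lintegral_swap hABm.aemeasurable]
  congr 1
  have : ∀ η : Space d, ∫⁻ ξ, A (ξ - η) * B η = (∫⁻ ξ, A ξ) * B η := by
    intro η
    rw [lintegral_mul_const _ (by exact hAm.comp (measurable_id.sub measurable_const)),
      lintegral_sub_right_eq_self]
  simp_rw [this]
  rw [lintegral_const_mul _ hBm, hs_sq, hs_sq]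

/-- Constant of the product law. -/
def prodConst (d : ℕ) (k ρ : ℝ) : ℝ≥0∞ :=
  (ENNReal.ofReal (4 * 4 ^ k) * bracketMass d ρ) ^ ((1 : ℝ) / 2)

lemma prodConst_ne_top {k ρ : ℝ} (hρ : (d : ℝ) / 2 < ρ) : prodConst d k ρ ≠ ∞ :=
  ENNReal.rpow_ne_top_of_nonneg (by norm_num)
    (ENNReal.mul_ne_top ENNReal.ofReal_ne_top (bracketMass_lt_top hρ).ne)

lemma hs_mul_le {k s₁ s₂ : ℝ} (hk : 0 ≤ k) (h₁ : k ≤ s₁) (h₂ : k ≤ s₂)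
    (f g : 𝓢(Space d, ℂ)) :
    hs k (fun x => f x * g x) ≤ prodConst d k (s₁ + s₂ - k) * (hs s₁ f * hs s₂ g) := by
  have h := hs_mul_sq_le hk h₁ h₂ f g
  have e : prodConst d k (s₁ + s₂ - k) ^ 2 =
      ENNReal.ofReal (4 * 4 ^ k) * bracketMass d (s₁ + s₂ - k) := by
    rw [prodConst, ← ENNReal.rpow_natCast, ← ENNReal.rpow_mul]; norm_num
  rw [← e, ← mul_pow, ← mul_pow] at h
  exact (ENNReal.pow_right_strictMono two_ne_zero).le_iff_le.1 h


/-! ### Composition and multiplication estimates for smooth functions of `u`. -/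

/-- The real-linear map `w ↦ α w + β w̄`. -/
def wirtinger (α β : ℂ) : ℂ →L[ℝ] ℂ :=
  α • (ContinuousLinearMap.id ℝ ℂ) + β • (Complex.conjCLE : ℂ →L[ℝ] ℂ)

@[simp] lemma wirtinger_apply (α β w : ℂ) :
    wirtinger α β w = α * w + β * (starRingEnd ℂ) w := by
  simp [wirtinger]

lemma norm_wirtinger_le (α β : ℂ) : ‖wirtinger α β‖ ≤ ‖α‖ + ‖β‖ := by
  apply ContinuousLinearMap.opNorm_le_bound _ (by positivity)
  intro w
  rw [wirtinger_apply, add_mul]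
  refine (norm_add_le _ _).trans (le_of_eq ?_)
  rw [norm_mul, norm_mul, RCLike.norm_conj]

lemma continuous_wirtinger {X : Type*} [TopologicalSpace X] {α β : X → ℂ} (hα : Continuous α)
    (hβ : Continuous β) : Continuous fun x => wirtinger (α x) (β x) := by
  unfold wirtinger
  fun_prop

/-- `F` is `k` times continuously real-differentiable, and it and its iterated Wirtinger derivatives
up to order `k` are bounded by `B` on the disc of radius `M`. -/
def RegBound (M B : ℝ) : ℕ → (ℂ → ℂ) → Prop
  | 0, F => Continuous F ∧ ∀ z, ‖z‖ ≤ M → ‖F z‖ ≤ B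
  | k + 1, F => (Continuous F ∧ ∀ z, ‖z‖ ≤ M → ‖F z‖ ≤ B) ∧
      ∃ α β : ℂ → ℂ, (∀ z, HasFDerivAt F (wirtinger (α z) (β z)) z) ∧
        RegBound M B k α ∧ RegBound M B k β

lemma RegBound.zero {M B : ℝ} {k : ℕ} {F : ℂ → ℂ} (h : RegBound M B k F) :
    Continuous F ∧ ∀ z, ‖z‖ ≤ M → ‖F z‖ ≤ B := by
  cases k with
  | zero => exact h
  | succ k => exact h.1

lemma RegBound.of_succ {M B : ℝ} {k : ℕ} {F : ℂ → ℂ} (h : RegBound M B (k + 1) F) :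
    RegBound M B k F := by
  induction k generalizing F with
  | zero => exact h.1
  | succ k ih =>
    obtain ⟨h0, α, β, hder, hα, hβ⟩ := h
    exact ⟨h0, α, β, hder, ih hα, ih hβ⟩

/-- The product of Schwartz functions. -/
def smul𝓢 (f g : 𝓢(Space d, ℂ)) : 𝓢(Space d, ℂ) :=
  SchwartzMap.pairing (ContinuousLinearMap.mul ℂ ℂ) f g

@[simp] lemma smul𝓢_apply (f g : 𝓢(Space d, ℂ)) (x : Space d) : smul𝓢 f g x = f x * g x := by
  simp [smul𝓢, SchwartzMap.pairing_apply_apply]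

/-- The complex conjugate of a Schwartz function. -/
def conj𝓢 (f : 𝓢(Space d, ℂ)) : 𝓢(Space d, ℂ) :=
  SchwartzMap.postcompCLM (𝕜 := ℝ) (Complex.conjCLE : ℂ →L[ℝ] ℂ) f

@[simp] lemma conj𝓢_apply (f : 𝓢(Space d, ℂ)) (x : Space d) :
    conj𝓢 f x = (starRingEnd ℂ) (f x) := by
  simp [conj𝓢]

/-- The `j`-th partial derivative of a Schwartz function. -/
def partial𝓢 (j : Fin d) (f : 𝓢(Space d, ℂ)) : 𝓢(Space d, ℂ) :=
  SchwartzMap.evalCLM ℝ (Space d) ℂ (basisVec j) (SchwartzMap.fderivCLM ℝ (Space d) ℂ f)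

@[simp] lemma partial𝓢_apply (j : Fin d) (f : 𝓢(Space d, ℂ)) (x : Space d) :
    partial𝓢 j f x = fderiv ℝ f x (basisVec j) := rfl

lemma integrable_comp_mul {M B : ℝ} {F : ℂ → ℂ} (hF : Continuous F)
    (hB : ∀ z, ‖z‖ ≤ M → ‖F z‖ ≤ B) (u f : 𝓢(Space d, ℂ)) (hu : ∀ x, ‖u x‖ ≤ M) :
    Integrable (fun x => F (u x) * f x) :=
  f.integrable.bdd_mul (c := B) (hF.comp u.continuous).aestronglyMeasurable
    (Eventually.of_forall fun x => hB _ (hu x))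

lemma memLp_comp_mul {M B : ℝ} {F : ℂ → ℂ} (hF : Continuous F)
    (hB : ∀ z, ‖z‖ ≤ M → ‖F z‖ ≤ B) (u f : 𝓢(Space d, ℂ)) (hu : ∀ x, ‖u x‖ ≤ M) :
    MemLp (fun x => F (u x) * f x) 2 := by
  refine (f.memLp 2 volume).of_le_mul (c := B)
    ((hF.comp u.continuous).mul f.continuous).aestronglyMeasurable
    (Eventually.of_forall fun x => ?_)
  rw [norm_mul]
  gcongr
  exact hB _ (hu x)

lemma hs_zero_comp_mul_le {M B : ℝ} {F : ℂ → ℂ} (hF : Continuous F)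
    (hB : ∀ z, ‖z‖ ≤ M → ‖F z‖ ≤ B) (u f : 𝓢(Space d, ℂ)) (hu : ∀ x, ‖u x‖ ≤ M) :
    hs 0 (fun x => F (u x) * f x) ≤ ENNReal.ofReal B * hs 0 f := by
  rw [hs_zero (integrable_comp_mul hF hB u f hu) (memLp_comp_mul hF hB u f hu),
    hs_zero f.integrable (f.memLp 2 volume)]
  refine eLpNorm_le_mul_eLpNorm_of_ae_le_mul (Eventually.of_forall fun x => ?_) 2
  rw [norm_mul]
  gcongr
  exact hB _ (hu x)

lemma hasFDerivAt_comp_mul {F α β : ℂ → ℂ} (h : ∀ z, HasFDerivAt F (wirtinger (α z) (β z)) z)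
    (u f : 𝓢(Space d, ℂ)) (x : Space d) :
    HasFDerivAt (fun x => F (u x) * f x) (F (u x) • fderiv ℝ f x +
      f x • (wirtinger (α (u x)) (β (u x))).comp (fderiv ℝ u x)) x := by
  have h1 : HasFDerivAt (fun x => F (u x)) ((wirtinger (α (u x)) (β (u x))).comp (fderiv ℝ u x)) x :=
    (h (u x)).comp x (u.hasFDerivAt x)
  exact h1.mul (f.hasFDerivAt x)

lemma integrable_fderiv_comp_mul {M B : ℝ} {F α β : ℂ → ℂ} (hF : Continuous F)
    (hFB : ∀ z, ‖z‖ ≤ M → ‖F z‖ ≤ B) (hα : Continuous α)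
    (hαB : ∀ z, ‖z‖ ≤ M → ‖α z‖ ≤ B) (hβ : Continuous β)
    (hβB : ∀ z, ‖z‖ ≤ M → ‖β z‖ ≤ B) (h : ∀ z, HasFDerivAt F (wirtinger (α z) (β z)) z)
    (u f : 𝓢(Space d, ℂ)) (hu : ∀ x, ‖u x‖ ≤ M) :
    Integrable (fderiv ℝ (fun x => F (u x) * f x)) := by
  have e : fderiv ℝ (fun x => F (u x) * f x) = fun x => F (u x) • fderiv ℝ f x +
      f x • (wirtinger (α (u x)) (β (u x))).comp (fderiv ℝ u x) := by
    ext1 x; exact (hasFDerivAt_comp_mul h u f x).fderiv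
  rw [e]
  have hf' : Integrable (fderiv ℝ f) := (SchwartzMap.fderivCLM ℝ (Space d) ℂ f).integrable
  have hfc : Continuous (fderiv ℝ f) := (SchwartzMap.fderivCLM ℝ (Space d) ℂ f).continuous
  have huc : Continuous (fderiv ℝ u) := (SchwartzMap.fderivCLM ℝ (Space d) ℂ u).continuous
  have hw := continuous_wirtinger (hα.comp u.continuous) (hβ.comp u.continuous)
  have hu' : ∀ x, ‖fderiv ℝ u x‖ ≤ SchwartzMap.seminorm ℝ 0 0
      (SchwartzMap.fderivCLM ℝ (Space d) ℂ u) := fun x =>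
    SchwartzMap.norm_le_seminorm ℝ (SchwartzMap.fderivCLM ℝ (Space d) ℂ u) x
  refine ((hf'.norm.const_mul B).add (f.integrable.norm.mul_const ((B + B) *
    SchwartzMap.seminorm ℝ 0 0 (SchwartzMap.fderivCLM ℝ (Space d) ℂ u)))).mono'
    (((hF.comp u.continuous).smul hfc).add
      (f.continuous.smul (hw.clm_comp huc))).aestronglyMeasurable
    (Eventually.of_forall fun x => (norm_add_le _ _).trans (add_le_add ?_ ?_))
  · change _ ≤ B * ‖fderiv ℝ f x‖
    rw [norm_smul]
    gcongr
    exact hFB _ (hu x)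
  · change _ ≤ ‖f x‖ * ((B + B) * _)
    have hB0 : 0 ≤ B := (norm_nonneg _).trans (hFB _ (hu x))
    rw [norm_smul]
    gcongr
    refine (ContinuousLinearMap.opNorm_comp_le _ _).trans ?_
    gcongr
    · exact (norm_wirtinger_le _ _).trans (add_le_add (hαB _ (hu x)) (hβB _ (hu x)))
    · exact hu' x

/-- For `u` bounded in `H^ρ`, `ρ > d/2`, multiplication by `F(u)` is bounded on `H^k`. -/
theorem hs_comp_mul_le {ρ : ℝ} (hρ : (d : ℝ) / 2 < ρ) {M B : ℝ} (k : ℕ)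
    (hk : (k : ℝ) ≤ ρ) :
    ∃ C : ℝ≥0∞, C ≠ ∞ ∧ ∀ F, RegBound M B k F → ∀ u f : 𝓢(Space d, ℂ), (∀ x, ‖u x‖ ≤ M) →
      hs ρ u ≤ ENNReal.ofReal M → hs k (fun x => F (u x) * f x) ≤ C * hs k f := by
  induction k with
  | zero =>
    refine ⟨ENNReal.ofReal B, ENNReal.ofReal_ne_top, fun F hF u f hu _ => ?_⟩
    simpa using hs_zero_comp_mul_le hF.1 hF.2 u f hu
  | succ k ih =>
    push_cast at hk
    obtain ⟨C, hC, ihC⟩ := ih (by linarith)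
    set K := prodConst d k ρ with hK
    have hKtop : K ≠ ∞ := prodConst_ne_top hρ
    set A : ℝ≥0∞ := ENNReal.ofReal (2 ^ (((k : ℝ) + 1) / 2)) with hA
    refine ⟨A * ENNReal.ofReal B + 2 * ∑ _j : Fin d, (C * (K * ENNReal.ofReal M) +
      C * (K * ENNReal.ofReal M) + C), ?_, fun F hF u f hu huρ => ?_⟩
    · have hM : C * (K * ENNReal.ofReal M) ≠ ∞ :=
        ENNReal.mul_ne_top hC (ENNReal.mul_ne_top hKtop ENNReal.ofReal_ne_top)
      exact ENNReal.add_ne_top.2 ⟨ENNReal.mul_ne_top ENNReal.ofReal_ne_top ENNReal.ofReal_ne_top,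
        ENNReal.mul_ne_top (by norm_num) (ENNReal.sum_ne_top.2 fun _ _ =>
          ENNReal.add_ne_top.2 ⟨ENNReal.add_ne_top.2 ⟨hM, hM⟩, hC⟩)⟩
    have hF0 : RegBound M B k F := hF.of_succ
    obtain ⟨⟨hFc, hFB⟩, α, β, hder, hα, hβ⟩ := hF
    have h1 := integrable_comp_mul hFc hFB u f hu
    have h2 : Differentiable ℝ (fun x => F (u x) * f x) := fun x =>
      (hasFDerivAt_comp_mul hder u f x).differentiableAt
    have h3 := integrable_fderiv_comp_mul hFc hFB hα.zero.1 hα.zero.2 hβ.zero.1 hβ.zero.2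
      hder u f hu
    push_cast
    refine (hs_succ_le (Nat.cast_nonneg k) h1 h2 h3).trans ?_
    rw [add_mul, mul_assoc, mul_assoc 2, Finset.sum_mul]
    gcongr with j
    · refine (hs_zero_comp_mul_le hFc hFB u f hu).trans ?_
      gcongr
      exact hs_mono (by positivity) _
    -- This handles the terms where the derivative falls on `F(u)`: `∂u` is in `H^{ρ-1}` and `f` in
    -- `H^{k+1}`, so the product law at order `k` sees the exponent `(ρ - 1) + (k + 1) - k = ρ >
    -- d/2`. The induction hypothesis then absorbs the coefficients `α(u)` and `β(u)`.
    have hprod : ∀ w : 𝓢(Space d, ℂ), hs (ρ - 1) w ≤ ENNReal.ofReal M →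
        hs k (smul𝓢 w f) ≤ K * ENNReal.ofReal M * hs (k + 1) f := by
      intro w hw
      have := hs_mul_le (d := d) (k := k) (s₁ := ρ - 1) (s₂ := k + 1) (Nat.cast_nonneg k)
        (by linarith) (by linarith) w f
      rw [show ρ - 1 + ((k : ℝ) + 1) - k = ρ by ring] at this
      have e : (smul𝓢 w f : Space d → ℂ) = fun x => w x * f x := by ext x; simp
      rw [e, mul_assoc]
      refine this.trans ?_
      gcongr
    have hw1 : hs (ρ - 1) (partial𝓢 j u) ≤ ENNReal.ofReal M := by
      refine le_trans ?_ huρ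
      have := hs_lineDeriv_le (ρ - 1) u j
      rwa [sub_add_cancel] at this
    have hw2 : hs (ρ - 1) (conj𝓢 (partial𝓢 j u)) ≤ ENNReal.ofReal M := by
      have e : (conj𝓢 (partial𝓢 j u) : Space d → ℂ) =
        fun x => (starRingEnd ℂ) (partial𝓢 j u x) := by ext x; simp
      rw [e, hs_conj]; exact hw1
    have e : (fun x => fderiv ℝ (fun x => F (u x) * f x) x (basisVec j)) = fun x =>
        (α (u x) * smul𝓢 (partial𝓢 j u) f x + β (u x) * smul𝓢 (conj𝓢 (partial𝓢 j u)) f x) +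
        F (u x) * partial𝓢 j f x := by
      ext x
      rw [(hasFDerivAt_comp_mul hder u f x).fderiv]
      simp
      ring
    rw [e]
    have i1 := integrable_comp_mul hα.zero.1 hα.zero.2 u (smul𝓢 (partial𝓢 j u) f) hu
    have i2 := integrable_comp_mul hβ.zero.1 hβ.zero.2 u (smul𝓢 (conj𝓢 (partial𝓢 j u)) f) hu
    have i3 := integrable_comp_mul hFc hFB u (partial𝓢 j f) hu
    refine (hs_add_le k (i1.add i2) i3).trans ?_
    rw [add_mul, add_mul]
    gcongr
    · refine (hs_add_le k i1 i2).trans ?_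
      gcongr
      · refine (ihC α hα u _ hu huρ).trans ?_
        rw [mul_assoc]
        gcongr
        exact hprod _ hw1
      · refine (ihC β hβ u _ hu huρ).trans ?_
        rw [mul_assoc]
        gcongr
        exact hprod _ hw2
    · refine (ihC F hF0 u _ hu huρ).trans ?_
      gcongr
      exact hs_lineDeriv_le k f j

/-- `‖F(u)‖_{H^{k+1}} ≤ C ‖u‖_{H^{k+1}}` with `C` depending only on a bound of `u` in `H^ρ`,
where `ρ > d/2` and `ρ ≥ k`. -/
theorem hs_comp_le {ρ : ℝ} (hρ : (d : ℝ) / 2 < ρ) {M B : ℝ} (k : ℕ)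
    (hk : (k : ℝ) ≤ ρ) :
    ∃ C : ℝ≥0∞, C ≠ ∞ ∧ ∀ F α β : ℂ → ℂ, (∀ z, HasFDerivAt F (wirtinger (α z) (β z)) z) →
      (∀ z, ‖z‖ ≤ M → ‖F z‖ ≤ B * ‖z‖) → RegBound M B k α → RegBound M B k β →
      ∀ u : 𝓢(Space d, ℂ), (∀ x, ‖u x‖ ≤ M) →
      hs ρ u ≤ ENNReal.ofReal M →
      hs ((k : ℝ) + 1) (fun x => F (u x)) ≤ C * hs ((k : ℝ) + 1) u := by
  obtain ⟨C, hC, hmul⟩ := hs_comp_mul_le hρ (M := M) (B := B) k hk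
  refine ⟨ENNReal.ofReal (2 ^ (((k : ℝ) + 1) / 2)) * ENNReal.ofReal B +
    2 * ∑ _j : Fin d, (C + C), ?_, fun F α β hder hFB hα hβ u hu huρ => ?_⟩
  · exact ENNReal.add_ne_top.2 ⟨ENNReal.mul_ne_top ENNReal.ofReal_ne_top ENNReal.ofReal_ne_top,
      ENNReal.mul_ne_top (by norm_num) (ENNReal.sum_ne_top.2 fun _ _ =>
        ENNReal.add_ne_top.2 ⟨hC, hC⟩)⟩
  have hFc : Continuous F := continuous_iff_continuousAt.2 fun z => (hder z).continuousAt
  have hFu : Continuous fun x => F (u x) := hFc.comp u.continuous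
  have h1 : Integrable (fun x => F (u x)) :=
    (u.integrable.norm.const_mul B).mono' hFu.aestronglyMeasurable
      (Eventually.of_forall fun x => hFB _ (hu x))
  have h1' : MemLp (fun x => F (u x)) 2 :=
    (u.memLp 2 volume).of_le_mul (c := B) hFu.aestronglyMeasurable
      (Eventually.of_forall fun x => hFB _ (hu x))
  have hd : ∀ x, HasFDerivAt (fun x => F (u x))
      ((wirtinger (α (u x)) (β (u x))).comp (fderiv ℝ u x)) x := fun x =>
    (hder (u x)).comp x (u.hasFDerivAt x)
  have h2 : Differentiable ℝ (fun x => F (u x)) := fun x => (hd x).differentiableAt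
  have hw := continuous_wirtinger (hα.zero.1.comp u.continuous) (hβ.zero.1.comp u.continuous)
  have huc : Continuous (fderiv ℝ u) := (SchwartzMap.fderivCLM ℝ (Space d) ℂ u).continuous
  have hui : Integrable (fderiv ℝ u) := (SchwartzMap.fderivCLM ℝ (Space d) ℂ u).integrable
  have h3 : Integrable (fderiv ℝ (fun x => F (u x))) := by
    have e : fderiv ℝ (fun x => F (u x)) = fun x =>
        (wirtinger (α (u x)) (β (u x))).comp (fderiv ℝ u x) := by
      ext1 x; exact (hd x).fderiv
    rw [e]
    refine (hui.norm.const_mul (B + B)).mono' (hw.clm_comp huc).aestronglyMeasurable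
      (Eventually.of_forall fun x => ?_)
    refine (ContinuousLinearMap.opNorm_comp_le _ _).trans ?_
    gcongr
    exact (norm_wirtinger_le _ _).trans (add_le_add (hα.zero.2 _ (hu x)) (hβ.zero.2 _ (hu x)))
  refine (hs_succ_le (Nat.cast_nonneg k) h1 h2 h3).trans ?_
  rw [add_mul, mul_assoc, mul_assoc 2, Finset.sum_mul]
  gcongr with j
  · rw [hs_zero h1 h1']
    refine (eLpNorm_le_mul_eLpNorm_of_ae_le_mul
      (Eventually.of_forall fun x => hFB _ (hu x)) 2).trans ?_
    rw [← hs_zero u.integrable (u.memLp 2 volume)]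
    gcongr
    exact hs_mono (by positivity) _
  -- The multiplication estimate is needed only at order `k`, with `f = ∂u`. This is why the
  -- `H^{k+1}` norm enters linearly, with a constant depending on the weaker norm `H^ρ`, where `ρ <
  -- k + 1` is allowed.
  · have e : (fun x => fderiv ℝ (fun x => F (u x)) x (basisVec j)) = fun x =>
        α (u x) * partial𝓢 j u x + β (u x) * conj𝓢 (partial𝓢 j u) x := by
      ext x
      rw [(hd x).fderiv]
      simp
    have e' : hs k (conj𝓢 (partial𝓢 j u)) = hs k (partial𝓢 j u) := by
      rw [← hs_conj]
      congr 1 with x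
      simp
    rw [e]
    have i1 := integrable_comp_mul hα.zero.1 hα.zero.2 u (partial𝓢 j u) hu
    have i2 := integrable_comp_mul hβ.zero.1 hβ.zero.2 u (conj𝓢 (partial𝓢 j u)) hu
    refine (hs_add_le k i1 i2).trans ?_
    rw [add_mul]
    gcongr
    · refine (hmul α hα u _ hu huρ).trans ?_
      gcongr
      exact hs_lineDeriv_le k u j
    · refine (hmul β hβ u _ hu huρ).trans ?_
      rw [e']
      gcongr
      exact hs_lineDeriv_le k u j


/-! ### Regularity of the functions `z^a z̄^b |z|^c`. -/

lemma hasFDerivAt_wirtinger {F : ℂ → ℂ} {L : ℂ →L[ℝ] ℂ} {z α β : ℂ} (h : HasFDerivAt F L z)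
    (hL : ∀ w, L w = α * w + β * (starRingEnd ℂ) w) : HasFDerivAt F (wirtinger α β) z :=
  h.congr_fderiv (ContinuousLinearMap.ext fun w => by rw [hL, wirtinger_apply])

lemma RegBound.mono {M B B' : ℝ} (hB : B ≤ B') {k : ℕ} {F : ℂ → ℂ} (h : RegBound M B k F) :
    RegBound M B' k F := by
  induction k generalizing F with
  | zero => exact ⟨h.1, fun z hz => (h.2 z hz).trans hB⟩
  | succ k ih =>
    obtain ⟨h0, α, β, hder, hα, hβ⟩ := h
    exact ⟨⟨h0.1, fun z hz => (h0.2 z hz).trans hB⟩, α, β, hder, ih hα, ih hβ⟩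

lemma RegBound.add {M B B' : ℝ} {k : ℕ} {F G : ℂ → ℂ} (hF : RegBound M B k F)
    (hG : RegBound M B' k G) : RegBound M (B + B') k (fun z => F z + G z) := by
  have h0 : ∀ z, ‖z‖ ≤ M → ‖F z + G z‖ ≤ B + B' := fun z hz =>
    (norm_add_le _ _).trans (add_le_add (hF.zero.2 z hz) (hG.zero.2 z hz))
  have hc : Continuous fun z => F z + G z := hF.zero.1.add hG.zero.1
  induction k generalizing F G with
  | zero => exact ⟨hc, h0⟩
  | succ k ih =>
    obtain ⟨-, α, β, hder, hα, hβ⟩ := hF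
    obtain ⟨-, α', β', hder', hα', hβ'⟩ := hG
    refine ⟨⟨hc, h0⟩, fun z => α z + α' z, fun z => β z + β' z, fun z => ?_,
      ih hα hα' ?_ ?_, ih hβ hβ' ?_ ?_⟩
    · refine hasFDerivAt_wirtinger ((hder z).add (hder' z)) fun w => ?_
      rw [add_apply, wirtinger_apply, wirtinger_apply]
      ring
    · exact fun z hz => (norm_add_le _ _).trans (add_le_add (hα.zero.2 z hz) (hα'.zero.2 z hz))
    · exact hα.zero.1.add hα'.zero.1
    · exact fun z hz => (norm_add_le _ _).trans (add_le_add (hβ.zero.2 z hz) (hβ'.zero.2 z hz))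
    · exact hβ.zero.1.add hβ'.zero.1

lemma RegBound.const_mul {M B : ℝ} {k : ℕ} {F : ℂ → ℂ} (hF : RegBound M B k F) (c : ℂ) :
    RegBound M (‖c‖ * B) k (fun z => c * F z) := by
  have key : ∀ {G : ℂ → ℂ}, (Continuous G ∧ ∀ z, ‖z‖ ≤ M → ‖G z‖ ≤ B) →
      (Continuous (fun z => c * G z) ∧ ∀ z, ‖z‖ ≤ M → ‖c * G z‖ ≤ ‖c‖ * B) := by
    intro G hG
    refine ⟨hG.1.const_mul c, fun z hz => ?_⟩
    rw [norm_mul]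
    gcongr
    exact hG.2 z hz
  induction k generalizing F with
  | zero => exact key hF
  | succ k ih =>
    obtain ⟨h0, α, β, hder, hα, hβ⟩ := hF
    refine ⟨key h0, fun z => c * α z, fun z => c * β z, fun z => ?_, ih hα, ih hβ⟩
    refine hasFDerivAt_wirtinger ((hder z).const_mul c) fun w => ?_
    rw [smul_apply, wirtinger_apply, smul_eq_mul]
    ring

/-- The function `z^a z̄^b |z|^c`. -/
def monom (a b : ℕ) (c : ℝ) (z : ℂ) : ℂ :=
  z ^ a * (starRingEnd ℂ z) ^ b * ((‖z‖ ^ c : ℝ) : ℂ)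

lemma norm_monom {a b : ℕ} {c : ℝ} {z : ℂ} (hz : z ≠ 0) :
    ‖monom a b c z‖ = ‖z‖ ^ ((a : ℝ) + b + c) := by
  have hz' : 0 < ‖z‖ := norm_pos_iff.2 hz
  rw [monom, norm_mul, norm_mul, norm_pow, norm_pow, RCLike.norm_conj, Complex.norm_real,
    Real.norm_of_nonneg (by positivity), Real.rpow_add hz', Real.rpow_add hz', Real.rpow_natCast,
    Real.rpow_natCast]

lemma monom_zero {a b : ℕ} {c : ℝ} (h : 0 < (a : ℝ) + b + c) : monom a b c 0 = 0 := by
  rcases Nat.eq_zero_or_pos a with ha | ha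
  · rcases Nat.eq_zero_or_pos b with hb | hb
    · subst ha hb
      have : c ≠ 0 := by rintro rfl; simp at h
      simp [monom, Real.zero_rpow this]
    · simp [monom, hb.ne']
  · simp [monom, ha.ne']

lemma norm_monom_le {a b : ℕ} {c : ℝ} (h : 0 < (a : ℝ) + b + c) (z : ℂ) :
    ‖monom a b c z‖ ≤ ‖z‖ ^ ((a : ℝ) + b + c) := by
  by_cases hz : z = 0
  · subst hz; rw [monom_zero h]; simp; positivity
  · exact (norm_monom hz).le

lemma hasFDerivAt_pow (a : ℕ) (z : ℂ) :
    HasFDerivAt (fun z : ℂ => z ^ a) (wirtinger (a * z ^ (a - 1)) 0) z := by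
  have h := (hasDerivAt_pow a z).hasFDerivAt.restrictScalars ℝ
  refine hasFDerivAt_wirtinger h fun w => ?_
  simp [mul_comm]

lemma hasFDerivAt_conj_pow (b : ℕ) (z : ℂ) :
    HasFDerivAt (fun z : ℂ => (starRingEnd ℂ z) ^ b)
      (wirtinger 0 (b * (starRingEnd ℂ z) ^ (b - 1))) z := by
  have h := (hasFDerivAt_pow b (starRingEnd ℂ z)).comp z
    (Complex.conjCLE : ℂ →L[ℝ] ℂ).hasFDerivAt
  refine hasFDerivAt_wirtinger h fun w => ?_
  simp

lemma hasFDerivAt_norm_rpow_complex (c : ℝ) {z : ℂ} (hz : z ≠ 0) :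
    HasFDerivAt (fun z : ℂ => ((‖z‖ ^ c : ℝ) : ℂ))
      (wirtinger ((c / 2 : ℝ) * (starRingEnd ℂ z) * ((‖z‖ ^ (c - 2) : ℝ) : ℂ))
        ((c / 2 : ℝ) * z * ((‖z‖ ^ (c - 2) : ℝ) : ℂ))) z := by
  have hz' : 0 < ‖z‖ := norm_pos_iff.2 hz
  have e : ∀ (c : ℝ) (z : ℂ), ‖z‖ ^ c = (‖z‖ ^ 2) ^ (c / 2) := by
    intro c z
    rw [← Real.rpow_natCast, ← Real.rpow_mul (norm_nonneg _)]
    congr 1; push_cast; ring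
  have h1 : HasFDerivAt (fun z : ℂ => ‖z‖ ^ 2) (2 • (innerSL ℝ z)) z :=
    (hasStrictFDerivAt_norm_sq z).hasFDerivAt
  have h2 := h1.rpow_const (p := c / 2) (Or.inl (by positivity))
  have h3 := Complex.ofRealCLM.hasFDerivAt.comp z h2
  have e2 : (fun z : ℂ => ((‖z‖ ^ c : ℝ) : ℂ)) =
      Complex.ofRealCLM ∘ (fun z : ℂ => (‖z‖ ^ 2) ^ (c / 2)) := by
    ext z; simp only [Function.comp, Complex.ofRealCLM_apply]; rw [e c z]
  rw [e2]
  have e3 : ‖z‖ ^ (c - 2) = (‖z‖ ^ 2) ^ (c / 2 - 1) := by rw [e]; congr 1; ring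
  rw [e3]
  refine hasFDerivAt_wirtinger h3 fun w => ?_
  have e4 : (innerSL ℝ z) w = (z.re * w.re + z.im * w.im) := by
    rw [innerSL_apply_apply, Complex.inner]; simp; ring
  simp only [ContinuousLinearMap.comp_apply, Complex.ofRealCLM_apply,
    smul_apply, e4, smul_eq_mul, nsmul_eq_mul]
  apply Complex.ext
  · simp; ring
  · simp; ring

/-- The derivative of `z^a z̄^b |z|^c` with respect to `z`. -/
def monomDz (a b : ℕ) (c : ℝ) (z : ℂ) : ℂ :=
  a * monom (a - 1) b c z + (c / 2 : ℝ) * monom a (b + 1) (c - 2) z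

/-- The derivative of `z^a z̄^b |z|^c` with respect to `z̄`. -/
def monomDzbar (a b : ℕ) (c : ℝ) (z : ℂ) : ℂ :=
  b * monom a (b - 1) c z + (c / 2 : ℝ) * monom (a + 1) b (c - 2) z

lemma hasFDerivAt_monom_aux (a b : ℕ) (c : ℝ) {z : ℂ} {p q : ℂ}
    (h : HasFDerivAt (fun z : ℂ => ((‖z‖ ^ c : ℝ) : ℂ)) (wirtinger p q) z) :
    HasFDerivAt (monom a b c) (wirtinger
      (a * monom (a - 1) b c z + z ^ a * (starRingEnd ℂ z) ^ b * p)
      (b * monom a (b - 1) c z + z ^ a * (starRingEnd ℂ z) ^ b * q)) z := by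
  have h' := ((hasFDerivAt_pow a z).mul (hasFDerivAt_conj_pow b z)).mul h
  unfold monom
  refine hasFDerivAt_wirtinger h' fun w => ?_
  simp only [wirtinger_apply, add_apply, smul_apply,
    smul_eq_mul, Pi.mul_apply]
  ring

/-- Away from `0` this is the product rule. At `0` a total degree above `1` makes the function
`o(|z|)`, and both derivative formulas vanish there. When `c = 0` the function is a polynomial in
`z`, `z̄` and no condition on the degree is needed. -/
lemma hasFDerivAt_monom {a b : ℕ} {c : ℝ} (h : 1 < (a : ℝ) + b + c ∨ c = 0) (z : ℂ) :
    HasFDerivAt (monom a b c) (wirtinger (monomDz a b c z) (monomDzbar a b c z)) z := by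
  rcases eq_or_ne c 0 with hc | hc
  · subst hc
    have h0 : HasFDerivAt (fun z : ℂ => ((‖z‖ ^ (0 : ℝ) : ℝ) : ℂ)) (wirtinger 0 0) z := by
      have e : wirtinger 0 0 = 0 := by ext w; simp
      simp only [Real.rpow_zero, e]
      exact hasFDerivAt_const _ _
    convert hasFDerivAt_monom_aux a b 0 h0 using 2 <;> simp [monomDz, monomDzbar]
  have h : 1 < (a : ℝ) + b + c := h.resolve_right hc
  by_cases hz : z = 0
  · subst hz
    have e1 : monomDz a b c 0 = 0 := by
      unfold monomDz
      rw [monom_zero (a := a) (b := b + 1) (by push_cast; linarith)]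
      rcases Nat.eq_zero_or_pos a with ha | ha
      · simp [ha]
      · rw [monom_zero (by rw [Nat.cast_sub (by omega)]; push_cast; linarith)]; simp
    have e2 : monomDzbar a b c 0 = 0 := by
      unfold monomDzbar
      rw [monom_zero (a := a + 1) (b := b) (by push_cast; linarith)]
      rcases Nat.eq_zero_or_pos b with ha | ha
      · simp [ha]
      · rw [monom_zero (by rw [Nat.cast_sub (by omega)]; push_cast; linarith)]; simp
    have e : wirtinger 0 0 = 0 := by ext w; simp
    rw [e1, e2, e, hasFDerivAt_iff_isLittleO_nhds_zero]
    simp only [zero_add, monom_zero (show 0 < (a : ℝ) + b + c by linarith), sub_zero,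
      zero_apply]
    have ht : Tendsto (fun z : ℂ => ‖z‖ ^ ((a : ℝ) + b + c - 1)) (𝓝 0) (𝓝 0) := by
      have : ContinuousAt (fun z : ℂ => ‖z‖ ^ ((a : ℝ) + b + c - 1)) 0 :=
        continuous_norm.continuousAt.rpow_const (Or.inr (by linarith))
      have h2 := this.tendsto
      rwa [norm_zero, Real.zero_rpow (by linarith)] at h2
    rw [Asymptotics.isLittleO_iff]
    intro ε hε
    filter_upwards [ht.eventually (gt_mem_nhds hε)] with z hz
    refine (norm_monom_le (by linarith) z).trans ?_
    by_cases hz0 : z = 0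
    · subst hz0; rw [norm_zero, Real.zero_rpow (by linarith)]; simp
    · have hp : 0 < ‖z‖ := norm_pos_iff.2 hz0
      rw [show (a : ℝ) + b + c = ((a : ℝ) + b + c - 1) + 1 by ring, Real.rpow_add hp, Real.rpow_one]
      gcongr
  · convert hasFDerivAt_monom_aux a b c (hasFDerivAt_norm_rpow_complex c hz) using 2
    · simp only [monomDz, monom, pow_succ]; ring
    · simp only [monomDzbar, monom, pow_succ]; ring

lemma continuous_monom {a b : ℕ} {c : ℝ} (h : 0 < (a : ℝ) + b + c ∨ c = 0) :
    Continuous (monom a b c) := by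
  rcases eq_or_ne c 0 with hc | hc
  · subst hc
    have : monom a b 0 = fun z => z ^ a * (starRingEnd ℂ z) ^ b := by ext z; simp [monom]
    rw [this]
    exact (continuous_pow a).mul (Complex.continuous_conj.pow b)
  have h : 0 < (a : ℝ) + b + c := h.resolve_right hc
  rw [continuous_iff_continuousAt]
  intro z
  by_cases hz : z = 0
  · subst hz
    have h1 : ContinuousAt (fun z : ℂ => ‖z‖ ^ ((a : ℝ) + b + c)) 0 :=
      continuous_norm.continuousAt.rpow_const (Or.inr h.le)
    have h2 := h1.tendsto
    rw [norm_zero, Real.zero_rpow h.ne'] at h2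
    rw [ContinuousAt, monom_zero h]
    exact squeeze_zero_norm (norm_monom_le h) h2
  · exact (hasFDerivAt_monom_aux a b c (hasFDerivAt_norm_rpow_complex c hz)).continuousAt

/-- The family is stable under both Wirtinger derivatives: they are combinations of members whose
degree is lower by one. Induction on `k` thus works while the degree exceeds `k`, or indefinitely
when `c = 0`, since the factor `c / 2` kills the term with `|z|^(c - 2)`. -/
lemma exists_regBound_monom (M : ℝ) {k a b : ℕ} {c : ℝ} (h : (k : ℝ) < (a : ℝ) + b + c ∨ c = 0) :
    ∃ B, RegBound M B k (monom a b c) := by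
  have hc : Continuous (monom a b c) :=
    continuous_monom (h.imp_left fun h => (Nat.cast_nonneg k).trans_lt h)
  have hbd : ∃ B, ∀ z, ‖z‖ ≤ M → ‖monom a b c z‖ ≤ B := by
    obtain ⟨B, hB⟩ := (isCompact_closedBall (0 : ℂ) M).exists_bound_of_continuousOn hc.continuousOn
    exact ⟨B, fun z hz => hB z (by simpa using hz)⟩
  induction k generalizing a b c with
  | zero =>
    obtain ⟨B, hB⟩ := hbd
    exact ⟨B, hc, hB⟩
  | succ k ih =>
    have ih' : ∀ {a b : ℕ} {c : ℝ}, ((k : ℝ) < (a : ℝ) + b + c ∨ c = 0) →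
        ∃ B, RegBound M B k (monom a b c) := by
      intro a b c h
      have hc : Continuous (monom a b c) :=
        continuous_monom (h.imp_left fun h => (Nat.cast_nonneg k).trans_lt h)
      refine ih h hc ?_
      obtain ⟨B, hB⟩ :=
        (isCompact_closedBall (0 : ℂ) M).exists_bound_of_continuousOn hc.continuousOn
      exact ⟨B, fun z hz => hB z (by simpa using hz)⟩
    push_cast at h
    have hzero : ∀ k : ℕ, RegBound M 0 k (fun _ => 0) := by
      intro k
      induction k with
      | zero => exact ⟨continuous_const, by simp⟩
      | succ k ih =>
        refine ⟨⟨continuous_const, by simp⟩, fun _ => 0, fun _ => 0, fun z => ?_, ih, ih⟩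
        exact hasFDerivAt_wirtinger (hasFDerivAt_const (0 : ℂ) z) fun w => by simp
    -- The degree condition is asked only for `n ≠ 0`: when `a = 0` the truncated exponent `a - 1`
    -- does not lower the degree, but the term has coefficient `0`.
    have part1 : ∀ {n a b : ℕ} {c : ℝ}, (n ≠ 0 → ((k : ℝ) < (a : ℝ) + b + c ∨ c = 0)) →
        ∃ B, RegBound M B k (fun z => (n : ℂ) * monom a b c z) := by
      intro n a b c hn
      rcases Nat.eq_zero_or_pos n with h0 | h0
      · exact ⟨0, by simpa [h0] using hzero k⟩
      · obtain ⟨B, hB⟩ := ih' (hn h0.ne')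
        exact ⟨_, hB.const_mul _⟩
    have part2 : ∀ {a b : ℕ} {c : ℝ}, ((k : ℝ) + 2 < (a : ℝ) + b + c ∨ c = 0) →
        ∃ B, RegBound M B k (fun z => ((c / 2 : ℝ) : ℂ) * monom a b (c - 2) z) := by
      intro a b c hn
      rcases eq_or_ne c 0 with h0 | h0
      · exact ⟨0, by simpa [h0] using hzero k⟩
      · obtain ⟨B, hB⟩ := ih' (a := a) (b := b) (c := c - 2)
          (Or.inl (by linarith [hn.resolve_right h0]))
        exact ⟨_, hB.const_mul _⟩
    obtain ⟨B₁, h₁⟩ := part1 (n := a) (a := a - 1) (b := b) (c := c) (fun hn => h.imp_left fun h => by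
      rw [Nat.cast_sub (by omega)]; push_cast; linarith)
    obtain ⟨B₂, h₂⟩ := part2 (a := a) (b := b + 1) (c := c) (h.imp_left fun h => by
      push_cast; linarith)
    obtain ⟨B₃, h₃⟩ := part1 (n := b) (a := a) (b := b - 1) (c := c) (fun hn => h.imp_left fun h => by
      rw [Nat.cast_sub (by omega)]; push_cast; linarith)
    obtain ⟨B₄, h₄⟩ := part2 (a := a + 1) (b := b) (c := c) (h.imp_left fun h => by
      push_cast; linarith)
    obtain ⟨B, hB⟩ := hbd
    set B' := max B (max (B₁ + B₂) (B₃ + B₄)) with hB'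
    refine ⟨B', ⟨hc, fun z hz => (hB z hz).trans (le_max_left _ _)⟩, monomDz a b c,
      monomDzbar a b c, hasFDerivAt_monom (h.imp_left fun h => ?_), ?_, ?_⟩
    · have := Nat.cast_nonneg (α := ℝ) k
      linarith
    · exact (h₁.add h₂).mono ((le_max_left _ _).trans (le_max_right _ _))
    · exact (h₃.add h₄).mono ((le_max_right _ _).trans (le_max_right _ _))


/-! ### Sobolev norms on `L²`: semicontinuity, density, embedding. -/

lemma coeFn_fourier_add (f g : L2 d) :
    ((𝓕 (f + g) : L2 d) : Space d → ℂ) =ᵐ[volume] fun ξ => (𝓕 f : L2 d) ξ + (𝓕 g : L2 d) ξ := by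
  rw [FourierTransform.fourier_add]
  exact Lp.coeFn_add _ _

lemma coeFn_fourier_sub (f g : L2 d) :
    ((𝓕 (f - g) : L2 d) : Space d → ℂ) =ᵐ[volume] fun ξ => (𝓕 f : L2 d) ξ - (𝓕 g : L2 d) ξ := by
  have h : 𝓕 (f - g) = 𝓕 f - 𝓕 g := map_sub (Lp.fourierTransformₗᵢ (Space d) ℂ) f g
  rw [h]
  exact Lp.coeFn_sub _ _

lemma coeFn_fourier_smul (c : ℂ) (f : L2 d) :
    ((𝓕 (c • f) : L2 d) : Space d → ℂ) =ᵐ[volume] fun ξ => c * (𝓕 f : L2 d) ξ := by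
  rw [FourierTransform.fourier_smul]
  exact Lp.coeFn_smul _ _

lemma sobolevNorm_def (s : ℝ) (f : L2 d) : sobolevNorm s f =
    eLpNorm (fun ξ : Space d => ((bracket ξ ^ (s / 2) : ℝ) : ℂ) * (𝓕 f : L2 d) ξ) 2 volume := rfl

lemma aesm_sobolev (s : ℝ) (f : L2 d) : AEStronglyMeasurable
    (fun ξ : Space d => ((bracket ξ ^ (s / 2) : ℝ) : ℂ) * (𝓕 f : L2 d) ξ) volume :=
  (continuous_weight _).aestronglyMeasurable.mul (Lp.aestronglyMeasurable _)

lemma sobolevNorm_add_le (s : ℝ) (f g : L2 d) :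
    sobolevNorm s (f + g) ≤ sobolevNorm s f + sobolevNorm s g := by
  rw [sobolevNorm_def, sobolevNorm_def s f, sobolevNorm_def s g]
  refine le_trans (le_of_eq ?_)
    (eLpNorm_add_le (aesm_sobolev s f) (aesm_sobolev s g) (by norm_num))
  apply eLpNorm_congr_ae
  filter_upwards [coeFn_fourier_add f g] with ξ hξ
  simp only [Pi.add_apply]
  rw [hξ]; ring

lemma sobolevNorm_sub_le (s : ℝ) (f g : L2 d) :
    sobolevNorm s (f - g) ≤ sobolevNorm s f + sobolevNorm s g := by
  rw [sobolevNorm_def, sobolevNorm_def s f, sobolevNorm_def s g]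
  refine le_trans (le_of_eq ?_)
    (eLpNorm_sub_le (aesm_sobolev s f) (aesm_sobolev s g) (by norm_num))
  apply eLpNorm_congr_ae
  filter_upwards [coeFn_fourier_sub f g] with ξ hξ
  simp only [Pi.sub_apply]
  rw [hξ]; ring

lemma sobolevNorm_le_add_sub (s : ℝ) (f g : L2 d) :
    sobolevNorm s f ≤ sobolevNorm s g + sobolevNorm s (f - g) := by
  have := sobolevNorm_add_le s g (f - g)
  rwa [add_sub_cancel] at this

lemma sobolevNorm_smul (s : ℝ) (c : ℂ) (f : L2 d) :
    sobolevNorm s (c • f) = ‖c‖ₑ * sobolevNorm s f := by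
  rw [sobolevNorm_def, sobolevNorm_def, ← eLpNorm_const_smul]
  apply eLpNorm_congr_ae
  filter_upwards [coeFn_fourier_smul c f] with ξ hξ
  simp only [Pi.smul_apply, smul_eq_mul]
  rw [hξ]; ring

lemma sobolevNorm_mono {s s' : ℝ} (h : s ≤ s') (f : L2 d) : sobolevNorm s f ≤ sobolevNorm s' f := by
  rw [sobolevNorm_def, sobolevNorm_def]
  apply eLpNorm_mono
  intro ξ
  rw [norm_mul, norm_mul, Complex.norm_real, Complex.norm_real]
  have := bracket_pos ξ
  rw [Real.norm_of_nonneg (by positivity), Real.norm_of_nonneg (by positivity)]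
  gcongr
  exact one_le_bracket ξ

lemma enorm_le_sobolevNorm {s : ℝ} (h : 0 ≤ s) (f : L2 d) : ‖f‖ₑ ≤ sobolevNorm s f := by
  rw [← sobolevNorm_zero]; exact sobolevNorm_mono h f

/-- A weighted `L²` norm on the Fourier side is lower semicontinuous on `L²`. -/
lemma weighted_le_of_tendsto {w : Space d → ℂ} (hw : AEStronglyMeasurable w volume)
    {f : ℕ → L2 d} {g : L2 d} (h : Tendsto f atTop (𝓝 g)) {R : ℝ≥0∞}
    (hR : ∀ n, eLpNorm (fun ξ => w ξ * (𝓕 (f n) : L2 d) ξ) 2 volume ≤ R) :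
    eLpNorm (fun ξ => w ξ * (𝓕 g : L2 d) ξ) 2 volume ≤ R := by
  have hF : Tendsto (fun n => (𝓕 (f n) : L2 d)) atTop (𝓝 (𝓕 g)) :=
    ((Lp.fourierTransformₗᵢ (Space d) ℂ).continuous.tendsto g).comp h
  -- By Plancherel the transforms converge in `L²`, hence almost everywhere along a subsequence, and
  -- Fatou's lemma applies to the weighted functions.
  obtain ⟨ns, -, hae⟩ := (tendstoInMeasure_of_tendsto_Lp hF).exists_seq_tendsto_ae
  refine (Lp.eLpNorm_lim_le_liminf_eLpNorm
    (f := fun n ξ => w ξ * (𝓕 (f (ns n)) : L2 d) ξ) (fun n => hw.mul (Lp.aestronglyMeasurable _))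
    _ ?_).trans ?_
  · filter_upwards [hae] with ξ hξ
    exact hξ.const_mul _
  · exact liminf_le_of_frequently_le' (Frequently.of_forall fun n => hR (ns n))

lemma sobolevNorm_le_of_tendsto {s : ℝ} {f : ℕ → L2 d} {g : L2 d} (h : Tendsto f atTop (𝓝 g))
    {R : ℝ≥0∞} (hR : ∀ n, sobolevNorm s (f n) ≤ R) : sobolevNorm s g ≤ R :=
  weighted_le_of_tendsto (continuous_weight _).aestronglyMeasurable h hR

/-- This allows a fixed-point argument run in `L²` alone to retain high Sobolev bounds in the limit.
-/
lemma isClosed_sobolevBall (s : ℝ) (R : ℝ≥0∞) : IsClosed {f : L2 d | sobolevNorm s f ≤ R} := by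
  apply IsSeqClosed.isClosed
  intro f g hf h
  exact sobolevNorm_le_of_tendsto h hf

lemma hasTemperateGrowth_bracket_rpow (s : ℝ) :
    (fun ξ : Space d => ((bracket ξ ^ s : ℝ) : ℂ)).HasTemperateGrowth := by
  have h1 := Function.hasTemperateGrowth_one_add_norm_sq_rpow (Space d) s
  have h2 : (fun ξ : Space d => (2 * Real.pi) • ξ).HasTemperateGrowth := by fun_prop
  have h3 : (fun ξ : Space d => (bracket ξ ^ s : ℝ)).HasTemperateGrowth := h1.comp h2
  fun_prop

/-- Schwartz functions are dense in `H^s`. -/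
lemma exists_schwartz_sobolevNorm_sub_le {s : ℝ} {u : L2 d} (hu : sobolevNorm s u < ∞) {ε : ℝ}
    (hε : 0 < ε) : ∃ φ : 𝓢(Space d, ℂ), sobolevNorm s (φ.toLp 2 volume - u) ≤ ENNReal.ofReal ε := by
  have hW : MemLp (fun ξ : Space d => ((bracket ξ ^ (s / 2) : ℝ) : ℂ) * (𝓕 u : L2 d) ξ) 2 volume :=
    ⟨aesm_sobolev s u, hu⟩
  obtain ⟨ψ, hψ⟩ := (SchwartzMap.denseRange_toLpCLM (E := Space d) (F := ℂ) (p := 2) (μ := volume)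
    ENNReal.ofNat_ne_top).exists_dist_lt (hW.toLp _) hε
  -- `ψ` approximates the weighted transform of `u` in `L²`; dividing by the weight preserves the
  -- Schwartz class, and `𝓕⁻ χ` is then as close to `u` in `H^s` as `ψ` is to its target.
  set χ : 𝓢(Space d, ℂ) :=
    SchwartzMap.smulLeftCLM ℂ (fun ξ : Space d => ((bracket ξ ^ (-(s / 2)) : ℝ) : ℂ)) ψ with hχ
  refine ⟨𝓕⁻ χ, ?_⟩
  rw [dist_comm, dist_eq_norm] at hψ
  have e : (𝓕 ((𝓕⁻ χ).toLp 2 volume) : L2 d) = χ.toLp 2 volume := by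
    rw [SchwartzMap.toLp_fourier_eq, FourierTransform.fourier_fourierInv_eq]
  have h : sobolevNorm s ((𝓕⁻ χ).toLp 2 volume - u) = ‖ψ.toLp 2 volume - hW.toLp _‖ₑ := by
    rw [sobolevNorm_def, Lp.enorm_def]
    apply eLpNorm_congr_ae
    filter_upwards [coeFn_fourier_sub ((𝓕⁻ χ).toLp 2 volume) u, χ.coeFn_toLp 2 volume,
      ψ.coeFn_toLp 2 volume, hW.coeFn_toLp, Lp.coeFn_sub (ψ.toLp 2 volume) (hW.toLp _)]
      with ξ h1 h2 h3 h4 h5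
    rw [h1, h5, Pi.sub_apply, h3, h4, e, h2, hχ,
      SchwartzMap.smulLeftCLM_apply_apply (hasTemperateGrowth_bracket_rpow _), mul_sub, smul_eq_mul,
      ← mul_assoc, ← Complex.ofReal_mul, ← Real.rpow_add (bracket_pos ξ)]
    simp
  rw [h, ← ofReal_norm]
  exact ENNReal.ofReal_le_ofReal hψ.le

lemma exists_schwartz_seq {s : ℝ} (hs : 0 ≤ s) {u : L2 d} (hu : sobolevNorm s u < ∞) {ε : ℝ}
    (hε : 0 < ε) : ∃ φ : ℕ → 𝓢(Space d, ℂ),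
      (∀ n, sobolevNorm s ((φ n).toLp 2 volume - u) ≤ ENNReal.ofReal ε) ∧
      Tendsto (fun n => ((φ n).toLp 2 volume : L2 d)) atTop (𝓝 u) := by
  have h : ∀ n : ℕ, ∃ φ : 𝓢(Space d, ℂ),
      sobolevNorm s (φ.toLp 2 volume - u) ≤ ENNReal.ofReal (ε / (n + 1)) := fun n =>
    exists_schwartz_sobolevNorm_sub_le hu (by positivity)
  choose φ hφ using h
  refine ⟨φ, fun n => (hφ n).trans (ENNReal.ofReal_le_ofReal ?_), ?_⟩
  · apply div_le_self hε.le
    linarith [Nat.cast_nonneg (α := ℝ) n]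
  · rw [tendsto_iff_norm_sub_tendsto_zero]
    have ht : Tendsto (fun n : ℕ => ε / ((n : ℝ) + 1)) atTop (𝓝 0) :=
      tendsto_const_div_atTop_nhds_zero_nat ε |>.comp (tendsto_add_atTop_nat 1) |>.congr
        fun n => by simp
    refine squeeze_zero (fun _ => norm_nonneg _) (fun n => ?_) ht
    have := (enorm_le_sobolevNorm hs _).trans (hφ n)
    rw [← ofReal_norm] at this
    exact (ENNReal.ofReal_le_ofReal_iff (by positivity)).1 this

/-- Constant of the Sobolev embedding `H^ρ ⊂ L^∞`. -/
def sobolevConst (d : ℕ) (ρ : ℝ) : ℝ := (bracketMass d ρ ^ ((1 : ℝ) / 2)).toReal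

lemma norm_schwartz_le_of_hs {ρ : ℝ} (hρ : (d : ℝ) / 2 < ρ) {M : ℝ} (hM : 0 ≤ M)
    {f : 𝓢(Space d, ℂ)} (hf : hs ρ f ≤ ENNReal.ofReal M) (x : Space d) :
    ‖f x‖ ≤ sobolevConst d ρ * M := by
  have h := sup_schwartz_le ρ f x
  have e : (bracketMass d ρ ^ ((1 : ℝ) / 2)) ^ 2 = bracketMass d ρ := by
    rw [← ENNReal.rpow_natCast, ← ENNReal.rpow_mul]; norm_num
  rw [← e, ← mul_pow] at h
  have h2 := (ENNReal.pow_right_strictMono two_ne_zero).le_iff_le.1 h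
  have h3 : ‖f x‖ₑ ≤ bracketMass d ρ ^ ((1 : ℝ) / 2) * ENNReal.ofReal M := h2.trans (by gcongr)
  have hne : bracketMass d ρ ^ ((1 : ℝ) / 2) ≠ ∞ :=
    ENNReal.rpow_ne_top_of_nonneg (by norm_num) (bracketMass_lt_top hρ).ne
  have h4 := ENNReal.toReal_mono (ENNReal.mul_ne_top hne ENNReal.ofReal_ne_top) h3
  rwa [toReal_enorm, ENNReal.toReal_mul, ENNReal.toReal_ofReal hM] at h4

/-- The Sobolev embedding `H^ρ ⊂ L^∞`, `ρ > d/2`. -/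
lemma ae_norm_le_of_sobolevNorm_le {ρ : ℝ} (hρ : (d : ℝ) / 2 < ρ) {M : ℝ} (hM : 0 ≤ M)
    {u : L2 d} (hu : sobolevNorm ρ u ≤ ENNReal.ofReal M) :
    ∀ᵐ x, ‖u x‖ ≤ sobolevConst d ρ * (M + 1) := by
  have hρ0 : 0 ≤ ρ := by
    have : 0 ≤ (d : ℝ) / 2 := by positivity
    linarith
  -- Approximants within distance `1` in `H^ρ` have norm at most `M + 1`, whence the constant. Their
  -- pointwise bound passes to an almost everywhere limit.
  obtain ⟨φ, hφ, hlim⟩ := exists_schwartz_seq hρ0 (hu.trans_lt ENNReal.ofReal_lt_top) one_pos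
  obtain ⟨ns, -, hae⟩ := (tendstoInMeasure_of_tendsto_Lp hlim).exists_seq_tendsto_ae
  have hco : ∀ᵐ x, ∀ n, ((φ n).toLp 2 volume : L2 d) x = φ n x :=
    ae_all_iff.2 fun n => (φ n).coeFn_toLp 2 volume
  filter_upwards [hae, hco] with x hx hx2
  refine le_of_tendsto hx.norm (Eventually.of_forall fun n => ?_)
  rw [hx2]
  apply norm_schwartz_le_of_hs hρ (by linarith)
  rw [← sobolevNorm_schwartz, ENNReal.ofReal_add hM zero_le_one]
  exact (sobolevNorm_le_add_sub ρ _ u).trans (add_le_add hu (hφ _))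

/-! ### The nonlinearity and its truncation. -/

/-- The nonlinearity `|z|^{2σ} z`. -/
def nonlin (σ : ℝ) (z : ℂ) : ℂ := ((‖z‖ ^ (2 * σ) : ℝ) : ℂ) * z

lemma nonlin_eq_monom (σ : ℝ) : nonlin σ = monom 1 0 (2 * σ) := by
  ext z; simp [nonlin, monom, mul_comm]

lemma nonlin_eq_monom_of_nat (n : ℕ) : nonlin n = monom (n + 1) n 0 := by
  ext z
  have : ((‖z‖ ^ (2 * (n : ℝ)) : ℝ) : ℂ) = z ^ n * (starRingEnd ℂ z) ^ n := by
    rw [← mul_pow, Complex.mul_conj, Complex.normSq_eq_norm_sq]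
    rw [Real.rpow_mul (norm_nonneg _), Real.rpow_natCast]
    push_cast
    norm_num
  rw [nonlin, this]
  simp [monom, pow_succ]
  ring

lemma norm_nonlin_le {σ M : ℝ} (hσ : 0 < σ) {z : ℂ} (hz : ‖z‖ ≤ M) :
    ‖nonlin σ z‖ ≤ M ^ (2 * σ) * ‖z‖ := by
  rw [nonlin, norm_mul, Complex.norm_real, Real.norm_of_nonneg (by positivity)]
  gcongr

/-- For integer `σ` the nonlinearity is a polynomial in `z`, `z̄`. Otherwise its degree `2σ + 1`
exceeds `r` strictly as soon as `r ≤ 2σ`. -/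
lemma exists_regBound_nonlin {σ : ℝ} {r : ℕ}
    (h : (∃ n : ℕ, σ = n) ∨ (r : ℝ) ≤ 2 * σ) (M : ℝ) : ∃ B, RegBound M B r (nonlin σ) := by
  rcases h with ⟨n, rfl⟩ | h
  · rw [nonlin_eq_monom_of_nat]
    exact exists_regBound_monom M (Or.inr rfl)
  · rw [nonlin_eq_monom]
    exact exists_regBound_monom M (Or.inl (by push_cast; linarith))

/-- A globally Lipschitz function which agrees with `|z|^{2σ} z` on a disc. -/
lemma exists_lipschitz_eq_nonlin {σ : ℝ} {k : ℕ} {M B : ℝ} (hM : 0 ≤ M)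
    (h : RegBound M B (k + 1) (nonlin σ)) :
    ∃ (K : NNReal) (g : ℂ → ℂ), LipschitzWith K g ∧ g 0 = 0 ∧ ∀ z, ‖z‖ ≤ M → g z = nonlin σ z := by
  obtain ⟨-, α, β, hder, hα, hβ⟩ := h
  have hB0 : 0 ≤ B := (norm_nonneg _).trans (hα.zero.2 0 (by simpa using hM))
  have hlip : LipschitzOnWith (B + B).toNNReal (nonlin σ) (Metric.closedBall 0 M) := by
    refine (convex_closedBall (0 : ℂ) M).lipschitzOnWith_of_nnnorm_hasFDerivWithin_le
      (f' := fun z => wirtinger (α z) (β z)) (fun z _ => (hder z).hasFDerivWithinAt) fun z hz => ?_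
    have hz' : ‖z‖ ≤ M := by simpa using hz
    rw [← NNReal.coe_le_coe, coe_nnnorm, Real.coe_toNNReal _ (by linarith)]
    exact (norm_wirtinger_le _ _).trans (add_le_add (hα.zero.2 _ hz') (hβ.zero.2 _ hz'))
  obtain ⟨g, hg, heq⟩ := hlip.extend_finite_dimension
  have heq' : ∀ z, ‖z‖ ≤ M → g z = nonlin σ z := fun z hz => (heq (by simpa using hz)).symm
  refine ⟨_, g, hg, ?_, heq'⟩
  rw [heq' 0 (by simpa using hM)]
  simp [nonlin]


/-- The data of a truncated nonlinearity: on a ball of `H^ρ`, `ρ > d/2`, the nonlinearity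
`|u|^{2σ} u` coincides with a globally Lipschitz map of `L²` which is bounded on `H^r`. -/
theorem exists_truncation {σ : ℝ} (hσ : 0 < σ) {k : ℕ} {ρ : ℝ} (hρ : (d : ℝ) / 2 < ρ)
    (hkρ : (k : ℝ) ≤ ρ) (hρr : ρ ≤ k + 1)
    (hreg : (∃ n : ℕ, σ = n) ∨ ((k + 1 : ℕ) : ℝ) ≤ 2 * σ) {M : ℝ} (hM : 0 ≤ M) :
    ∃ (K : NNReal) (N : L2 d → L2 d) (C : NNReal), LipschitzWith K N ∧ N 0 = 0 ∧
      ∀ u : L2 d, sobolevNorm ρ u ≤ ENNReal.ofReal M →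
        (N u =ᵐ[volume] fun x => ((‖u x‖ ^ (2 * σ) : ℝ) : ℂ) * u x) ∧
        sobolevNorm ((k : ℝ) + 1) (N u) ≤ C * sobolevNorm ((k : ℝ) + 1) u := by
  -- Schwartz approximants of `u` have `H^ρ` norm at most `M + 1` and sup norm at most the Sobolev
  -- constant times `M + 1`. `M'` dominates both, so that one disc serves for the truncation and for
  -- the tame estimate.
  set M' : ℝ := max (M + 1) (sobolevConst d ρ * (M + 1)) with hM'
  have hM'0 : 0 ≤ M' := by
    have := le_max_left (M + 1) (sobolevConst d ρ * (M + 1))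
    linarith
  obtain ⟨B₀, hB₀⟩ := exists_regBound_nonlin hreg M'
  set B : ℝ := max B₀ (M' ^ (2 * σ)) with hB
  have hBr : RegBound M' B (k + 1) (nonlin σ) := hB₀.mono (le_max_left _ _)
  obtain ⟨K, g, hgl, hg0, hgeq⟩ := exists_lipschitz_eq_nonlin hM'0 hBr
  obtain ⟨C, hC, htame⟩ := hs_comp_le (d := d) hρ (M := M') (B := B) k hkρ
  obtain ⟨-, α, β, hder, hα, hβ⟩ := hBr
  have hC1 : C + 1 ≠ ∞ := ENNReal.add_ne_top.2 ⟨hC, ENNReal.one_ne_top⟩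
  -- `C + 1` is nonzero, so the bound remains valid, as `∞ ≤ ∞`, when `u` is not in `H^{k+1}`.
  refine ⟨K, fun u => hgl.compLp hg0 u, (C + 1).toNNReal, hgl.lipschitzWith_compLp hg0,
    hgl.compLp_zero hg0, fun u hu => ⟨?_, ?_⟩⟩
  · filter_upwards [hgl.coeFn_compLp hg0 u, ae_norm_le_of_sobolevNorm_le hρ hM hu] with x h1 h2
    rw [h1, Function.comp_apply, hgeq _ (h2.trans (le_max_right _ _))]
    rfl
  rw [ENNReal.coe_toNNReal hC1]
  rcases eq_or_ne (sobolevNorm ((k : ℝ) + 1) u) ∞ with htop | htop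
  · rw [htop, ENNReal.mul_top (by simp)]; exact le_top
  -- The tame estimate holds for Schwartz functions. The `L²` continuity of the truncated map and
  -- lower semicontinuity of the norm carry it to `u` up to `ε`, which then tends to `0`.
  have key : ∀ ε : ℝ, 0 < ε → ε ≤ 1 → sobolevNorm ((k : ℝ) + 1) (hgl.compLp hg0 u) ≤
      C * (sobolevNorm ((k : ℝ) + 1) u + ENNReal.ofReal ε) := by
    intro ε hε hε1
    obtain ⟨φ, hφ, hlim⟩ := exists_schwartz_seq (by positivity) (lt_top_iff_ne_top.2 htop) hε
    refine sobolevNorm_le_of_tendsto (((hgl.continuous_compLp hg0).tendsto u).comp hlim) fun n => ?_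
    have h1 : hs ρ (φ n) ≤ ENNReal.ofReal (M + 1) := by
      rw [← sobolevNorm_schwartz, ENNReal.ofReal_add hM zero_le_one]
      refine (sobolevNorm_le_add_sub ρ _ u).trans (add_le_add hu ?_)
      exact (sobolevNorm_mono hρr _).trans ((hφ n).trans (ENNReal.ofReal_le_ofReal hε1))
    have h2 : ∀ x, ‖φ n x‖ ≤ M' := fun x =>
      (norm_schwartz_le_of_hs hρ (by linarith) h1 x).trans (le_max_right _ _)
    have h3 := htame (nonlin σ) α β hder (fun z hz => (norm_nonlin_le hσ hz).trans
      (by gcongr; exact le_max_right _ _)) hα hβ (φ n) h2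
      (h1.trans (ENNReal.ofReal_le_ofReal (le_max_left _ _)))
    have hFc : Continuous (nonlin σ) := continuous_iff_continuousAt.2 fun z => (hder z).continuousAt
    have hFu : Continuous fun x => nonlin σ (φ n x) := hFc.comp (φ n).continuous
    have i1 : Integrable (fun x => nonlin σ (φ n x)) :=
      ((φ n).integrable.norm.const_mul (M' ^ (2 * σ))).mono' hFu.aestronglyMeasurable
        (Eventually.of_forall fun x => norm_nonlin_le hσ (h2 x))
    have i2 : MemLp (fun x => nonlin σ (φ n x)) 2 :=
      ((φ n).memLp 2 volume).of_le_mul (c := M' ^ (2 * σ)) hFu.aestronglyMeasurable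
        (Eventually.of_forall fun x => norm_nonlin_le hσ (h2 x))
    have e : hgl.compLp hg0 ((φ n).toLp 2 volume) = i2.toLp _ := by
      apply Lp.ext
      filter_upwards [hgl.coeFn_compLp hg0 ((φ n).toLp 2 volume), i2.coeFn_toLp,
        (φ n).coeFn_toLp 2 volume] with x e1 e2 e3
      rw [e1, e2, Function.comp_apply, e3, hgeq _ (h2 x)]
    simp only [Function.comp_apply]
    rw [e, sobolevNorm_toLp _ i1 i2]
    refine h3.trans ?_
    gcongr
    rw [← sobolevNorm_schwartz]
    exact (sobolevNorm_le_add_sub _ _ u).trans (add_le_add le_rfl (hφ n))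
  refine le_trans ?_ (mul_le_mul_left (self_le_add_right C 1) _)
  have ht : Tendsto (fun ε : ℝ => C * (sobolevNorm ((k : ℝ) + 1) u + ENNReal.ofReal ε)) (𝓝[>] 0)
      (𝓝 (C * (sobolevNorm ((k : ℝ) + 1) u + ENNReal.ofReal 0))) := by
    apply ENNReal.Tendsto.const_mul _ (Or.inr hC)
    exact tendsto_const_nhds.add
      ((ENNReal.continuous_ofReal.tendsto 0).mono_left nhdsWithin_le_nhds)
  rw [ENNReal.ofReal_zero, add_zero] at ht
  refine ge_of_tendsto ht ?_
  filter_upwards [Ioc_mem_nhdsGT (zero_lt_one' ℝ)] with ε hε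
  exact key ε hε.1 hε.2


/-! ### Fourier multipliers and the free flow. -/

lemma norm_fourierInv_eq (f : L2 d) : ‖(𝓕⁻ f : L2 d)‖ = ‖f‖ :=
  (Lp.fourierTransformₗᵢ (Space d) ℂ).symm.norm_map f

lemma enorm_eq_eLpNorm_fourier (f : L2 d) : ‖f‖ₑ = eLpNorm (𝓕 f : L2 d) 2 volume := by
  rw [← Lp.enorm_def, ← ofReal_norm, ← ofReal_norm, Lp.norm_fourier_eq]

lemma memLp_mul_of_bounded {b : Space d → ℂ} (hb : AEStronglyMeasurable b volume) {C : ℝ}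
    (hC : ∀ ξ, ‖b ξ‖ ≤ C) (f : L2 d) : MemLp (fun ξ => b ξ * f ξ) 2 volume := by
  refine (Lp.memLp f).of_le_mul (c := C) (hb.mul (Lp.aestronglyMeasurable f))
    (Eventually.of_forall fun ξ => ?_)
  rw [norm_mul]
  gcongr
  exact hC ξ

/-- The Fourier multiplier by a bounded function `b`, on `L²`. -/
def multOp {b : Space d → ℂ} (hb : AEStronglyMeasurable b volume) {C : ℝ}
    (hC : ∀ ξ, ‖b ξ‖ ≤ C) : L2 d →L[ℂ] L2 d :=
  LinearMap.mkContinuous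
    { toFun := fun f => 𝓕⁻ ((memLp_mul_of_bounded hb hC (𝓕 f : L2 d)).toLp)
      map_add' := fun f g => by
        rw [← FourierTransform.fourierInv_add]
        congr 1
        apply Lp.ext
        filter_upwards [MemLp.coeFn_toLp (memLp_mul_of_bounded hb hC (𝓕 (f + g) : L2 d)),
          MemLp.coeFn_toLp (memLp_mul_of_bounded hb hC (𝓕 f : L2 d)),
          MemLp.coeFn_toLp (memLp_mul_of_bounded hb hC (𝓕 g : L2 d)), coeFn_fourier_add f g,
          Lp.coeFn_add ((memLp_mul_of_bounded hb hC (𝓕 f : L2 d)).toLp)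
            ((memLp_mul_of_bounded hb hC (𝓕 g : L2 d)).toLp)] with ξ h1 h2 h3 h4 h5
        rw [h1, h5, Pi.add_apply, h2, h3, h4, mul_add]
      map_smul' := fun c f => by
        rw [RingHom.id_apply, ← FourierTransform.fourierInv_smul]
        congr 1
        apply Lp.ext
        filter_upwards [MemLp.coeFn_toLp (memLp_mul_of_bounded hb hC (𝓕 (c • f) : L2 d)),
          MemLp.coeFn_toLp (memLp_mul_of_bounded hb hC (𝓕 f : L2 d)), coeFn_fourier_smul c f,
          Lp.coeFn_smul c ((memLp_mul_of_bounded hb hC (𝓕 f : L2 d)).toLp)] with ξ h1 h2 h4 h5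
        rw [h1, h5, Pi.smul_apply, h2, h4, smul_eq_mul]
        ring } C fun f => by
    simp only [LinearMap.coe_mk, AddHom.coe_mk]
    rw [norm_fourierInv_eq]
    have h0 : 0 ≤ C := (norm_nonneg _).trans (hC 0)
    rw [← Lp.norm_fourier_eq f]
    refine Lp.norm_le_mul_norm_of_ae_le_mul ?_
    filter_upwards [MemLp.coeFn_toLp (memLp_mul_of_bounded hb hC (𝓕 f : L2 d))] with ξ h1
    rw [h1, norm_mul]
    gcongr
    exact hC ξ

lemma multOp_apply {b : Space d → ℂ} (hb : AEStronglyMeasurable b volume) {C : ℝ}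
    (hC : ∀ ξ, ‖b ξ‖ ≤ C) (f : L2 d) :
    multOp hb hC f = 𝓕⁻ ((memLp_mul_of_bounded hb hC (𝓕 f : L2 d)).toLp) := rfl

lemma fourier_multOp {b : Space d → ℂ} (hb : AEStronglyMeasurable b volume) {C : ℝ}
    (hC : ∀ ξ, ‖b ξ‖ ≤ C) (f : L2 d) :
    ((𝓕 (multOp hb hC f) : L2 d) : Space d → ℂ) =ᵐ[volume] fun ξ => b ξ * (𝓕 f : L2 d) ξ := by
  rw [multOp_apply, FourierTransform.fourier_fourierInv_eq]
  exact MemLp.coeFn_toLp _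

lemma enorm_multOp {b : Space d → ℂ} (hb : AEStronglyMeasurable b volume) {C : ℝ}
    (hC : ∀ ξ, ‖b ξ‖ ≤ C) (f : L2 d) :
    ‖multOp hb hC f‖ₑ = eLpNorm (fun ξ => b ξ * (𝓕 f : L2 d) ξ) 2 volume := by
  rw [enorm_eq_eLpNorm_fourier]
  exact eLpNorm_congr_ae (fourier_multOp hb hC f)

lemma tendsto_eLpNorm_mul_zero {ι : Type*} {l : Filter ι} [l.IsCountablyGenerated]
    {b : ι → Space d → ℂ} (hb : ∀ n, AEStronglyMeasurable (b n) volume) {C : ℝ}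
    (hC : ∀ n ξ, ‖b n ξ‖ ≤ C) (h0 : ∀ᵐ ξ, Tendsto (fun n => b n ξ) l (𝓝 0)) (f : L2 d) :
    Tendsto (fun n => eLpNorm (fun ξ => b n ξ * f ξ) 2 volume) l (𝓝 0) := by
  have h2 : Tendsto (fun n => ∫⁻ ξ, ‖b n ξ * f ξ‖ₑ ^ 2) l (𝓝 (∫⁻ _ξ : Space d, 0)) := by
    refine tendsto_lintegral_filter_of_dominated_convergence'
      (fun ξ => ENNReal.ofReal C ^ 2 * ‖f ξ‖ₑ ^ 2) (Eventually.of_forall fun n => ?_)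
      (Eventually.of_forall fun n => Eventually.of_forall fun ξ => ?_) ?_ ?_
    · exact ((hb n).mul (Lp.aestronglyMeasurable f)).enorm.pow_const 2
    · rw [enorm_mul, mul_pow]
      gcongr
      rw [← ofReal_norm]
      exact ENNReal.ofReal_le_ofReal (hC n ξ)
    · rw [lintegral_const_mul' _ _ (by finiteness), ← eLpNorm_two_sq]
      have := (Lp.memLp f).2.ne
      finiteness
    · filter_upwards [h0] with ξ hξ
      have h3 : Tendsto (fun n => b n ξ * f ξ) l (𝓝 0) := by simpa using hξ.mul_const (f ξ)
      have h4 := (ENNReal.continuous_pow 2).tendsto _ |>.comp h3.enorm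
      simpa [Function.comp_def] using h4
  simp_rw [← eLpNorm_two_sq] at h2
  rw [lintegral_zero] at h2
  have h5 := (ENNReal.continuous_rpow_const (y := (2 : ℝ)⁻¹)).tendsto _ |>.comp h2
  have e : ∀ x : ℝ≥0∞, (x ^ 2) ^ (2 : ℝ)⁻¹ = x := fun x => by
    rw [← ENNReal.rpow_natCast, ← ENNReal.rpow_mul]; norm_num
  simpa [Function.comp_def, e] using h5

/-- The phase `exp (i t P(2πξ))`. -/
def phase (P : Space d → ℝ) (t : ℝ) (ξ : Space d) : ℂ :=
  Complex.exp (Complex.I * (t * P ((2 * Real.pi) • ξ) : ℝ))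

lemma norm_phase (P : Space d → ℝ) (t : ℝ) (ξ : Space d) : ‖phase P t ξ‖ = 1 := by
  rw [phase, mul_comm Complex.I, Complex.norm_exp_ofReal_mul_I]

lemma aemeasurable_dilate {P : Space d → ℝ} (hP : AEMeasurable P volume) {c : ℝ} (hc : c ≠ 0) :
    AEMeasurable (fun ξ : Space d => P (c • ξ)) volume := by
  refine hP.comp_quasiMeasurePreserving ⟨measurable_const_smul _, ?_⟩
  rw [Measure.map_addHaar_smul volume hc]
  exact Measure.smul_absolutelyContinuous

lemma aesm_phase {P : Space d → ℝ} (hP : AEMeasurable P volume) (t : ℝ) :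
    AEStronglyMeasurable (phase P t) volume :=
  (Complex.measurable_exp.comp_aemeasurable
    ((Complex.measurable_ofReal.comp_aemeasurable
      ((aemeasurable_dilate hP (by positivity)).const_mul t)).const_mul _)).aestronglyMeasurable

lemma freeFlow_eq {P : Space d → ℝ} (hP : AEMeasurable P volume) (t : ℝ) (f : L2 d) :
    freeFlow hP t f = multOp (aesm_phase hP t) (fun ξ => (norm_phase P t ξ).le) f := rfl

lemma fourier_freeFlow {P : Space d → ℝ} (hP : AEMeasurable P volume) (t : ℝ) (f : L2 d) :
    ((𝓕 (freeFlow hP t f) : L2 d) : Space d → ℂ) =ᵐ[volume]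
      fun ξ => phase P t ξ * (𝓕 f : L2 d) ξ :=
  fourier_multOp (aesm_phase hP t) (fun ξ => (norm_phase P t ξ).le) f

lemma sobolevNorm_freeFlow {P : Space d → ℝ} (hP : AEMeasurable P volume) (s t : ℝ) (f : L2 d) :
    sobolevNorm s (freeFlow hP t f) = sobolevNorm s f := by
  rw [sobolevNorm_def, sobolevNorm_def]
  apply eLpNorm_congr_norm_ae
  filter_upwards [fourier_freeFlow hP t f] with ξ h
  rw [h, norm_mul, norm_mul, norm_mul, norm_phase, one_mul]

lemma norm_freeFlow {P : Space d → ℝ} (hP : AEMeasurable P volume) (t : ℝ) (f : L2 d) :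
    ‖freeFlow hP t f‖ = ‖f‖ := by
  have h := sobolevNorm_freeFlow hP 0 t f
  rw [sobolevNorm_zero, sobolevNorm_zero] at h
  simpa using congrArg ENNReal.toReal h

lemma freeFlow_sub {P : Space d → ℝ} (hP : AEMeasurable P volume) (t : ℝ) (f g : L2 d) :
    freeFlow hP t (f - g) = freeFlow hP t f - freeFlow hP t g := by
  simp only [freeFlow_eq, map_sub]

lemma continuous_freeFlow_time {P : Space d → ℝ} (hP : AEMeasurable P volume) (f : L2 d) :
    Continuous fun t => freeFlow hP t f := by
  rw [continuous_iff_continuousAt]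
  intro t₀
  rw [ContinuousAt, tendsto_iff_norm_sub_tendsto_zero]
  have h := tendsto_eLpNorm_mul_zero (l := 𝓝 t₀) (b := fun t ξ => phase P t ξ - phase P t₀ ξ)
    (fun t => (aesm_phase hP t).sub (aesm_phase hP t₀)) (C := 2)
    (fun t ξ => (norm_sub_le _ _).trans (by rw [norm_phase, norm_phase]; norm_num))
    (Eventually.of_forall fun ξ => ?_) (𝓕 f : L2 d)
  · have e : ∀ t, ‖freeFlow hP t f - freeFlow hP t₀ f‖ =
        (eLpNorm (fun ξ => (phase P t ξ - phase P t₀ ξ) * (𝓕 f : L2 d) ξ) 2 volume).toReal := by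
      intro t
      rw [← toReal_enorm, enorm_eq_eLpNorm_fourier]
      congr 1
      apply eLpNorm_congr_ae
      filter_upwards [coeFn_fourier_sub (freeFlow hP t f) (freeFlow hP t₀ f),
        fourier_freeFlow hP t f, fourier_freeFlow hP t₀ f] with ξ h1 h2 h3
      rw [h1, h2, h3]; ring
    simp_rw [e]
    exact (ENNReal.tendsto_toReal ENNReal.zero_ne_top).comp h
  · have hc : Continuous fun t => phase P t ξ := by unfold phase; fun_prop
    have := (hc.tendsto t₀).sub_const (phase P t₀ ξ)
    rwa [sub_self] at this

/-- Strong continuity in time and the isometry property give joint continuity. -/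
lemma continuous_freeFlow {P : Space d → ℝ} (hP : AEMeasurable P volume) :
    Continuous fun p : ℝ × L2 d => freeFlow hP p.1 p.2 := by
  rw [continuous_iff_continuousAt]
  rintro ⟨t₀, f₀⟩
  rw [ContinuousAt, tendsto_iff_norm_sub_tendsto_zero]
  have h1 : Tendsto (fun p : ℝ × L2 d => ‖p.2 - f₀‖ +
      ‖freeFlow hP p.1 f₀ - freeFlow hP t₀ f₀‖) (𝓝 (t₀, f₀)) (𝓝 (‖f₀ - f₀‖ +
      ‖freeFlow hP t₀ f₀ - freeFlow hP t₀ f₀‖)) := by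
    have hc : Continuous fun p : ℝ × L2 d => ‖p.2 - f₀‖ +
      ‖freeFlow hP p.1 f₀ - freeFlow hP t₀ f₀‖ :=
      (continuous_snd.sub continuous_const).norm.add
        (((continuous_freeFlow_time hP f₀).comp continuous_fst).sub continuous_const).norm
    exact hc.tendsto (t₀, f₀)
  simp only [sub_self, norm_zero, add_zero] at h1
  refine squeeze_zero (fun _ => norm_nonneg _) (fun p => ?_) h1
  calc ‖freeFlow hP p.1 p.2 - freeFlow hP t₀ f₀‖ =
        ‖freeFlow hP p.1 (p.2 - f₀) + (freeFlow hP p.1 f₀ - freeFlow hP t₀ f₀)‖ := by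
        rw [freeFlow_sub]; congr 1; abel
    _ ≤ _ := (norm_add_le _ _).trans (by rw [norm_freeFlow])

/-- The multiplier `min(2, T |P|)` which controls `exp (itP) - 1` for `|t| ≤ T`. -/
def smallMult (P : Space d → ℝ) (T : ℝ) (ξ : Space d) : ℂ :=
  ((min 2 |T * P ((2 * Real.pi) • ξ)| : ℝ) : ℂ)

lemma norm_smallMult (P : Space d → ℝ) (T : ℝ) (ξ : Space d) :
    ‖smallMult P T ξ‖ = min 2 |T * P ((2 * Real.pi) • ξ)| := by
  rw [smallMult, Complex.norm_real, Real.norm_of_nonneg (by positivity)]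

lemma norm_smallMult_le (P : Space d → ℝ) (T : ℝ) (ξ : Space d) : ‖smallMult P T ξ‖ ≤ 2 := by
  rw [norm_smallMult]; exact min_le_left _ _

lemma aesm_smallMult {P : Space d → ℝ} (hP : AEMeasurable P volume) (T : ℝ) :
    AEStronglyMeasurable (smallMult P T) volume := by
  have h := (aemeasurable_dilate hP (c := 2 * Real.pi) (by positivity)).const_mul T
  have h2 : AEMeasurable (fun ξ => min 2 |T * P ((2 * Real.pi) • ξ)|) volume :=
    aemeasurable_const.min (measurable_norm.comp_aemeasurable h)
  exact (Complex.measurable_ofReal.comp_aemeasurable h2).aestronglyMeasurable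

/-- Since `|exp(ip) - 1| ≤ min(2, |p|)`, one bounded multiplier controls all times `|t| ≤ T`, so
smallness obtained for it is uniform in time. -/
lemma norm_freeFlow_sub_le {P : Space d → ℝ} (hP : AEMeasurable P volume) {t T : ℝ} (ht : |t| ≤ T)
    (f : L2 d) : ‖freeFlow hP t f - f‖ ≤
      ‖multOp (aesm_smallMult hP T) (norm_smallMult_le P T) f‖ := by
  have h : ‖freeFlow hP t f - f‖ₑ ≤
      ‖multOp (aesm_smallMult hP T) (norm_smallMult_le P T) f‖ₑ := by
    rw [enorm_multOp, enorm_eq_eLpNorm_fourier]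
    apply eLpNorm_mono_ae
    filter_upwards [coeFn_fourier_sub (freeFlow hP t f) f, fourier_freeFlow hP t f] with ξ h1 h2
    rw [h1, h2, norm_mul, norm_smallMult, ← sub_one_mul, norm_mul]
    gcongr
    refine le_min ((norm_sub_le _ _).trans (by rw [norm_phase]; norm_num)) ?_
    refine (Real.norm_exp_I_mul_ofReal_sub_one_le (x := t * P ((2 * Real.pi) • ξ))).trans ?_
    rw [Real.norm_eq_abs, abs_mul, abs_mul]
    exact mul_le_mul_of_nonneg_right (ht.trans (le_abs_self T)) (abs_nonneg _)
  exact (enorm_le_iff_norm_le).1 h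

/-! ### Minkowski's inequality and interpolation in `H^s`. -/

/-- Minkowski's inequality for the `H^s` norm of an integral. -/
lemma sobolevNorm_integral_le {s a b : ℝ} (hab : a ≤ b) {f : ℝ → L2 d}
    (hf : IntervalIntegrable f volume a b) {m : ℝ → ℝ} (hm : IntervalIntegrable m volume a b)
    (hm0 : ∀ τ ∈ Set.Ioc a b, 0 ≤ m τ)
    (h : ∀ τ ∈ Set.Ioc a b, sobolevNorm s (f τ) ≤ ENNReal.ofReal (m τ)) :
    sobolevNorm s (∫ τ in a..b, f τ) ≤ ENNReal.ofReal (∫ τ in a..b, m τ) := by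
  -- The integral is taken in `L²`, where the `H^s` weight is unbounded. The weight cut off at
  -- height `k` gives a bounded operator, which commutes with the integral; Fatou's lemma then
  -- removes the cutoff.
  set w : ℕ → Space d → ℂ := fun k ξ => ((min (bracket ξ ^ (s / 2)) k : ℝ) : ℂ) with hw
  have hw0 : ∀ k (ξ : Space d), ‖w k ξ‖ = min (bracket ξ ^ (s / 2)) k := fun k ξ => by
    have := Real.rpow_nonneg (bracket_pos ξ).le (s / 2)
    rw [hw, Complex.norm_real, Real.norm_of_nonneg (by positivity)]
  have hwm : ∀ k, AEStronglyMeasurable (w k) volume := fun k =>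
    (Complex.continuous_ofReal.comp
      ((continuous_bracket_rpow _).min continuous_const)).aestronglyMeasurable
  have hwb : ∀ k (ξ : Space d), ‖w k ξ‖ ≤ k := fun k ξ => by rw [hw0]; exact min_le_right _ _
  have hJ : ∀ k (g : L2 d), ‖multOp (hwm k) (hwb k) g‖ₑ ≤ sobolevNorm s g := by
    intro k g
    rw [enorm_multOp, sobolevNorm_def]
    apply eLpNorm_mono
    intro ξ
    rw [norm_mul, norm_mul, hw0, Complex.norm_real,
      Real.norm_of_nonneg (Real.rpow_nonneg (bracket_pos ξ).le (s / 2))]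
    gcongr
    exact min_le_left _ _
  have hbound : ∀ k, ‖multOp (hwm k) (hwb k) (∫ τ in a..b, f τ)‖ₑ ≤
      ENNReal.ofReal (∫ τ in a..b, m τ) := by
    intro k
    rw [← ContinuousLinearMap.intervalIntegral_comp_comm _ hf, ← ofReal_norm]
    apply ENNReal.ofReal_le_ofReal
    refine intervalIntegral.norm_integral_le_of_norm_le hab (Eventually.of_forall fun τ hτ => ?_) hm
    have := (hJ k (f τ)).trans (h τ hτ)
    rw [← ofReal_norm] at this
    exact (ENNReal.ofReal_le_ofReal_iff (hm0 τ hτ)).1 this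
  rw [sobolevNorm_def]
  refine (Lp.eLpNorm_lim_le_liminf_eLpNorm
    (f := fun k ξ => w k ξ * (𝓕 (∫ τ in a..b, f τ) : L2 d) ξ)
    (fun k => (hwm k).mul (Lp.aestronglyMeasurable _)) _
    (Eventually.of_forall fun ξ => ?_)).trans ?_
  · apply Tendsto.mul_const
    apply tendsto_const_nhds.congr'
    filter_upwards [eventually_ge_atTop ⌈bracket ξ ^ (s / 2)⌉₊] with k hk
    rw [hw]
    simp only
    rw [min_eq_left]
    exact (Nat.le_ceil _).trans (by exact_mod_cast hk)
  · refine liminf_le_of_frequently_le' (Frequently.of_forall fun k => ?_)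
    have := hbound k
    rwa [enorm_multOp] at this

/-- Interpolation: for `0 ≤ ρ < r`, the `H^ρ` norm is controlled by a small multiple of the
`H^r` norm and a large multiple of the `L²` norm. -/
lemma exists_sobolevNorm_le_add {ρ r : ℝ} (hρ : 0 ≤ ρ) (hr : ρ < r) {ε : ℝ} (hε : 0 < ε) :
    ∃ C : ℝ, 0 ≤ C ∧ ∀ f : L2 d, sobolevNorm ρ f ≤
      ENNReal.ofReal ε * sobolevNorm r f + ENNReal.ofReal C * ‖f‖ₑ := by
  -- Threshold between high and low frequencies: `K ^ (-((r - ρ) / 2)) = ε`, so above it `H^ρ` costs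
  -- at most `ε` times `H^r`.
  set K : ℝ := ε ^ (-(2 / (r - ρ))) with hK
  have hK0 : 0 < K := by positivity
  refine ⟨K ^ (ρ / 2), by positivity, fun f => ?_⟩
  have hpt : ∀ X : ℝ, 1 ≤ X → X ^ (ρ / 2) ≤ ε * X ^ (r / 2) + K ^ (ρ / 2) := by
    intro X hX
    have hX0 : 0 < X := by linarith
    rcases le_total K X with h | h
    · have h1 : X ^ (-((r - ρ) / 2)) ≤ ε := by
        calc X ^ (-((r - ρ) / 2)) ≤ K ^ (-((r - ρ) / 2)) :=
              Real.rpow_le_rpow_of_nonpos hK0 h (by linarith)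
          _ = ε := by
            rw [hK, ← Real.rpow_mul hε.le]
            have : -(2 / (r - ρ)) * -((r - ρ) / 2) = 1 := by
              have : r - ρ ≠ 0 := by linarith
              field_simp
            rw [this, Real.rpow_one]
      have h2 : X ^ (ρ / 2) = X ^ (-((r - ρ) / 2)) * X ^ (r / 2) := by
        rw [← Real.rpow_add hX0]; congr 1; ring
      rw [h2]
      have h3 : X ^ (-((r - ρ) / 2)) * X ^ (r / 2) ≤ ε * X ^ (r / 2) := by gcongr
      have : 0 ≤ K ^ (ρ / 2) := by positivity
      linarith
    · have h1 : X ^ (ρ / 2) ≤ K ^ (ρ / 2) := by gcongr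
      have : 0 ≤ ε * X ^ (r / 2) := by positivity
      linarith
  rw [sobolevNorm_def, sobolevNorm_def, enorm_eq_eLpNorm_fourier]
  calc _ ≤ eLpNorm ((fun ξ : Space d => ε * ‖((bracket ξ ^ (r / 2) : ℝ) : ℂ) * (𝓕 f : L2 d) ξ‖) +
        fun ξ => K ^ (ρ / 2) * ‖(𝓕 f : L2 d) ξ‖) 2 volume := by
        apply eLpNorm_mono_real
        intro ξ
        have hb := bracket_pos ξ
        simp only [Pi.add_apply]
        rw [norm_mul, norm_mul, Complex.norm_real, Complex.norm_real,
          Real.norm_of_nonneg (by positivity), Real.norm_of_nonneg (by positivity), ← mul_assoc,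
          ← add_mul]
        gcongr
        exact hpt _ (one_le_bracket ξ)
    _ ≤ _ := by
        refine (eLpNorm_add_le ((aesm_sobolev r f).norm.const_mul ε)
          ((Lp.aestronglyMeasurable (𝓕 f : L2 d)).norm.const_mul _) (by norm_num)).trans ?_
        apply add_le_add
        · apply eLpNorm_le_mul_eLpNorm_of_ae_le_mul (Eventually.of_forall fun ξ => ?_) 2
          rw [norm_mul, Real.norm_of_nonneg hε.le, norm_norm]
        · apply eLpNorm_le_mul_eLpNorm_of_ae_le_mul (Eventually.of_forall fun ξ => ?_) 2
          rw [norm_mul, Real.norm_of_nonneg (by positivity), norm_norm]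


/-! ### The Duhamel equation as a Volterra equation. -/

lemma continuous_duhamel_integrand {X : Type*} [TopologicalSpace X] {U : ℝ → X → X}
    (hU : Continuous fun p : ℝ × X => U p.1 p.2) {g : ℝ → X} (hg : Continuous g) :
    Continuous fun p : ℝ × ℝ => U (p.1 - p.2) (g p.2) :=
  hU.comp ((continuous_fst.sub continuous_snd).prodMk (hg.comp continuous_snd))

section Volterra

variable {X : Type*} [NormedAddCommGroup X] [NormedSpace ℝ X] [NormedSpace ℂ X]

/-- The right-hand side of Duhamel's formula. -/
def duhamel (U : ℝ → X → X) (N : X → X) (a : X) (c : ℂ) (u : ℝ → X) (t : ℝ) : X :=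
  U t a + c • ∫ τ in (0 : ℝ)..t, U (t - τ) (N (u τ))

lemma continuous_duhamel {U : ℝ → X → X} (hU : Continuous fun p : ℝ × X => U p.1 p.2)
    {N : X → X} (hN : Continuous N) (a : X) (c : ℂ) {u : ℝ → X} (hu : Continuous u) :
    Continuous (duhamel U N a c u) := by
  have h1 : Continuous fun t => U t a := hU.comp (continuous_id.prodMk continuous_const)
  have h2 : Continuous fun t : ℝ => ∫ τ in (0 : ℝ)..t, U (t - τ) (N (u τ)) :=
    intervalIntegral.continuous_parametric_intervalIntegral_of_continuous
      (continuous_duhamel_integrand hU (hN.comp hu)) continuous_id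
  exact h1.add (h2.const_smul c)

/-- Existence for the Duhamel equation with a globally Lipschitz nonlinearity, with invariance of
closed constraints. -/
theorem exists_duhamel_fixedPoint [CompleteSpace X] {U : ℝ → X → X} (hU : Continuous fun p : ℝ × X => U p.1 p.2)
    (hU1 : ∀ t x y, ‖U t x - U t y‖ ≤ ‖x - y‖) {N : X → X} {K : NNReal} (hN : LipschitzWith K N)
    (a : X) (c : ℂ) {T : ℝ} (hT : 0 ≤ T) {S : ℝ → Set X} (hS : ∀ t, IsClosed (S t))
    {v : ℝ → X} (hv : Continuous v) (hvS : ∀ t ∈ Set.Icc 0 T, v t ∈ S t)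
    (hinv : ∀ u : ℝ → X, Continuous u → (∀ t ∈ Set.Icc 0 T, u t ∈ S t) →
      ∀ t ∈ Set.Icc 0 T, duhamel U N a c u t ∈ S t) :
    ∃ u : ℝ → X, Continuous u ∧ (∀ t ∈ Set.Icc 0 T, u t ∈ S t) ∧
      ∀ t ∈ Set.Icc 0 T, u t = duhamel U N a c u t := by
  set ext : C(Set.Icc 0 T, X) → ℝ → X := fun u => Set.IccExtend hT u with hext
  have hextc : ∀ u, Continuous (ext u) := fun u => u.continuous.Icc_extend'
  have hexte : ∀ u (t : ℝ) (ht : t ∈ Set.Icc 0 T), ext u t = u ⟨t, ht⟩ := fun u t ht =>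
    Set.IccExtend_of_mem hT u ht
  set Ψ : C(Set.Icc 0 T, X) → C(Set.Icc 0 T, X) := fun u =>
    ⟨fun t => duhamel U N a c (ext u) t,
      (continuous_duhamel hU hN.continuous a c (hextc u)).comp continuous_subtype_val⟩ with hΨ
  set L : ℝ := ‖c‖ * K with hL
  have hL0 : 0 ≤ L := by positivity
  -- Each iteration integrates the previous bound once more, which produces the factorial. Some
  -- iterate is therefore a contraction for any `T`, and no small-time restriction or continuation
  -- argument is needed.
  have hiter : ∀ (n : ℕ) (u w : C(Set.Icc 0 T, X)) (t : Set.Icc (0 : ℝ) T),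
      ‖(Ψ^[n] u) t - (Ψ^[n] w) t‖ ≤ (L * t) ^ n / n.factorial * dist u w := by
    intro n u w
    induction n with
    | zero =>
      intro t
      simp only [Function.iterate_zero, id, pow_zero, Nat.factorial_zero, Nat.cast_one, div_one,
        one_mul]
      rw [← dist_eq_norm]
      exact ContinuousMap.dist_apply_le_dist t
    | succ n ih =>
      intro t
      rw [Function.iterate_succ_apply', Function.iterate_succ_apply']
      set u' := Ψ^[n] u
      set w' := Ψ^[n] w
      have ht0 : (0 : ℝ) ≤ t := t.2.1
      have hi : ∀ z : C(Set.Icc 0 T, X), IntervalIntegrable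
          (fun τ => U ((t : ℝ) - τ) (N (ext z τ))) volume 0 t := fun z =>
        ((continuous_duhamel_integrand hU (hN.continuous.comp (hextc z))).comp
          (continuous_const.prodMk continuous_id)).intervalIntegrable _ _
      have e : Ψ u' t - Ψ w' t = c • ∫ τ in (0 : ℝ)..t,
          (U ((t : ℝ) - τ) (N (ext u' τ)) - U ((t : ℝ) - τ) (N (ext w' τ))) := by
        rw [intervalIntegral.integral_sub (hi u') (hi w'), smul_sub]
        simp only [hΨ, ContinuousMap.coe_mk, duhamel]
        abel
      rw [e, norm_smul]
      have hb : ‖∫ τ in (0 : ℝ)..t,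
          (U ((t : ℝ) - τ) (N (ext u' τ)) - U ((t : ℝ) - τ) (N (ext w' τ)))‖ ≤
          ∫ τ in (0 : ℝ)..t, K * ((L * τ) ^ n / n.factorial * dist u w) := by
        refine intervalIntegral.norm_integral_le_of_norm_le ht0
          (Eventually.of_forall fun τ hτ => ?_) ?_
        · have hτ' : τ ∈ Set.Icc 0 T := ⟨hτ.1.le, hτ.2.trans t.2.2⟩
          refine (hU1 _ _ _).trans ?_
          rw [← dist_eq_norm]
          refine (hN.dist_le_mul _ _).trans ?_
          rw [hexte _ τ hτ', hexte _ τ hτ', dist_eq_norm]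
          gcongr
          exact ih ⟨τ, hτ'⟩
        · apply Continuous.intervalIntegrable
          fun_prop
      have hint : ∫ τ in (0 : ℝ)..t, K * ((L * τ) ^ n / n.factorial * dist u w) =
          K * (L ^ n * ((t : ℝ) ^ (n + 1) / (n + 1)) / n.factorial * dist u w) := by
        simp_rw [mul_pow]
        rw [intervalIntegral.integral_const_mul, intervalIntegral.integral_mul_const,
          intervalIntegral.integral_div, intervalIntegral.integral_const_mul, integral_pow]
        simp
      calc _ ≤ ‖c‖ * (K * (L ^ n * ((t : ℝ) ^ (n + 1) / (n + 1)) / n.factorial * dist u w)) := by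
            rw [← hint]; gcongr
        _ = (L * t) ^ (n + 1) / (n + 1).factorial * dist u w := by
            clear_value L
            have h1 : (n.factorial : ℝ) ≠ 0 := by positivity
            have h2 : (n : ℝ) + 1 ≠ 0 := by positivity
            have h3 : ((n + 1).factorial : ℝ) = (n + 1) * n.factorial := by
              rw [Nat.factorial_succ]; push_cast; ring
            have h4 : (L * t) ^ (n + 1) = (‖c‖ * K) * L ^ n * (t : ℝ) ^ (n + 1) := by
              rw [← hL]; ring
            rw [h3, h4]
            field_simp
  obtain ⟨n, hn⟩ : ∃ n : ℕ, (L * T) ^ n / n.factorial < 1 :=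
    ((FloorSemiring.tendsto_pow_div_factorial_atTop (L * T)).eventually
      (gt_mem_nhds one_pos)).exists
  have hq0 : 0 ≤ (L * T) ^ n / n.factorial := by positivity
  have hcontr : ContractingWith ((L * T) ^ n / n.factorial).toNNReal Ψ^[n] := by
    refine ⟨by rw [← NNReal.coe_lt_coe, Real.coe_toNNReal _ hq0]; exact hn,
      LipschitzWith.of_dist_le_mul fun u w => ?_⟩
    rw [Real.coe_toNNReal _ hq0, ContinuousMap.dist_le (by positivity)]
    intro t
    rw [dist_eq_norm]
    refine (hiter n u w t).trans ?_
    have := t.2.1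
    have := t.2.2
    gcongr
  have : Nonempty C(Set.Icc 0 T, X) := ⟨⟨fun t => v t, hv.comp continuous_subtype_val⟩⟩
  set z := ContractingWith.fixedPoint Ψ^[n] hcontr with hz
  -- `Ψ` commutes with its iterate, so it maps the unique fixed point of the iterate to itself.
  have hfix : Ψ z = z := hcontr.isFixedPt_fixedPoint_iterate
  set A : Set C(Set.Icc 0 T, X) := {u | ∀ t : Set.Icc (0 : ℝ) T, u t ∈ S t} with hA
  have hAc : IsClosed A := by
    have : A = ⋂ t : Set.Icc (0 : ℝ) T, (fun u : C(Set.Icc 0 T, X) => u t) ⁻¹' (S t) := by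
      ext u; simp [hA]
    rw [this]
    exact isClosed_iInter fun t => (hS t).preimage (continuous_eval_const t)
  have hAΨ : ∀ u ∈ A, Ψ u ∈ A := fun u hu t =>
    hinv (ext u) (hextc u) (fun τ hτ => by rw [hexte u τ hτ]; exact hu ⟨τ, hτ⟩) t t.2
  have hAiter : ∀ (m : ℕ), ∀ u ∈ A, Ψ^[m] u ∈ A := by
    intro m
    induction m with
    | zero => exact fun u hu => hu
    | succ m ih =>
      intro u hu
      rw [Function.iterate_succ_apply']
      exact hAΨ _ (ih u hu)
  -- The iterates started from `v` stay in the closed invariant set and converge to `z`.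
  have hzA : z ∈ A := by
    set v₀ : C(Set.Icc 0 T, X) := ⟨fun t => v t, hv.comp continuous_subtype_val⟩
    have hv₀ : v₀ ∈ A := fun t => hvS t t.2
    refine hAc.mem_of_tendsto (hcontr.tendsto_iterate_fixedPoint v₀)
      (Eventually.of_forall fun m => ?_)
    rw [← Function.iterate_mul]
    exact hAiter _ _ hv₀
  refine ⟨ext z, hextc z, fun t ht => by rw [hexte z t ht]; exact hzA ⟨t, ht⟩, fun t ht => ?_⟩
  rw [hexte z t ht]
  conv_lhs => rw [← hfix]
  rfl

end Volterra

lemma integral_mul_exp (L t : ℝ) :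
    ∫ τ in (0 : ℝ)..t, L * Real.exp (L * τ) = Real.exp (L * t) - 1 := by
  have h : ∀ τ ∈ Set.uIcc 0 t, HasDerivAt (fun τ => Real.exp (L * τ)) (L * Real.exp (L * τ)) τ := by
    intro τ _
    have := ((hasDerivAt_id τ).const_mul L).exp
    simpa [mul_comm] using this
  rw [intervalIntegral.integral_eq_sub_of_hasDerivAt h
    ((by fun_prop : Continuous fun τ => L * Real.exp (L * τ)).intervalIntegrable _ _)]
  simp


/-! ### Comparison with the dispersionless equation. -/

/-- On bounded sets of `H^r`, the `L²` topology controls the `H^ρ` topology for `ρ < r`. -/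
lemma exists_sobolevNorm_le_of_norm_le {ρ r : ℝ} (hρ : 0 ≤ ρ) (hr : ρ < r) {R : ℝ} (hR : 0 ≤ R)
    {ε : ℝ} (hε : 0 < ε) : ∃ δ > 0, ∀ f : L2 d, sobolevNorm r f ≤ ENNReal.ofReal R → ‖f‖ ≤ δ →
      sobolevNorm ρ f ≤ ENNReal.ofReal ε := by
  have hε' : 0 < ε / (2 * (R + 1)) := by positivity
  obtain ⟨C, hC, h⟩ := exists_sobolevNorm_le_add (d := d) hρ hr hε'
  refine ⟨ε / (2 * (C + 1)), by positivity, fun f hf hδ => (h f).trans ?_⟩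
  have h1 : ENNReal.ofReal (ε / (2 * (R + 1))) * sobolevNorm r f ≤ ENNReal.ofReal (ε / 2) := by
    calc _ ≤ ENNReal.ofReal (ε / (2 * (R + 1))) * ENNReal.ofReal R := by gcongr
      _ = ENNReal.ofReal (ε / (2 * (R + 1)) * R) := (ENNReal.ofReal_mul hε'.le).symm
      _ ≤ _ := by
        apply ENNReal.ofReal_le_ofReal
        rw [div_mul_eq_mul_div, div_le_div_iff₀ (by positivity) (by positivity)]
        nlinarith
  have h2 : ENNReal.ofReal C * ‖f‖ₑ ≤ ENNReal.ofReal (ε / 2) := by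
    rw [← ofReal_norm, ← ENNReal.ofReal_mul hC]
    apply ENNReal.ofReal_le_ofReal
    calc C * ‖f‖ ≤ C * (ε / (2 * (C + 1))) := by gcongr
      _ ≤ ε / 2 := by
        rw [mul_div_assoc', div_le_div_iff₀ (by positivity) (by positivity)]
        nlinarith
  calc _ ≤ ENNReal.ofReal (ε / 2) + ENNReal.ofReal (ε / 2) := add_le_add h1 h2
    _ = ENNReal.ofReal ε := by
      rw [← ENNReal.ofReal_add (by positivity) (by positivity), add_halves]

lemma ae_dilate {p : Space d → Prop} (h : ∀ᵐ ξ, p ξ) {c : ℝ} (hc : c ≠ 0) :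
    ∀ᵐ ξ : Space d, p (c • ξ) := by
  have hq : Measure.QuasiMeasurePreserving (fun ξ : Space d => c • ξ) volume volume := by
    refine ⟨measurable_const_smul _, ?_⟩
    rw [Measure.map_addHaar_smul volume hc]
    exact Measure.smul_absolutelyContinuous
  exact hq.ae h

/-- The defect operator `min(2, T|P(D)|)`. -/
def defect {P : Space d → ℝ} (hP : AEMeasurable P volume) (T : ℝ) : L2 d →L[ℂ] L2 d :=
  multOp (aesm_smallMult hP T) (norm_smallMult_le P T)

lemma norm_defect_le {P : Space d → ℝ} (hP : AEMeasurable P volume) (T : ℝ) (f : L2 d) :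
    ‖defect hP T f‖ ≤ 2 * ‖f‖ := by
  rw [← Lp.norm_fourier_eq (defect hP T f), ← Lp.norm_fourier_eq f]
  refine Lp.norm_le_mul_norm_of_ae_le_mul ?_
  filter_upwards [fourier_multOp (aesm_smallMult hP T) (norm_smallMult_le P T) f] with ξ h
  rw [defect, h, norm_mul]
  gcongr
  exact norm_smallMult_le P T ξ

/-- Dominated convergence on the Fourier side, the multiplier being at most `2`. The smallness of
the symbols enters the comparison with the ODE only through this limit. -/
lemma tendsto_defect {Q : ℕ → Space d → ℝ} (hQ : ∀ n, AEMeasurable (Q n) volume)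
    (h0 : ∀ᵐ ξ, Tendsto (fun n => Q n ξ) atTop (𝓝 0)) (T : ℝ) (f : L2 d) :
    Tendsto (fun n => ‖defect (hQ n) T f‖) atTop (𝓝 0) := by
  have h := tendsto_eLpNorm_mul_zero (l := atTop) (b := fun n => smallMult (Q n) T)
    (fun n => aesm_smallMult (hQ n) T) (C := 2) (fun n ξ => norm_smallMult_le (Q n) T ξ) ?_
    (𝓕 f : L2 d)
  · have e : ∀ n, ‖defect (hQ n) T f‖ =
        (eLpNorm (fun ξ => smallMult (Q n) T ξ * (𝓕 f : L2 d) ξ) 2 volume).toReal := fun n => by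
      rw [← toReal_enorm, defect, enorm_multOp]
    simp_rw [e]
    exact (ENNReal.tendsto_toReal ENNReal.zero_ne_top).comp h
  · filter_upwards [ae_dilate h0 (c := 2 * Real.pi) (by positivity)] with ξ hξ
    rw [tendsto_zero_iff_norm_tendsto_zero]
    simp_rw [norm_smallMult]
    have h1 : Tendsto (fun n => |T * Q n ((2 * Real.pi) • ξ)|) atTop (𝓝 0) := by
      have := (hξ.const_mul T).abs
      simpa using this
    exact squeeze_zero (fun n => by positivity) (fun n => min_le_right _ _) h1

set_option maxHeartbeats 1000000 in
/-- When the symbols tend to zero, the solutions with fixed initial datum approach the solution of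
the limiting ordinary differential equation. -/
theorem exists_isSolution_near_ode {σ ρ T R lam s ε : ℝ} {k : ℕ} (hσ : 0 < σ)
    (hρ : (d : ℝ) / 2 < ρ) (hkρ : (k : ℝ) ≤ ρ) (hρr : ρ < k + 1)
    (hreg : (∃ n : ℕ, σ = n) ∨ ((k + 1 : ℕ) : ℝ) ≤ 2 * σ) (hT : 0 ≤ T) (hR : 0 ≤ R)
    (hs0 : 0 ≤ s) (hsr : s < k + 1) (hε : 0 < ε) (a₀ : 𝓢(Space d, ℂ))
    {v G : ℝ → L2 d} (hv : Continuous v)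
    (hG : ∀ t ∈ Set.Icc 0 T,
      G t =ᵐ[volume] fun x : Space d => ((‖v t x‖ ^ (2 * σ) : ℝ) : ℂ) * v t x)
    (hode : ∀ t ∈ Set.Icc 0 T, v t = a₀.toLp 2 volume - (Complex.I * (lam : ℂ)) •
      ∫ τ in (0 : ℝ)..t, G τ)
    (hvR : ∀ t ∈ Set.Icc 0 T, sobolevNorm (k + 1) (v t) ≤ ENNReal.ofReal R)
    {Q : ℕ → Space d → ℝ} (hQ : ∀ n, AEMeasurable (Q n) volume)
    (hQ0 : ∀ᵐ ξ, Tendsto (fun n => Q n ξ) atTop (𝓝 0)) :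
    ∀ᶠ n in atTop, ∃ u : ℝ → L2 d, IsSolution (hQ n) lam σ a₀ T u ∧
      sobolevNorm s (u T - v T) ≤ ENNReal.ofReal ε := by
  have hρ0 : 0 ≤ ρ := by
    have : 0 ≤ (d : ℝ) / 2 := by positivity
    linarith
  -- The radius `R + 1` leaves room `1` in `H^ρ` around `v`, which is bounded by `R`.
  obtain ⟨K, N, C, hN, -, hNu⟩ :=
    exists_truncation (d := d) hσ hρ hkρ hρr.le hreg (M := R + 1) (by positivity)
  set L : ℝ := |lam| * C with hL
  set K' : ℝ := |lam| * K with hK'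
  have hL0 : 0 ≤ L := by positivity
  have hK0 : 0 ≤ K' := by positivity
  set R₂ : ℝ := R * Real.exp (L * T) + R * Real.exp (L * T) with hR₂
  have hR₂0 : 0 ≤ R₂ := by positivity
  obtain ⟨δ₁, hδ₁, hI₁⟩ := exists_sobolevNorm_le_of_norm_le (d := d) hρ0 hρr hR₂0 one_pos
  obtain ⟨δ₂, hδ₂, hI₂⟩ := exists_sobolevNorm_le_of_norm_le (d := d) hs0 hsr hR₂0 hε
  -- After Gronwall growth up to time `T` the `L²` distance is still below `δ₁`, which keeps the
  -- solution in the region where `N` is the true nonlinearity, and below `δ₂`, which gives the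
  -- final `H^s` bound.
  set δ : ℝ := min δ₁ δ₂ * Real.exp (-(K' * T)) with hδ
  have hδ0 : 0 < δ := mul_pos (lt_min hδ₁ hδ₂) (Real.exp_pos _)
  set c : ℂ := -(Complex.I * lam) with hc
  have hcn : ‖c‖ = |lam| := by simp [hc]
  set a : L2 d := a₀.toLp 2 volume with ha
  have hexpL : ∀ t ∈ Set.Icc 0 T, R * Real.exp (L * t) ≤ R * Real.exp (L * T) := fun t ht => by
    have := ht.2
    gcongr
  have hRexp : ∀ t ∈ Set.Icc 0 T, R ≤ R * Real.exp (L * t) := fun t ht =>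
    le_mul_of_one_le_right hR (Real.one_le_exp (mul_nonneg hL0 ht.1))
  have hδexp : ∀ t ∈ Set.Icc 0 T, δ * Real.exp (K' * t) ≤ min δ₁ δ₂ := fun t ht => by
    rw [hδ, mul_assoc, ← Real.exp_add]
    apply mul_le_of_le_one_right (lt_min hδ₁ hδ₂).le
    rw [Real.exp_le_one_iff]
    have := mul_le_mul_of_nonneg_left ht.2 hK0
    linarith
  have hvρ : ∀ t ∈ Set.Icc 0 T, sobolevNorm ρ (v t) ≤ ENNReal.ofReal R := fun t ht =>
    (sobolevNorm_mono hρr.le _).trans (hvR t ht)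
  have hGN : ∀ t ∈ Set.Icc 0 T, G t = N (v t) := by
    intro t ht
    have h1 := (hNu (v t) ((hvρ t ht).trans (ENNReal.ofReal_le_ofReal (by linarith)))).1
    exact Lp.ext ((hG t ht).trans h1.symm)
  have hv0 : v 0 = a := by
    have := hode 0 ⟨le_rfl, hT⟩
    simpa using this
  have hNv : Continuous fun τ => N (v τ) := hN.continuous.comp hv
  have hodeN : ∀ t ∈ Set.Icc 0 T, v t = a + c • ∫ τ in (0 : ℝ)..t, N (v τ) := by
    intro t ht
    rw [hode t ht, hc, neg_smul, sub_eq_add_neg]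
    congr 3
    apply intervalIntegral.integral_congr
    intro τ hτ
    rw [Set.uIcc_of_le ht.1] at hτ
    exact hGN τ ⟨hτ.1, hτ.2.trans ht.2⟩
  -- The two constraints support each other: together they bound the `H^ρ` norm by `R + 1`, where
  -- the tame `H^{k+1}` bound on `N` holds. They grow like the solutions of the corresponding
  -- Gronwall equations, with rates `L` and `K'`.
  set S : ℝ → Set (L2 d) := fun t => {f | sobolevNorm (k + 1) f ≤ ENNReal.ofReal
    (R * Real.exp (L * t))} ∩ {f | ‖f - v t‖ ≤ δ * Real.exp (K' * t)} with hS
  have hSc : ∀ t, IsClosed (S t) := fun t => (isClosed_sobolevBall _ _).inter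
    (isClosed_le (continuous_id.sub continuous_const).norm continuous_const)
  have hvS : ∀ t ∈ Set.Icc 0 T, v t ∈ S t := by
    intro t ht
    refine ⟨(hvR t ht).trans (ENNReal.ofReal_le_ofReal (hRexp t ht)), ?_⟩
    simp only [Set.mem_ofPred_eq, sub_self, norm_zero]
    positivity
  have hSdiff : ∀ t ∈ Set.Icc 0 T, ∀ f ∈ S t,
      sobolevNorm (k + 1) (f - v t) ≤ ENNReal.ofReal R₂ ∧ ‖f - v t‖ ≤ min δ₁ δ₂ := by
    intro t ht f hf
    refine ⟨(sobolevNorm_sub_le _ _ _).trans ?_, hf.2.trans (hδexp t ht)⟩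
    rw [hR₂, ENNReal.ofReal_add (by positivity) (by positivity)]
    exact add_le_add (hf.1.trans (ENNReal.ofReal_le_ofReal (hexpL t ht)))
      ((hvR t ht).trans (ENNReal.ofReal_le_ofReal ((hRexp t ht).trans (hexpL t ht))))
  have hSρ : ∀ t ∈ Set.Icc 0 T, ∀ f ∈ S t, sobolevNorm ρ f ≤ ENNReal.ofReal (R + 1) := by
    intro t ht f hf
    obtain ⟨h1, h2⟩ := hSdiff t ht f hf
    refine (sobolevNorm_le_add_sub ρ f (v t)).trans ?_
    rw [ENNReal.ofReal_add hR zero_le_one]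
    exact add_le_add (hvρ t ht) (hI₁ _ h1 (h2.trans (min_le_left _ _)))
  have hη : Tendsto (fun n => ‖defect (hQ n) T a‖ +
      |lam| * ∫ τ in (0 : ℝ)..T, ‖defect (hQ n) T (N (v τ))‖) atTop (𝓝 0) := by
    have h1 : Tendsto (fun n => ∫ τ in (0 : ℝ)..T, ‖defect (hQ n) T (N (v τ))‖) atTop
        (𝓝 (∫ _τ in (0 : ℝ)..T, (0 : ℝ))) := by
      refine intervalIntegral.tendsto_integral_filter_of_dominated_convergence
        (fun τ => 2 * ‖N (v τ)‖) (Eventually.of_forall fun n => ?_)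
        (Eventually.of_forall fun n => Eventually.of_forall fun τ _ => ?_) ?_
        (Eventually.of_forall fun τ _ => tendsto_defect hQ hQ0 T _)
      · exact ((defect (hQ n) T).continuous.comp hNv).norm.aestronglyMeasurable
      · rw [norm_norm]; exact norm_defect_le (hQ n) T _
      · exact (continuous_const.mul hNv.norm).intervalIntegrable _ _
    have := (tendsto_defect hQ hQ0 T a).add (h1.const_mul |lam|)
    simpa using this
  filter_upwards [hη.eventually_le_const hδ0] with n hn
  have hUc := continuous_freeFlow (hQ n)
  have hUi : ∀ (t : ℝ) {g : ℝ → L2 d}, Continuous g →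
      Continuous fun τ => freeFlow (hQ n) (t - τ) (g τ) := fun t g hg =>
    (continuous_duhamel_integrand hUc hg).comp (continuous_const.prodMk continuous_id)
  have hinv : ∀ w : ℝ → L2 d, Continuous w → (∀ t ∈ Set.Icc 0 T, w t ∈ S t) →
      ∀ t ∈ Set.Icc 0 T, duhamel (fun t f => freeFlow (hQ n) t f) N a c w t ∈ S t := by
    intro w hw hwS t ht
    have hsub : ∀ τ ∈ Set.Ioc 0 t, τ ∈ Set.Icc 0 T := fun τ hτ => ⟨hτ.1.le, hτ.2.trans ht.2⟩
    have hNw : Continuous fun τ => N (w τ) := hN.continuous.comp hw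
    constructor
    · change sobolevNorm (k + 1) (freeFlow (hQ n) t a +
        c • ∫ τ in (0 : ℝ)..t, freeFlow (hQ n) (t - τ) (N (w τ))) ≤ _
      refine (sobolevNorm_add_le _ _ _).trans ?_
      rw [sobolevNorm_freeFlow, sobolevNorm_smul, ← hv0]
      have h1 := sobolevNorm_integral_le (s := k + 1) ht.1
        ((hUi t hNw).intervalIntegrable (μ := volume) 0 t)
        (m := fun τ => C * (R * Real.exp (L * τ)))
        ((by fun_prop : Continuous fun τ => C * (R * Real.exp (L * τ))).intervalIntegrable _ _)
        (fun τ _ => by positivity) (fun τ hτ => ?_)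
      -- The exponential solves the integral equation for the bound exactly, so the first constraint
      -- reproduces itself.
      · have e : R * Real.exp (L * t) = R +
            ‖c‖ * ∫ τ in (0 : ℝ)..t, C * (R * Real.exp (L * τ)) := by
          rw [hcn, ← intervalIntegral.integral_const_mul]
          have : ∀ τ, |lam| * (C * (R * Real.exp (L * τ))) = R * (L * Real.exp (L * τ)) :=
            fun τ => by rw [hL]; ring
          simp_rw [this]
          rw [intervalIntegral.integral_const_mul, integral_mul_exp]
          ring
        have hpos : 0 ≤ ∫ τ in (0 : ℝ)..t, C * (R * Real.exp (L * τ)) :=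
          intervalIntegral.integral_nonneg ht.1 fun τ _ => by positivity
        rw [e, ENNReal.ofReal_add hR (by positivity), ENNReal.ofReal_mul (norm_nonneg _),
          ofReal_norm]
        gcongr
        exact hvR 0 ⟨le_rfl, hT⟩
      · rw [sobolevNorm_freeFlow]
        refine (hNu _ (hSρ τ (hsub τ hτ) _ (hwS τ (hsub τ hτ)))).2.trans ?_
        rw [ENNReal.ofReal_mul C.coe_nonneg, ENNReal.ofReal_coe_nnreal]
        gcongr
        exact (hwS τ (hsub τ hτ)).1
    · change ‖freeFlow (hQ n) t a + c • (∫ τ in (0 : ℝ)..t, freeFlow (hQ n) (t - τ) (N (w τ))) -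
        v t‖ ≤ _
      have e : freeFlow (hQ n) t a + c • (∫ τ in (0 : ℝ)..t, freeFlow (hQ n) (t - τ) (N (w τ))) -
          v t = (freeFlow (hQ n) t a - a) +
          c • ∫ τ in (0 : ℝ)..t, (freeFlow (hQ n) (t - τ) (N (w τ)) - N (v τ)) := by
        rw [hodeN t ht, intervalIntegral.integral_sub ((hUi t hNw).intervalIntegrable _ _)
          (hNv.intervalIntegrable _ _), smul_sub]
        abel
      rw [e]
      have hDc : Continuous fun τ => ‖defect (hQ n) T (N (v τ))‖ :=
        ((defect (hQ n) T).continuous.comp hNv).norm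
      have hEc : Continuous fun τ => K * (δ * Real.exp (K' * τ)) := by fun_prop
      have h1 : ‖∫ τ in (0 : ℝ)..t, (freeFlow (hQ n) (t - τ) (N (w τ)) - N (v τ))‖ ≤
          ∫ τ in (0 : ℝ)..t, (K * (δ * Real.exp (K' * τ)) + ‖defect (hQ n) T (N (v τ))‖) := by
        refine intervalIntegral.norm_integral_le_of_norm_le ht.1
          (Eventually.of_forall fun τ hτ => ?_) ((hEc.add hDc).intervalIntegrable _ _)
        -- The Lipschitz part is controlled by the isometry and the second constraint. The defect
        -- part acts only on `N (v τ)`, which does not depend on `w` or `n`, so its smallness is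
        -- uniform over the candidates `w`.
        have e2 : freeFlow (hQ n) (t - τ) (N (w τ)) - N (v τ) =
            freeFlow (hQ n) (t - τ) (N (w τ) - N (v τ)) +
            (freeFlow (hQ n) (t - τ) (N (v τ)) - N (v τ)) := by
          rw [freeFlow_sub]; abel
        rw [e2]
        refine (norm_add_le _ _).trans (add_le_add ?_ ?_)
        · rw [norm_freeFlow, ← dist_eq_norm]
          refine (hN.dist_le_mul _ _).trans ?_
          rw [dist_eq_norm]
          gcongr
          exact (hwS τ (hsub τ hτ)).2
        · refine norm_freeFlow_sub_le (hQ n) ?_ _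
          rw [abs_of_nonneg (by linarith [hτ.2])]
          linarith [hτ.1, ht.2]
      rw [intervalIntegral.integral_add (hEc.intervalIntegrable _ _)
        (hDc.intervalIntegrable _ _)] at h1
      have h2 : ∫ τ in (0 : ℝ)..t, ‖defect (hQ n) T (N (v τ))‖ ≤
          ∫ τ in (0 : ℝ)..T, ‖defect (hQ n) T (N (v τ))‖ :=
        intervalIntegral.integral_mono_interval le_rfl ht.1 ht.2
          (Eventually.of_forall fun τ => norm_nonneg _) (hDc.intervalIntegrable _ _)
      have h3 : |lam| * ∫ τ in (0 : ℝ)..t, K * (δ * Real.exp (K' * τ)) =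
          δ * (Real.exp (K' * t) - 1) := by
        rw [← intervalIntegral.integral_const_mul]
        have : ∀ τ, |lam| * (K * (δ * Real.exp (K' * τ))) = δ * (K' * Real.exp (K' * τ)) :=
          fun τ => by rw [hK']; ring
        simp_rw [this]
        rw [intervalIntegral.integral_const_mul, integral_mul_exp]
      have h4 : ‖freeFlow (hQ n) t a - a‖ ≤ ‖defect (hQ n) T a‖ :=
        norm_freeFlow_sub_le (hQ n) (by rw [abs_of_nonneg ht.1]; exact ht.2) _
      refine (norm_add_le _ _).trans ?_
      rw [norm_smul, hcn]
      have h5 := mul_le_mul_of_nonneg_left h1 (abs_nonneg lam)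
      have h6 := mul_le_mul_of_nonneg_left h2 (abs_nonneg lam)
      rw [mul_add, h3] at h5
      linarith
  obtain ⟨u, huc, huS, hu⟩ := exists_duhamel_fixedPoint (U := fun t f => freeFlow (hQ n) t f) hUc
    (fun t x y => by rw [← freeFlow_sub, norm_freeFlow]) hN a c hT hSc hv hvS hinv
  refine ⟨u, ⟨⟨ρ, hρ, fun t₀ ht₀ => ⟨(hSρ t₀ ht₀ _ (huS t₀ ht₀)).trans_lt ENNReal.ofReal_lt_top,
    ?_⟩⟩, fun t => N (u t), (hN.continuous.comp huc).continuousOn,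
    fun t ht => (hNu _ (hSρ t ht _ (huS t ht))).1, fun t ht => ?_⟩, ?_⟩
  -- Continuity in `H^ρ` is interpolated from continuity in `L²` and the uniform bound in `H^{k+1}`.
  · rw [ENNReal.tendsto_nhds_zero]
    intro e he
    obtain ⟨e', he'0, he'⟩ : ∃ e' : ℝ, 0 < e' ∧ ENNReal.ofReal e' ≤ e := by
      refine ⟨(min e 1).toReal, ENNReal.toReal_pos (by simp [he.ne']) (by simp), ?_⟩
      rw [ENNReal.ofReal_toReal (by simp)]
      exact min_le_left _ _
    obtain ⟨δ₃, hδ₃, hI₃⟩ := exists_sobolevNorm_le_of_norm_le (d := d) hρ0 hρr hR₂0 he'0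
    have h1 : Tendsto (fun t => ‖u t - u t₀‖) (𝓝[Set.Icc 0 T] t₀) (𝓝 0) := by
      have := ((huc.tendsto t₀).sub_const (u t₀)).norm
      simp only [sub_self, norm_zero] at this
      exact this.mono_left nhdsWithin_le_nhds
    filter_upwards [h1.eventually_le_const hδ₃, self_mem_nhdsWithin] with t ht1 ht2
    refine (hI₃ _ ((sobolevNorm_sub_le _ _ _).trans ?_) ht1).trans he'
    rw [hR₂, ENNReal.ofReal_add (by positivity) (by positivity)]
    exact add_le_add ((huS t ht2).1.trans (ENNReal.ofReal_le_ofReal (hexpL t ht2)))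
      ((huS t₀ ht₀).1.trans (ENNReal.ofReal_le_ofReal (hexpL t₀ ht₀)))
  · rw [hu t ht, duhamel, hc, neg_smul, ← sub_eq_add_neg]
  · obtain ⟨h1, h2⟩ := hSdiff T ⟨hT, le_rfl⟩ _ (huS T ⟨hT, le_rfl⟩)
    exact hI₂ _ h1 (h2.trans (min_le_right _ _))


/-! ### Oscillating functions. -/

/-- The function `b exp (-i lam t γ)`. -/
def oscFun (lam : ℝ) (γ : Space d → ℝ) (b : 𝓢(Space d, ℂ)) (t : ℝ) (x : Space d) : ℂ :=
  Complex.exp (-(Complex.I * lam * t) * γ x) * b x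

lemma norm_exp_osc (lam t y : ℝ) : ‖Complex.exp (-(Complex.I * lam * t) * y)‖ = 1 := by
  have : -(Complex.I * lam * t) * y = ((-(lam * t * y) : ℝ) : ℂ) * Complex.I := by
    push_cast; ring
  rw [this, Complex.norm_exp_ofReal_mul_I]

lemma norm_oscFun (lam : ℝ) (γ : Space d → ℝ) (b : 𝓢(Space d, ℂ)) (t : ℝ) (x : Space d) :
    ‖oscFun lam γ b t x‖ = ‖b x‖ := by
  rw [oscFun, norm_mul, norm_exp_osc, one_mul]

lemma continuous_oscFun (lam : ℝ) {γ : Space d → ℝ} (hγ : Continuous γ) (b : 𝓢(Space d, ℂ))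
    (t : ℝ) : Continuous (oscFun lam γ b t) := by
  have := b.continuous
  unfold oscFun
  fun_prop

lemma memLp_oscFun (lam : ℝ) {γ : Space d → ℝ} (hγ : Continuous γ) (b : 𝓢(Space d, ℂ)) (t : ℝ) :
    MemLp (oscFun lam γ b t) 2 volume :=
  (b.memLp 2 volume).of_le (continuous_oscFun lam hγ b t).aestronglyMeasurable
    (Eventually.of_forall fun x => (norm_oscFun lam γ b t x).le)

lemma integrable_oscFun (lam : ℝ) {γ : Space d → ℝ} (hγ : Continuous γ) (b : 𝓢(Space d, ℂ))
    (t : ℝ) : Integrable (oscFun lam γ b t) :=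
  b.integrable.mono (continuous_oscFun lam hγ b t).aestronglyMeasurable
    (Eventually.of_forall fun x => (norm_oscFun lam γ b t x).le)

/-- The function `b exp (-i lam t γ)`, as an element of `L²`. -/
def osc (lam : ℝ) {γ : Space d → ℝ} (hγ : Continuous γ) (b : 𝓢(Space d, ℂ)) (t : ℝ) : L2 d :=
  (memLp_oscFun lam hγ b t).toLp

lemma coeFn_osc (lam : ℝ) {γ : Space d → ℝ} (hγ : Continuous γ) (b : 𝓢(Space d, ℂ)) (t : ℝ) :
    osc lam hγ b t =ᵐ[volume] oscFun lam γ b t :=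
  MemLp.coeFn_toLp _

lemma osc_zero (lam : ℝ) {γ : Space d → ℝ} (hγ : Continuous γ) (b : 𝓢(Space d, ℂ)) :
    osc lam hγ b 0 = b.toLp 2 volume := by
  apply Lp.ext
  filter_upwards [coeFn_osc lam hγ b 0, b.coeFn_toLp 2 volume] with x h1 h2
  rw [h1, h2, oscFun]
  simp

/-- The pointwise bound `|exp z - 1 - z| ≤ |z|²`, with `|γ| ≤ 1`, makes the remainder quadratic in
`t' - t` in `L²`. The ODE thus holds strongly in `L²` and can be integrated. -/
lemma hasDerivAt_osc (lam : ℝ) {γ : Space d → ℝ} (hγ : Continuous γ) (hγ1 : ∀ x, |γ x| ≤ 1)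
    {b b' : 𝓢(Space d, ℂ)} (hb' : ∀ x, b' x = γ x * b x) (t : ℝ) :
    HasDerivAt (osc lam hγ b) (-(Complex.I * lam) • osc lam hγ b' t) t := by
  rw [hasDerivAt_iff_isLittleO]
  refine Asymptotics.IsBigO.trans_isLittleO (g := fun t' => ‖t' - t‖ ^ 2) ?_
    (Asymptotics.isLittleO_pow_sub_sub t one_lt_two)
  apply Asymptotics.IsBigO.of_bound (lam ^ 2 * ‖(b.toLp 2 volume : L2 d)‖)
  have hev : ∀ᶠ t' in 𝓝 t, |lam| * |t' - t| ≤ 1 := by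
    have hc : Continuous fun t' => |lam| * |t' - t| := by fun_prop
    have := hc.tendsto t
    simp only [sub_self, abs_zero, mul_zero] at this
    exact this.eventually_le_const one_pos
  filter_upwards [hev] with t' ht'
  have e : lam ^ 2 * ‖(b.toLp 2 volume : L2 d)‖ * ‖‖t' - t‖ ^ 2‖ =
      (lam ^ 2 * ‖t' - t‖ ^ 2) * ‖(b.toLp 2 volume : L2 d)‖ := by
    rw [norm_pow, norm_norm]; ring
  rw [e]
  apply Lp.norm_le_mul_norm_of_ae_le_mul
  filter_upwards [coeFn_osc lam hγ b t, coeFn_osc lam hγ b t', coeFn_osc lam hγ b' t,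
    b.coeFn_toLp 2 volume, Lp.coeFn_sub (osc lam hγ b t' - osc lam hγ b t)
      ((t' - t) • (-(Complex.I * lam) • osc lam hγ b' t)),
    Lp.coeFn_sub (osc lam hγ b t') (osc lam hγ b t),
    Lp.coeFn_smul (t' - t) (-(Complex.I * lam) • osc lam hγ b' t),
    Lp.coeFn_smul (-(Complex.I * lam)) (osc lam hγ b' t)] with x h1 h2 h3 h4 h5 h6 h7 h8
  rw [h5, Pi.sub_apply, h6, h7, Pi.sub_apply, Pi.smul_apply, h8, Pi.smul_apply, h1, h2, h3, h4]
  set z : ℂ := -(Complex.I * lam) * (t' - t : ℝ) * γ x with hz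
  have hzn : ‖z‖ ≤ |lam| * |t' - t| := by
    rw [hz, norm_mul, norm_mul, norm_neg, norm_mul, Complex.norm_I, one_mul, Complex.norm_real,
      Complex.norm_real, Complex.norm_real]
    exact mul_le_of_le_one_right (by positivity) (hγ1 x)
  have e2 : oscFun lam γ b t' x - oscFun lam γ b t x -
      (t' - t) • (-(Complex.I * lam)) • oscFun lam γ b' t x =
      (Complex.exp z - 1 - z) * oscFun lam γ b t x := by
    have e3 : Complex.exp (-(Complex.I * lam * t') * γ x) =
        Complex.exp z * Complex.exp (-(Complex.I * lam * t) * γ x) := by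
      rw [← Complex.exp_add, hz]; congr 1; push_cast; ring
    rw [oscFun, e3, oscFun, oscFun, hb', Complex.real_smul, smul_eq_mul, hz]
    ring
  rw [e2, norm_mul, norm_oscFun]
  gcongr
  refine (Complex.norm_exp_sub_one_sub_id_le (hzn.trans ht')).trans ?_
  rw [← sq_abs lam, ← mul_pow]
  gcongr
  exact hzn

/-- Each `z`-derivative multiplies the coefficient by `c` and the `z̄`-derivative is zero. The index
`i` counts the factors already extracted, so `k + i` is constant along the induction. The bound
depends on `c` only through `c₀`, which gives uniformity in time when `c = -i lam t`. -/
lemma regBound_exp {M c₀ : ℝ} {c : ℂ} (hc : ‖c‖ ≤ c₀) (k i : ℕ) {b : ℂ}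
    (hb : ‖b‖ ≤ (1 + c₀) ^ i) :
    RegBound M ((1 + c₀) ^ (k + i) * Real.exp (c₀ * M)) k (fun z => b * Complex.exp (c * z)) := by
  have hc0 : 0 ≤ c₀ := (norm_nonneg c).trans hc
  have key : ∀ (k i : ℕ) {b : ℂ}, ‖b‖ ≤ (1 + c₀) ^ i →
      Continuous (fun z => b * Complex.exp (c * z)) ∧
      ∀ z, ‖z‖ ≤ M → ‖b * Complex.exp (c * z)‖ ≤ (1 + c₀) ^ (k + i) * Real.exp (c₀ * M) := by
    intro k i b hb
    refine ⟨by fun_prop, fun z hz => ?_⟩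
    rw [norm_mul]
    have h1 : ‖b‖ ≤ (1 + c₀) ^ (k + i) :=
      hb.trans (pow_le_pow_right₀ (by linarith) (by omega))
    have h2 : ‖Complex.exp (c * z)‖ ≤ Real.exp (c₀ * M) := by
      rw [Complex.norm_exp]
      apply Real.exp_le_exp.2
      refine (Complex.re_le_norm _).trans ?_
      rw [norm_mul]
      gcongr
    gcongr
  induction k generalizing i b with
  | zero => exact key 0 i hb
  | succ k ih =>
    have hbc : ‖b * c‖ ≤ (1 + c₀) ^ (i + 1) := by
      rw [norm_mul, pow_succ]
      gcongr
      linarith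
    have h1 := ih (i + 1) hbc
    have h2 := ih (i + 1) (b := 0) (by rw [norm_zero]; positivity)
    rw [show k + (i + 1) = k + 1 + i by omega] at h1 h2
    refine ⟨key (k + 1) i hb, _, _, fun z => ?_, h1, h2⟩
    have hd : HasDerivAt (fun z => b * Complex.exp (c * z)) (b * c * Complex.exp (c * z)) z := by
      have := (((hasDerivAt_id z).const_mul c).cexp).const_mul b
      simpa [mul_comm, mul_assoc, mul_left_comm] using this
    refine hasFDerivAt_wirtinger (hd.hasFDerivAt.restrictScalars ℝ) fun w => ?_
    simp [mul_comm]

lemma hs_schwartz_ne_top (s : ℝ) (f : 𝓢(Space d, ℂ)) : hs s f ≠ ∞ := by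
  have h := ((SchwartzMap.smulLeftCLM ℂ (fun ξ : Space d => ((bracket ξ ^ (s / 2) : ℝ) : ℂ))
    (𝓕 f)).memLp 2 volume).2.ne
  refine ne_of_eq_of_ne (congrArg (fun g => eLpNorm g 2 volume) ?_) h
  ext ξ
  rw [SchwartzMap.smulLeftCLM_apply_apply (hasTemperateGrowth_bracket_rpow _), smul_eq_mul,
    SchwartzMap.fourier_coe]

/-- Uniform Sobolev bounds for `b exp (-i lam t γ)` on bounded time intervals. -/
lemma exists_sobolevNorm_osc_le (lam T : ℝ) (hT : 0 ≤ T) {γ : Space d → ℝ} (hγ : Continuous γ)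
    {u : 𝓢(Space d, ℂ)} (hu : ∀ x, u x = γ x) (b : 𝓢(Space d, ℂ)) (k : ℕ) :
    ∃ R : ℝ, 0 ≤ R ∧ ∀ t ∈ Set.Icc 0 T, sobolevNorm k (osc lam hγ b t) ≤ ENNReal.ofReal R := by
  set ρ : ℝ := max k (d / 2 + 1) with hρ
  obtain ⟨M₀, hM₀⟩ : ∃ M₀ : ℝ, ∀ x, ‖u x‖ ≤ M₀ := by
    obtain ⟨C, hC⟩ := u.decay 0 0
    exact ⟨C, fun x => by simpa using hC.2 x⟩
  set M : ℝ := max M₀ (hs ρ u).toReal with hM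
  have hc0 : 0 ≤ |lam| * T := by positivity
  -- The phase is the entire function `exp(-i lam t z)` evaluated at the Schwartz function `u = γ`;
  -- `oscFun` is therefore a product covered by the multiplication estimate, with one constant for
  -- all `t ∈ [0, T]`.
  obtain ⟨C, hC, h⟩ := hs_comp_mul_le (d := d) (ρ := ρ) ((by linarith : (d : ℝ) / 2 < d / 2 + 1).trans_le
    (le_max_right _ _)) (M := M) (B := (1 + |lam| * T) ^ (k + 0) * Real.exp (|lam| * T * M)) k
    (le_max_left _ _)
  refine ⟨(C * hs k b).toReal, ENNReal.toReal_nonneg, fun t ht => ?_⟩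
  rw [ENNReal.ofReal_toReal (ENNReal.mul_ne_top hC (hs_schwartz_ne_top _ _)), osc,
    sobolevNorm_toLp _ (integrable_oscFun lam hγ b t)]
  have hn : ‖-(Complex.I * lam * t)‖ ≤ |lam| * T := by
    rw [norm_neg, norm_mul, norm_mul, Complex.norm_I, one_mul, Complex.norm_real,
      Complex.norm_real, Real.norm_eq_abs, Real.norm_eq_abs, abs_of_nonneg ht.1]
    gcongr
    exact ht.2
  have := h _ (regBound_exp hn k 0 (b := 1) (by simp)) u b
    (fun x => (hM₀ x).trans (le_max_left _ _)) ?_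
  · refine le_trans (le_of_eq ?_) this
    congr 1
    ext x
    rw [oscFun, hu, one_mul]
  · rw [← ENNReal.ofReal_toReal (hs_schwartz_ne_top ρ u)]
    exact ENNReal.ofReal_le_ofReal (le_max_right _ _)


/-! ### Growth of homogeneous norms of oscillating functions. -/

/-- The homogeneous Sobolev norm `‖|D|^s f‖_{L²}`. -/
def homNorm (s : ℝ) (f : L2 d) : ℝ≥0∞ :=
  eLpNorm (fun ξ : Space d => ((‖(2 * Real.pi) • ξ‖ ^ s : ℝ) : ℂ) * (𝓕 f : L2 d) ξ) 2 volume

lemma homNorm_le_sobolevNorm {s : ℝ} (hs : 0 ≤ s) (f : L2 d) : homNorm s f ≤ sobolevNorm s f := by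
  rw [homNorm, sobolevNorm_def]
  apply eLpNorm_mono
  intro ξ
  have hb := bracket_pos ξ
  rw [norm_mul, norm_mul, Complex.norm_real, Complex.norm_real,
    Real.norm_of_nonneg (by positivity), Real.norm_of_nonneg (by positivity)]
  gcongr
  calc ‖(2 * Real.pi) • ξ‖ ^ s = (‖(2 * Real.pi) • ξ‖ ^ 2) ^ (s / 2) := by
        rw [← Real.rpow_natCast, ← Real.rpow_mul (norm_nonneg _)]
        congr 1
        push_cast
        ring
    _ ≤ _ := by
        apply Real.rpow_le_rpow (by positivity) _ (by positivity)
        unfold bracket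
        linarith

lemma aesm_homNorm {s : ℝ} (hs : 0 ≤ s) (f : L2 d) : AEStronglyMeasurable
    (fun ξ : Space d => ((‖(2 * Real.pi) • ξ‖ ^ s : ℝ) : ℂ) * (𝓕 f : L2 d) ξ) volume := by
  have hc : Continuous fun ξ : Space d => ((‖(2 * Real.pi) • ξ‖ ^ s : ℝ) : ℂ) :=
    Complex.continuous_ofReal.comp
      ((continuous_const_smul (2 * Real.pi)).norm.rpow_const fun _ => Or.inr hs)
  exact hc.aestronglyMeasurable.mul (Lp.aestronglyMeasurable _)

lemma homNorm_le_add_sub {s : ℝ} (hs : 0 ≤ s) (f g : L2 d) :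
    homNorm s f ≤ homNorm s g + homNorm s (g - f) := by
  rw [homNorm, homNorm, homNorm]
  refine le_trans (le_of_eq ?_)
    (eLpNorm_sub_le (aesm_homNorm hs g) (aesm_homNorm hs (g - f)) (by norm_num))
  apply eLpNorm_congr_ae
  filter_upwards [coeFn_fourier_sub g f] with ξ hξ
  simp only [Pi.sub_apply]
  rw [hξ]; ring

lemma fourier_translate_sub {f : Space d → ℂ} (hf : Integrable f) (y ξ : Space d) :
    𝓕 (fun x => f (x + y) - f x) ξ =
      (Complex.exp (Complex.I * (2 * Real.pi * inner ℝ y ξ : ℝ)) - 1) * 𝓕 f ξ := by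
  have h1 : 𝓕 (fun x => f (x + y)) ξ =
      Complex.exp (Complex.I * (2 * Real.pi * inner ℝ y ξ : ℝ)) * 𝓕 f ξ := by
    have := congrFun (VectorFourier.fourierIntegral_comp_add_right Real.fourierChar
      (volume : Measure (Space d)) (innerₗ (Space d)) f y) ξ
    refine this.trans ?_
    simp only [Circle.smul_def, smul_eq_mul, Real.fourierChar_apply, innerₗ_apply_apply]
    rw [mul_comm Complex.I]
    rfl
  have h2 : 𝓕 (fun x => f (x + y) - f x) ξ = 𝓕 (fun x => f (x + y)) ξ - 𝓕 f ξ := by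
    rw [Real.fourier_eq, Real.fourier_eq, Real.fourier_eq, ← integral_sub]
    · simp_rw [smul_sub]
    · exact (Real.fourierIntegral_convergent_iff ξ).2 (hf.comp_add_right y)
    · exact (Real.fourierIntegral_convergent_iff ξ).2 hf
  rw [h2, h1]; ring

lemma min_two_le_rpow {θ p : ℝ} (hθ : 0 ≤ θ) (hp : p ∈ Set.Ioc (0 : ℝ) 1) :
    min 2 θ ≤ 2 * θ ^ p := by
  rcases le_total θ 1 with h | h
  · have : θ ≤ θ ^ p := by
      rcases hθ.eq_or_lt with h0 | h0
      · rw [← h0, Real.zero_rpow hp.1.ne']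
      · simpa using Real.rpow_le_rpow_of_exponent_ge h0 h hp.2
    have h2 : 0 ≤ θ ^ p := by positivity
    exact (min_le_right _ _).trans (by linarith)
  · have : 1 ≤ θ ^ p := Real.one_le_rpow h hp.1.le
    exact (min_le_left _ _).trans (by linarith)

/-- Functions with bounded `|D|^s` norm have uniformly small differences in `L²`. -/
lemma eLpNorm_translate_sub_le {s : ℝ} (hs : 0 < s) {f : Space d → ℂ} (h1 : Integrable f)
    (h2 : MemLp f 2 volume) (y : Space d) :
    eLpNorm (fun x => f (x + y) - f x) 2 volume ≤ ENNReal.ofReal (2 * ‖y‖ ^ min s 1) *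
      (eLpNorm f 2 volume + homNorm s (h2.toLp f)) := by
  -- The bound `min(2, θ) ≤ 2 θ^p` needs `p ≤ 1`, and `X^p ≤ 1 + X^s` needs `p ≤ s`.
  set p := min s 1 with hp
  have hpI : p ∈ Set.Ioc (0 : ℝ) 1 := ⟨lt_min hs one_pos, min_le_right _ _⟩
  have h1' : Integrable fun x => f (x + y) - f x := (h1.comp_add_right y).sub h1
  have h2' : MemLp (fun x => f (x + y) - f x) 2 volume :=
    (h2.comp_measurePreserving (measurePreserving_add_right volume y)).sub h2
  have hF : eLpNorm f 2 volume + homNorm s (h2.toLp f) =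
      eLpNorm (fun ξ => ‖𝓕 f ξ‖) 2 volume +
      eLpNorm (fun ξ : Space d => ‖(2 * Real.pi) • ξ‖ ^ s * ‖𝓕 f ξ‖) 2 volume := by
    congr 1
    · rw [← hs_zero h1 h2, ModifiedDispersion.hs, eLpNorm_norm]
      simp
    · rw [homNorm]
      apply eLpNorm_congr_norm_ae
      filter_upwards [fourier_toLp_ae h1 h2] with ξ hξ
      rw [hξ, norm_mul, norm_mul, norm_norm, Complex.norm_real]
  have hcont : Continuous fun ξ : Space d => ‖(2 * Real.pi) • ξ‖ ^ s :=
    (continuous_const_smul (2 * Real.pi)).norm.rpow_const fun _ => Or.inr hs.le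
  rw [hF, ← hs_zero h1' h2', ModifiedDispersion.hs]
  refine le_trans ?_ (mul_le_mul_right (eLpNorm_add_le
    (continuous_fourier h1).norm.aestronglyMeasurable
    (hcont.mul (continuous_fourier h1).norm).aestronglyMeasurable (by norm_num)) _)
  refine eLpNorm_le_mul_eLpNorm_of_ae_le_mul (Eventually.of_forall fun ξ => ?_) 2
  rw [fourier_translate_sub h1]
  simp only [zero_div, Real.rpow_zero, Complex.ofReal_one, one_mul, Pi.add_apply, Pi.mul_apply]
  rw [norm_mul, ← one_add_mul, norm_mul, norm_norm, ← mul_assoc,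
    Real.norm_of_nonneg (by positivity : (0 : ℝ) ≤ 1 + ‖(2 * Real.pi) • ξ‖ ^ s)]
  gcongr
  set θ : ℝ := ‖y‖ * ‖(2 * Real.pi) • ξ‖ with hθ
  have hθ0 : 0 ≤ θ := by positivity
  have ha : ‖Complex.exp (Complex.I * (2 * Real.pi * inner ℝ y ξ : ℝ)) - 1‖ ≤ min 2 θ := by
    refine le_min ((norm_sub_le _ _).trans ?_) ?_
    · rw [mul_comm Complex.I, Complex.norm_exp_ofReal_mul_I]; norm_num
    · refine Real.norm_exp_I_mul_ofReal_sub_one_le.trans ?_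
      have : 2 * Real.pi * inner ℝ y ξ = inner ℝ y ((2 * Real.pi) • ξ) := by
        rw [real_inner_smul_right]
      rw [this]
      exact norm_inner_le_norm _ _
  refine (ha.trans (min_two_le_rpow hθ0 hpI)).trans ?_
  rw [hθ, Real.mul_rpow (norm_nonneg _) (norm_nonneg _), mul_assoc]
  gcongr
  set X := ‖(2 * Real.pi) • ξ‖
  have hX : 0 ≤ X := norm_nonneg _
  rcases le_total X 1 with h | h
  · have h3 : X ^ p ≤ 1 := Real.rpow_le_one hX h hpI.1.le
    have : 0 ≤ X ^ s := by positivity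
    linarith
  · have : X ^ p ≤ X ^ s := Real.rpow_le_rpow_of_exponent_le h (min_le_left _ _)
    linarith

/-- The oscillating functions `b exp (-i lam n γ)` are unbounded for `|D|^s`, `s > 0`, unless `γ`
is locally constant where `b ≠ 0`. -/
theorem exists_homNorm_osc_gt {s lam : ℝ} (hs : 0 < s) (hlam : lam ≠ 0) {γ : Space d → ℝ}
    (hγ : ContDiff ℝ 1 γ) {b : 𝓢(Space d, ℂ)} {x₀ e : Space d} (hb : b x₀ ≠ 0)
    (he : fderiv ℝ γ x₀ e ≠ 0) {A : ℝ≥0∞} (hA : A ≠ ∞) :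
    ∃ n : ℕ, 0 < n ∧ A < homNorm s (osc lam hγ.continuous b n) := by
  by_contra! hcon
  set D := fderiv ℝ γ x₀ e with hD
  -- Chosen so that the limiting phase `lam ∂_y γ` equals `π` at `x₀`, where the phase factor
  -- becomes `-1`.
  set y : Space d := (Real.pi / (lam * D)) • e with hy
  set yn : ℕ → Space d := fun n => ((n : ℝ))⁻¹ • y with hyn
  have hyn0 : Tendsto yn atTop (𝓝 0) := by
    have := (tendsto_inv_atTop_nhds_zero_nat (𝕜 := ℝ)).smul_const y
    simpa using this
  -- The difference of the `n`-th oscillating function under translation by `y / n`, stripped of a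
  -- factor of modulus one so that it converges pointwise.
  set w : ℕ → Space d → ℂ := fun n x =>
    b (x + yn n) * Complex.exp (-(Complex.I * lam) * ((n : ℝ) • (γ (x + yn n) - γ x) : ℝ)) - b x
    with hw
  set wl : Space d → ℂ := fun x =>
    b x * Complex.exp (-(Complex.I * lam) * (fderiv ℝ γ x y : ℝ)) - b x with hwl
  have hwn : ∀ n, eLpNorm (w n) 2 volume =
      eLpNorm (fun x => oscFun lam γ b n (x + yn n) - oscFun lam γ b n x) 2 volume := by
    intro n
    apply eLpNorm_congr_norm_ae (Eventually.of_forall fun x => ?_)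
    have e1 : oscFun lam γ b n (x + yn n) - oscFun lam γ b n x =
        Complex.exp (-(Complex.I * lam * (n : ℝ)) * γ x) * w n x := by
      have e2 : Complex.exp (-(Complex.I * lam * (n : ℝ)) * γ (x + yn n)) =
          Complex.exp (-(Complex.I * lam * (n : ℝ)) * γ x) *
          Complex.exp (-(Complex.I * lam) * ((n : ℝ) • (γ (x + yn n) - γ x) : ℝ)) := by
        rw [← Complex.exp_add, smul_eq_mul]; congr 1; push_cast; ring
      rw [oscFun, e2, oscFun, hw]
      ring
    rw [e1, norm_mul, norm_exp_osc, one_mul]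
  have hlim : ∀ x, Tendsto (fun n => w n x) atTop (𝓝 (wl x)) := by
    intro x
    have h1 : Tendsto (fun n => b (x + yn n)) atTop (𝓝 (b x)) := by
      have := (b.continuous.tendsto (x + 0)).comp (tendsto_const_nhds.add hyn0)
      simpa [Function.comp_def] using this
    have h2 : Tendsto (fun n : ℕ => (n : ℝ) • (γ (x + yn n) - γ x)) atTop
        (𝓝 (fderiv ℝ γ x y)) := by
      refine (hγ.differentiable one_ne_zero x).hasFDerivAt.lim y ?_
      simpa using tendsto_natCast_atTop_atTop (R := ℝ)
    have h3 : Continuous fun r : ℝ => Complex.exp (-(Complex.I * lam) * (r : ℝ)) := by fun_prop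
    exact (h1.mul ((h3.tendsto _).comp h2)).sub_const _
  -- If the `|D|^s` norms were bounded by `A`, the translation differences would tend to `0` in
  -- `L²`.
  have hup : Tendsto (fun n => eLpNorm (w n) 2 volume) atTop (𝓝 0) := by
    have hb2 : eLpNorm b 2 volume ≠ ∞ := (b.memLp 2 volume).2.ne
    have h1 : Tendsto (fun n => ENNReal.ofReal (2 * ‖yn n‖ ^ min s 1) *
        (eLpNorm b 2 volume + A)) atTop (𝓝 0) := by
      have h2 : Tendsto (fun n => 2 * ‖yn n‖ ^ min s 1) atTop (𝓝 0) := by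
        have := (hyn0.norm.rpow_const (p := min s 1) (Or.inr (lt_min hs one_pos).le)).const_mul 2
        rwa [norm_zero, Real.zero_rpow (lt_min hs one_pos).ne', mul_zero] at this
      have h3 := ENNReal.Tendsto.mul_const (b := eLpNorm b 2 volume + A)
        (ENNReal.tendsto_ofReal h2) (Or.inr (by finiteness))
      simpa using h3
    refine tendsto_of_tendsto_of_tendsto_of_le_of_le' tendsto_const_nhds h1
      (Eventually.of_forall fun _ => zero_le) ?_
    filter_upwards [eventually_gt_atTop 0] with n hn
    rw [hwn]
    refine (eLpNorm_translate_sub_le hs (integrable_oscFun lam hγ.continuous b n)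
      (memLp_oscFun lam hγ.continuous b n) (yn n)).trans ?_
    gcongr
    · exact (eLpNorm_congr_norm_ae (Eventually.of_forall fun x => norm_oscFun lam γ b n x)).le
    · exact hcon n hn
  have hwm : ∀ n, Continuous (w n) := by
    intro n
    have h1 := b.continuous
    have h2 := hγ.continuous
    rw [hw]
    fun_prop
  have hwlc : Continuous wl := by
    have h1 := b.continuous
    have h2 : Continuous fun x => fderiv ℝ γ x y :=
      (hγ.continuous_fderiv one_ne_zero).clm_apply continuous_const
    rw [hwl]
    fun_prop
  -- By Fatou's lemma the pointwise limit vanishes almost everywhere, and everywhere by continuity.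
  -- At `x₀`, however, it equals `-2 b(x₀)`.
  have h0 : eLpNorm wl 2 volume = 0 := by
    have := Lp.eLpNorm_lim_le_liminf_eLpNorm (p := 2) (μ := volume) (f := w)
      (fun n => (hwm n).aestronglyMeasurable) wl (Eventually.of_forall hlim)
    rw [hup.liminf_eq] at this
    exact le_antisymm this zero_le
  rw [eLpNorm_eq_zero_iff hwlc.aestronglyMeasurable two_ne_zero] at h0
  have h00 : wl = 0 := (hwlc.ae_eq_iff_eq volume continuous_zero).1 h0
  have hx := congrFun h00 x₀
  have hval : -(Complex.I * lam) * (fderiv ℝ γ x₀ y : ℝ) = -(Real.pi * Complex.I) := by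
    have : fderiv ℝ γ x₀ y = Real.pi / lam := by
      rw [hy, map_smul, ← hD, smul_eq_mul]; field_simp
    rw [this]
    have : (lam : ℂ) ≠ 0 := by exact_mod_cast hlam
    push_cast
    field_simp
  simp only [hwl, Pi.zero_apply] at hx
  rw [hval, Complex.exp_neg, Complex.exp_pi_mul_I] at hx
  norm_num at hx
  apply hb
  have : -b x₀ - b x₀ = -(2 * b x₀) := by ring
  rw [this] at hx
  simpa using hx


/-! ### The explicit solution of the limiting ODE. -/

/-- The bump function `exp (-c / (1 - |x|²))`, supported in the unit ball. -/
def bump (c : ℝ) (x : Space d) : ℝ := expNegInvGlue ((1 - ‖x‖ ^ 2) / c)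

lemma contDiff_bump (c : ℝ) : ContDiff ℝ ((⊤ : ℕ∞) : WithTop ℕ∞) (bump c : Space d → ℝ) :=
  expNegInvGlue.contDiff.comp ((contDiff_const.sub (contDiff_norm_sq ℝ)).div_const c)

lemma bump_eq_zero_iff {c : ℝ} (hc : 0 < c) {x : Space d} : bump c x = 0 ↔ 1 ≤ ‖x‖ := by
  rw [bump, expNegInvGlue.zero_iff_nonpos, div_le_iff₀ hc, zero_mul, sub_nonpos,
    one_le_sq_iff₀ (norm_nonneg x)]

lemma bump_mem_Icc {c : ℝ} (x : Space d) : bump c x ∈ Set.Icc (0 : ℝ) 1 := by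
  refine ⟨expNegInvGlue.nonneg _, ?_⟩
  unfold bump expNegInvGlue
  split_ifs with h
  · exact zero_le_one
  · rw [Real.exp_le_one_iff, neg_nonpos, inv_nonneg]
    exact (not_le.1 h).le

/-- The reason for this particular bump: all its positive real powers are again smooth, so the phase
`|a₀|^{2σ}` is smooth for every `σ > 0` although `a₀` vanishes outside the ball. -/
lemma bump_one_rpow {c : ℝ} (hc : 0 < c) (x : Space d) : bump 1 x ^ c = bump c x := by
  unfold bump expNegInvGlue
  rw [div_one]
  by_cases h : 1 - ‖x‖ ^ 2 ≤ 0
  · rw [if_pos h, if_pos (div_nonpos_of_nonpos_of_nonneg h hc.le), Real.zero_rpow hc.ne']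
  · have h' : 0 < 1 - ‖x‖ ^ 2 := not_le.1 h
    rw [if_neg h, if_neg (not_le.2 (div_pos h' hc)), ← Real.exp_mul]
    congr 1
    field_simp

lemma hasCompactSupport_bump {c : ℝ} (hc : 0 < c) : HasCompactSupport (bump c : Space d → ℝ) := by
  refine HasCompactSupport.intro (isCompact_closedBall (0 : Space d) 1) fun x hx => ?_
  rw [bump_eq_zero_iff hc]
  rw [Metric.mem_closedBall, dist_zero_right, not_le] at hx
  exact hx.le

/-- The bump function, as a Schwartz function. -/
def bump𝓢 {c : ℝ} (hc : 0 < c) : 𝓢(Space d, ℂ) :=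
  HasCompactSupport.toSchwartzMap (f := Complex.ofRealCLM ∘ (bump c : Space d → ℝ))
    ((hasCompactSupport_bump hc).comp_left rfl) (Complex.ofRealCLM.contDiff.comp (contDiff_bump c))

lemma bump𝓢_apply {c : ℝ} (hc : 0 < c) (x : Space d) : bump𝓢 hc x = (bump c x : ℂ) := by
  simp [bump𝓢]

/-- Mean value theorem along a radius: the bump is nonzero at the centre and zero on the unit
sphere. -/
lemma exists_fderiv_bump_ne_zero (hd : 1 ≤ d) {c : ℝ} (hc : 0 < c) :
    ∃ x e : Space d, ‖x‖ < 1 ∧ fderiv ℝ (bump c) x e ≠ 0 := by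
  set e : Space d := EuclideanSpace.single ⟨0, hd⟩ 1 with he
  have hen : ‖e‖ = 1 := by simp [he]
  have hdiff : Differentiable ℝ (bump c : Space d → ℝ) := (contDiff_bump c).differentiable (by simp)
  have hder : ∀ τ : ℝ, HasDerivAt (fun τ : ℝ => bump c (τ • e)) (fderiv ℝ (bump c) (τ • e) e) τ := by
    intro τ
    have h1 : HasDerivAt (fun τ : ℝ => τ • e) e τ := by
      simpa using (hasDerivAt_id τ).smul_const e
    exact (hdiff (τ • e)).hasFDerivAt.comp_hasDerivAt τ h1
  obtain ⟨τ, hτ, h⟩ := exists_hasDerivAt_eq_slope (fun τ : ℝ => bump c (τ • e)) _ zero_lt_one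
    (fun τ _ => (hder τ).continuousAt.continuousWithinAt) fun τ _ => hder τ
  refine ⟨τ • e, e, ?_, ?_⟩
  · rw [norm_smul, hen, mul_one, Real.norm_of_nonneg hτ.1.le]
    exact hτ.2
  · rw [h]
    have h1 : bump c ((1 : ℝ) • e) = 0 := (bump_eq_zero_iff hc).2 (by rw [one_smul, hen])
    have h0 : bump c ((0 : ℝ) • e) ≠ 0 := fun h0 => by
      rw [bump_eq_zero_iff hc, zero_smul, norm_zero] at h0
      linarith
    simp only [h1]
    simpa using h0

/-- Solutions of `i ∂ₜ v = lam |v|^{2σ} v` with Schwartz datum, which are locally bounded in time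
with values in every Sobolev space, and unbounded for `|D|^s` for every `s > 0`. -/
theorem exists_ode_solution (hd : 1 ≤ d) {lam σ : ℝ} (hlam : lam ≠ 0) (hσ : 0 < σ) :
    ∃ (a₀ : 𝓢(Space d, ℂ)) (v G : ℝ → L2 d), Continuous v ∧
      (∀ t, G t =ᵐ[volume] fun x : Space d => ((‖v t x‖ ^ (2 * σ) : ℝ) : ℂ) * v t x) ∧
      (∀ t, v t = a₀.toLp 2 volume - (Complex.I * (lam : ℂ)) • ∫ τ in (0 : ℝ)..t, G τ) ∧
      (∀ (k : ℕ) (T : ℝ), 0 ≤ T → ∃ R : ℝ, 0 ≤ R ∧ ∀ t ∈ Set.Icc 0 T,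
        sobolevNorm k (v t) ≤ ENNReal.ofReal R) ∧
      ∀ s : ℝ, 0 < s → ∀ A : ℝ≥0∞, A ≠ ∞ → ∃ n : ℕ, 0 < n ∧ A < homNorm s (v n) := by
  have hc : 0 < 2 * σ := by positivity
  set γ : Space d → ℝ := bump (2 * σ) with hγdef
  have hγd : ContDiff ℝ 1 γ := (contDiff_bump (2 * σ)).of_le (by simp)
  have hγ : Continuous γ := hγd.continuous
  have hγ1 : ∀ x, |γ x| ≤ 1 := fun x => by
    rw [abs_of_nonneg (bump_mem_Icc x).1]; exact (bump_mem_Icc x).2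
  set a₀ : 𝓢(Space d, ℂ) := bump𝓢 one_pos with ha₀
  -- `a₁ = |a₀|^{2σ} a₀`. The modulus of the solution is conserved, so the nonlinear term at time
  -- `t` is `a₁` carried by the same phase.
  set a₁ : 𝓢(Space d, ℂ) := smul𝓢 (bump𝓢 hc) a₀ with ha₁
  have ha₁' : ∀ x, a₁ x = γ x * a₀ x := fun x => by rw [ha₁, smul𝓢_apply, bump𝓢_apply]
  have hder := hasDerivAt_osc lam hγ hγ1 ha₁'
  have hder₁ := hasDerivAt_osc lam hγ hγ1 (b := a₁) (b' := smul𝓢 (bump𝓢 hc) a₁)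
    fun x => by rw [smul𝓢_apply, bump𝓢_apply]
  have hcont : Continuous (osc lam hγ a₀) :=
    continuous_iff_continuousAt.2 fun t => (hder t).continuousAt
  have hcont₁ : Continuous (osc lam hγ a₁) :=
    continuous_iff_continuousAt.2 fun t => (hder₁ t).continuousAt
  refine ⟨a₀, osc lam hγ a₀, osc lam hγ a₁, hcont, fun t => ?_, fun t => ?_, fun k T hT =>
    exists_sobolevNorm_osc_le lam T hT hγ (bump𝓢_apply hc) a₀ k, fun s hs A hA => ?_⟩
  · filter_upwards [coeFn_osc lam hγ a₀ t, coeFn_osc lam hγ a₁ t] with x h1 h2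
    rw [h1, h2, norm_oscFun, oscFun, oscFun, ha₁', ha₀, bump𝓢_apply, Complex.norm_real,
      Real.norm_of_nonneg (bump_mem_Icc x).1, bump_one_rpow hc]
    ring
  · have hc₁ : Continuous fun τ => -(Complex.I * (lam : ℂ)) • osc lam hγ a₁ τ :=
      (continuous_const_smul (-(Complex.I * (lam : ℂ)))).comp hcont₁
    have h := intervalIntegral.integral_eq_sub_of_hasDerivAt (a := 0) (b := t)
      (fun τ _ => hder τ) (hc₁.intervalIntegrable _ _)
    rw [intervalIntegral.integral_smul, osc_zero, neg_smul] at h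
    rw [sub_eq_add_neg, h]
    abel
  · obtain ⟨x, e, hx, he⟩ := exists_fderiv_bump_ne_zero hd hc
    refine exists_homNorm_osc_gt hs hlam hγd (x₀ := x) (e := e) ?_ he hA
    rw [ha₀, bump𝓢_apply, Complex.ofReal_ne_zero, Ne, bump_eq_zero_iff one_pos]
    exact not_le.2 hx


/-! ### Dilations: norms, free flow, solutions. -/

lemma eLpNorm_dilate {c : ℝ} (hc : 0 < c) {g : Space d → ℂ} (hg : AEStronglyMeasurable g volume) :
    eLpNorm (fun x => g (c • x)) 2 volume =
      ENNReal.ofReal (c ^ (-((d : ℝ) / 2))) * eLpNorm g 2 volume := by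
  have hmap := Measure.map_addHaar_smul (volume : Measure (Space d)) hc.ne'
  have h1 : eLpNorm g 2 (Measure.map (c • ·) (volume : Measure (Space d))) =
      eLpNorm (fun x => g (c • x)) 2 volume :=
    eLpNorm_map_measure (by rw [hmap]; exact hg.smul_measure _)
      (measurable_const_smul c).aemeasurable
  rw [← h1, hmap, eLpNorm_smul_measure_of_ne_top (by norm_num), smul_eq_mul]
  congr 1
  rw [finrank_euclideanSpace_fin, abs_of_pos (by positivity), ENNReal.ofReal_rpow_of_pos (by positivity)]
  congr 1
  rw [← Real.rpow_natCast, ← Real.rpow_neg hc.le, ← Real.rpow_mul hc.le]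
  congr 1
  simp
  ring

lemma aesm_dilate {c : ℝ} (hc : 0 < c) {g : Space d → ℂ} (hg : AEStronglyMeasurable g volume) :
    AEStronglyMeasurable (fun x => g (c • x)) volume := by
  refine hg.comp_quasiMeasurePreserving ⟨measurable_const_smul c, ?_⟩
  rw [Measure.map_addHaar_smul volume hc.ne']
  exact Measure.smul_absolutelyContinuous

lemma memLp_dilate (A : ℂ) {c : ℝ} (hc : 0 < c) {g : Space d → ℂ} (hg : MemLp g 2 volume) :
    MemLp (fun x => A * g (c • x)) 2 volume := by
  refine MemLp.const_mul ⟨aesm_dilate hc hg.1, ?_⟩ A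
  rw [eLpNorm_dilate hc hg.1]
  exact ENNReal.mul_lt_top ENNReal.ofReal_lt_top hg.2

/-- The operator `f ↦ A f(c ·)` on `L²`. -/
def dil (A : ℂ) {c : ℝ} (hc : 0 < c) : L2 d →L[ℂ] L2 d :=
  LinearMap.mkContinuous
    { toFun := fun f => (memLp_dilate A hc (Lp.memLp f)).toLp
      map_add' := fun f g => by
        apply Lp.ext
        filter_upwards [MemLp.coeFn_toLp (memLp_dilate A hc (Lp.memLp (f + g))),
          MemLp.coeFn_toLp (memLp_dilate A hc (Lp.memLp f)),
          MemLp.coeFn_toLp (memLp_dilate A hc (Lp.memLp g)),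
          Lp.coeFn_add ((memLp_dilate A hc (Lp.memLp f)).toLp)
            ((memLp_dilate A hc (Lp.memLp g)).toLp),
          ae_dilate (Lp.coeFn_add f g) hc.ne'] with x h1 h2 h3 h4 h5
        rw [h1, h4, Pi.add_apply, h2, h3, h5, Pi.add_apply, mul_add]
      map_smul' := fun a f => by
        apply Lp.ext
        filter_upwards [MemLp.coeFn_toLp (memLp_dilate A hc (Lp.memLp (a • f))),
          MemLp.coeFn_toLp (memLp_dilate A hc (Lp.memLp f)),
          Lp.coeFn_smul a ((memLp_dilate A hc (Lp.memLp f)).toLp),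
          ae_dilate (Lp.coeFn_smul a f) hc.ne'] with x h1 h2 h3 h4
        rw [h1, RingHom.id_apply, h3, Pi.smul_apply, h2, h4, Pi.smul_apply, smul_eq_mul, smul_eq_mul]
        ring } (‖A‖ * c ^ (-((d : ℝ) / 2))) fun f => by
    simp only [LinearMap.coe_mk, AddHom.coe_mk]
    rw [Lp.norm_toLp, Lp.norm_def, ← ENNReal.toReal_ofReal (by positivity :
      0 ≤ ‖A‖ * c ^ (-((d : ℝ) / 2))), ← ENNReal.toReal_mul]
    refine ENNReal.toReal_mono (ENNReal.mul_ne_top ENNReal.ofReal_ne_top (Lp.memLp f).2.ne) ?_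
    rw [ENNReal.ofReal_mul (norm_nonneg _), mul_assoc, ← eLpNorm_dilate hc (Lp.aestronglyMeasurable f)]
    exact eLpNorm_le_mul_eLpNorm_of_ae_le_mul
      (Eventually.of_forall fun x => (norm_mul A _).le) 2

lemma coeFn_dil (A : ℂ) {c : ℝ} (hc : 0 < c) (f : L2 d) :
    dil A hc f =ᵐ[volume] fun x => A * f (c • x) :=
  MemLp.coeFn_toLp (memLp_dilate A hc (Lp.memLp f))

/-- The Schwartz function `A f(c ·)`. -/
def dil𝓢 (A : ℂ) {c : ℝ} (hc : 0 < c) (f : 𝓢(Space d, ℂ)) : 𝓢(Space d, ℂ) :=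
  A • SchwartzMap.compCLMOfContinuousLinearEquiv ℂ
    (ContinuousLinearEquiv.smulLeft (Units.mk0 c hc.ne') : Space d ≃L[ℝ] Space d) f

lemma dil𝓢_apply (A : ℂ) {c : ℝ} (hc : 0 < c) (f : 𝓢(Space d, ℂ)) (x : Space d) :
    dil𝓢 A hc f x = A * f (c • x) := by
  simp [dil𝓢, Units.smul_def]

lemma toLp_dil𝓢 (A : ℂ) {c : ℝ} (hc : 0 < c) (f : 𝓢(Space d, ℂ)) :
    (dil𝓢 A hc f).toLp 2 volume = dil A hc (f.toLp 2 volume) := by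
  apply Lp.ext
  filter_upwards [(dil𝓢 A hc f).coeFn_toLp 2 volume, coeFn_dil A hc (f.toLp 2 volume),
    ae_dilate (f.coeFn_toLp 2 volume) hc.ne'] with x h1 h2 h3
  rw [h1, h2, h3, dil𝓢_apply]

lemma fourier_dilate (A : ℂ) {c : ℝ} (hc : 0 < c) (f : Space d → ℂ) (ξ : Space d) :
    𝓕 (fun x => A * f (c • x)) ξ = A * ((c ^ d)⁻¹ : ℝ) * 𝓕 f (c⁻¹ • ξ) := by
  rw [Real.fourier_eq, Real.fourier_eq]
  have h := Measure.integral_comp_smul (volume : Measure (Space d))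
    (fun x => Real.fourierChar (-(inner ℝ x (c⁻¹ • ξ))) • (A * f x)) c
  have e : ∀ x : Space d, inner ℝ (c • x) (c⁻¹ • ξ) = inner ℝ x ξ := fun x => by
    rw [real_inner_smul_left, real_inner_smul_right, ← mul_assoc, mul_inv_cancel₀ hc.ne', one_mul]
  simp_rw [e] at h
  rw [h, finrank_euclideanSpace_fin, abs_of_pos (by positivity), Complex.real_smul]
  have e2 : ∀ x : Space d, Real.fourierChar (-(inner ℝ x (c⁻¹ • ξ))) • (A * f x) =
      A * (Real.fourierChar (-(inner ℝ x (c⁻¹ • ξ))) • f x) := fun x => by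
    simp only [Circle.smul_def, smul_eq_mul]; ring
  simp_rw [e2]
  rw [integral_const_mul]
  ring

/-- Both sides are continuous on `L²` and agree on the dense subspace of Schwartz functions. -/
lemma fourier_dil (A : ℂ) {c : ℝ} (hc : 0 < c) (f : L2 d) :
    𝓕 (dil A hc f) = dil (A * ((c ^ d)⁻¹ : ℝ)) (inv_pos.2 hc) (𝓕 f : L2 d) := by
  have hd := SchwartzMap.denseRange_toLpCLM (E := Space d) (F := ℂ) (p := 2) (μ := volume)
    ENNReal.ofNat_ne_top
  have hF := (Lp.fourierTransformₗᵢ (Space d) ℂ).continuous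
  suffices h : (fun f : L2 d => (𝓕 (dil A hc f) : L2 d)) =
      fun f => dil (A * ((c ^ d)⁻¹ : ℝ)) (inv_pos.2 hc) (𝓕 f : L2 d) from congrFun h f
  refine hd.equalizer (hF.comp (dil A hc).continuous)
    ((dil _ (inv_pos.2 hc)).continuous.comp hF) ?_
  ext1 φ
  change (𝓕 (dil A hc (φ.toLp 2 volume)) : L2 d) =
    dil (A * ((c ^ d)⁻¹ : ℝ)) (inv_pos.2 hc) (𝓕 (φ.toLp 2 volume) : L2 d)
  rw [← toLp_dil𝓢, SchwartzMap.toLp_fourier_eq, SchwartzMap.toLp_fourier_eq, ← toLp_dil𝓢]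
  congr 1
  ext ξ
  rw [dil𝓢_apply, SchwartzMap.fourier_coe, SchwartzMap.fourier_coe, ← fourier_dilate A hc]
  congr 1

lemma coeFn_fourier_dil (A : ℂ) {c : ℝ} (hc : 0 < c) (f : L2 d) :
    ((𝓕 (dil A hc f) : L2 d) : Space d → ℂ) =ᵐ[volume]
      fun ξ => A * ((c ^ d)⁻¹ : ℝ) * (𝓕 f : L2 d) (c⁻¹ • ξ) := by
  rw [fourier_dil]
  exact coeFn_dil _ _ _

lemma sobolevNorm_dil (s : ℝ) {A : ℝ} (hA : 0 ≤ A) {c : ℝ} (hc : 0 < c) (f : L2 d) :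
    sobolevNorm s (dil (A : ℂ) hc f) = ENNReal.ofReal (A * c ^ (-((d : ℝ) / 2))) *
      eLpNorm (fun ξ : Space d => ((bracket (c • ξ) ^ (s / 2) : ℝ) : ℂ) * (𝓕 f : L2 d) ξ) 2
        volume := by
  set g : Space d → ℂ := fun ξ => ((bracket (c • ξ) ^ (s / 2) : ℝ) : ℂ) * (𝓕 f : L2 d) ξ with hg
  have hgm : AEStronglyMeasurable g volume :=
    ((continuous_weight (s / 2)).comp (continuous_const_smul c)).aestronglyMeasurable.mul
      (Lp.aestronglyMeasurable _)
  have h1 : sobolevNorm s (dil (A : ℂ) hc f) =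
      eLpNorm ((A * (c ^ d)⁻¹ : ℝ) • fun ξ => g (c⁻¹ • ξ)) 2 volume := by
    rw [sobolevNorm_def]
    apply eLpNorm_congr_ae
    filter_upwards [coeFn_fourier_dil (A : ℂ) hc f] with ξ h
    rw [h, Pi.smul_apply, hg, Complex.real_smul]
    simp only
    rw [smul_smul, mul_inv_cancel₀ hc.ne', one_smul]
    push_cast
    ring
  rw [h1, eLpNorm_const_smul, eLpNorm_dilate (inv_pos.2 hc) hgm, ← mul_assoc, ← ofReal_norm,
    Real.norm_of_nonneg (by positivity), ← ENNReal.ofReal_mul (by positivity)]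
  congr 2
  rw [mul_assoc]
  congr 1
  rw [Real.inv_rpow hc.le, ← Real.rpow_neg hc.le, neg_neg, ← Real.rpow_natCast,
    ← Real.rpow_neg hc.le, ← Real.rpow_add hc]
  congr 1
  ring

/-- For `c ≥ 1` the bracket of `cξ` is at most `c²` times that of `ξ`. -/
lemma sobolevNorm_dil_le {s : ℝ} (hs : 0 ≤ s) {A : ℝ} (hA : 0 ≤ A) {c : ℝ} (hc : 1 ≤ c)
    (f : L2 d) : sobolevNorm s (dil (A : ℂ) (one_pos.trans_le hc) f) ≤
      ENNReal.ofReal (A * c ^ (s - (d : ℝ) / 2)) * sobolevNorm s f := by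
  have hc0 : 0 < c := one_pos.trans_le hc
  rw [sobolevNorm_dil s hA hc0]
  have e : A * c ^ (s - (d : ℝ) / 2) = A * c ^ (-((d : ℝ) / 2)) * c ^ s := by
    rw [mul_assoc, ← Real.rpow_add hc0]; congr 2; ring
  rw [e, ENNReal.ofReal_mul (p := A * c ^ (-((d : ℝ) / 2))) (by positivity), mul_assoc, sobolevNorm_def]
  gcongr
  refine eLpNorm_le_mul_eLpNorm_of_ae_le_mul (Eventually.of_forall fun ξ => ?_) 2
  have hb := bracket_pos ξ
  have hb' := bracket_pos (c • ξ)
  rw [norm_mul, norm_mul, Complex.norm_real, Complex.norm_real,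
    Real.norm_of_nonneg (by positivity), Real.norm_of_nonneg (by positivity), ← mul_assoc]
  gcongr
  have e2 : c ^ s = (c ^ 2) ^ (s / 2) := by
    rw [← Real.rpow_natCast, ← Real.rpow_mul hc0.le]; congr 1; push_cast; ring
  rw [e2, ← Real.mul_rpow (by positivity) hb.le]
  apply Real.rpow_le_rpow hb'.le _ (by positivity)
  unfold bracket
  rw [smul_comm, norm_smul c, Real.norm_of_nonneg hc0.le]
  nlinarith [one_le_pow₀ (n := 2) hc]

/-- The bracket of `cξ` is at least `c² |2πξ|²`. The lower bound has the same power of `c` as the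
upper one only for the homogeneous norm, which is why growth is measured with `homNorm`. -/
lemma le_sobolevNorm_dil {s : ℝ} (hs : 0 ≤ s) {A : ℝ} (hA : 0 ≤ A) {c : ℝ} (hc : 0 < c)
    (f : L2 d) : ENNReal.ofReal (A * c ^ (s - (d : ℝ) / 2)) * homNorm s f ≤
      sobolevNorm s (dil (A : ℂ) hc f) := by
  rw [sobolevNorm_dil s hA hc]
  have e : A * c ^ (s - (d : ℝ) / 2) = A * c ^ (-((d : ℝ) / 2)) * c ^ s := by
    rw [mul_assoc, ← Real.rpow_add hc]; congr 2; ring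
  rw [e, ENNReal.ofReal_mul (by positivity), mul_assoc, homNorm]
  gcongr
  have hcs : ENNReal.ofReal (c ^ s) = ‖c ^ s‖ₑ := by
    rw [← ofReal_norm, Real.norm_of_nonneg (by positivity)]
  rw [hcs, ← eLpNorm_const_smul]
  refine eLpNorm_mono fun ξ => ?_
  have hb := bracket_pos (c • ξ)
  rw [Pi.smul_apply, norm_smul, norm_mul, norm_mul, Complex.norm_real, Complex.norm_real,
    Real.norm_of_nonneg (by positivity), Real.norm_of_nonneg (by positivity),
    Real.norm_of_nonneg (by positivity), ← mul_assoc]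
  gcongr
  rw [← Real.mul_rpow hc.le (norm_nonneg _)]
  have e2 : c * ‖(2 * Real.pi) • ξ‖ = ‖(2 * Real.pi) • c • ξ‖ := by
    rw [smul_comm, norm_smul c, Real.norm_of_nonneg hc.le]
  rw [e2]
  calc ‖(2 * Real.pi) • c • ξ‖ ^ s = (‖(2 * Real.pi) • c • ξ‖ ^ 2) ^ (s / 2) := by
        rw [← Real.rpow_natCast, ← Real.rpow_mul (norm_nonneg _)]
        congr 1
        push_cast
        ring
    _ ≤ _ := by
        apply Real.rpow_le_rpow (by positivity) _ (by positivity)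
        unfold bracket
        linarith

/-- The free flow is conjugated by dilations to the free flow of a rescaled symbol. -/
lemma freeFlow_dil {P Q : Space d → ℝ} (hP : AEMeasurable P volume) (hQ : AEMeasurable Q volume)
    {B c : ℝ} (hB : B ≠ 0) (hc : 0 < c) (hPQ : ∀ ξ, Q ξ = B⁻¹ * P (c • ξ)) (A : ℂ) (t : ℝ)
    (f : L2 d) : freeFlow hP t (dil A hc f) = dil A hc (freeFlow hQ (B * t) f) := by
  apply (Lp.fourierTransformₗᵢ (Space d) ℂ).injective
  change 𝓕 (freeFlow hP t (dil A hc f)) = 𝓕 (dil A hc (freeFlow hQ (B * t) f))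
  apply Lp.ext
  filter_upwards [fourier_freeFlow hP t (dil A hc f), coeFn_fourier_dil A hc f,
    coeFn_fourier_dil A hc (freeFlow hQ (B * t) f),
    ae_dilate (fourier_freeFlow hQ (B * t) f) (inv_pos.2 hc).ne'] with ξ h1 h2 h3 h4
  rw [h1, h2, h3, h4]
  have : phase Q (B * t) (c⁻¹ • ξ) = phase P t ξ := by
    unfold phase
    rw [hPQ, smul_comm c, smul_smul c, mul_inv_cancel₀ hc.ne', one_smul]
    congr 3
    field_simp
  rw [this]
  ring

/-- Dilations map solutions to solutions. -/
theorem IsSolution.dilate {P Q : Space d → ℝ} (hP : AEMeasurable P volume)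
    (hQ : AEMeasurable Q volume) {lam σ A c T : ℝ} (hA : 0 < A) (hc : 1 ≤ c)
    (hPQ : ∀ ξ, Q ξ = (A ^ (2 * σ))⁻¹ * P (c • ξ)) {a₀ : 𝓢(Space d, ℂ)} {u : ℝ → L2 d}
    (h : IsSolution hQ lam σ a₀ T u) :
    IsSolution hP lam σ (dil𝓢 (A : ℂ) (one_pos.trans_le hc) a₀) (T / A ^ (2 * σ))
      fun t => dil (A : ℂ) (one_pos.trans_le hc) (u (A ^ (2 * σ) * t)) := by
  obtain ⟨⟨r, hr, hu⟩, g, hgc, hg, hduh⟩ := h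
  have hr0 : 0 ≤ r := by
    have : 0 ≤ (d : ℝ) / 2 := by positivity
    linarith
  have hc0 : 0 < c := one_pos.trans_le hc
  set B : ℝ := A ^ (2 * σ) with hB
  have hB0 : 0 < B := by positivity
  have hmaps : Set.MapsTo (fun t => B * t) (Set.Icc 0 (T / B)) (Set.Icc 0 T) := fun t ht =>
    ⟨mul_nonneg hB0.le ht.1, (le_div_iff₀' hB0).1 ht.2⟩
  have hBc : Continuous fun t : ℝ => B * t := by fun_prop
  refine ⟨⟨r, hr, fun t₀ ht₀ => ⟨?_, ?_⟩⟩,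
    -- The nonlinearity has degree `2σ + 1`, so it turns the amplitude `A` into `A^{2σ} A = B A`.
    fun t => (B : ℂ) • dil (A : ℂ) hc0 (g (B * t)), ?_, fun t ht => ?_, fun t ht => ?_⟩
  · exact (sobolevNorm_dil_le hr0 hA.le hc _).trans_lt
      (ENNReal.mul_lt_top ENNReal.ofReal_lt_top (hu _ (hmaps ht₀)).1)
  · have h1 : Tendsto (fun t => B * t) (𝓝[Set.Icc 0 (T / B)] t₀) (𝓝[Set.Icc 0 T] (B * t₀)) :=
      tendsto_nhdsWithin_of_tendsto_nhds_of_eventually_within _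
        ((hBc.tendsto t₀).mono_left nhdsWithin_le_nhds)
        (eventually_nhdsWithin_of_forall fun t ht => hmaps ht)
    have h2 := ENNReal.Tendsto.const_mul (a := ENNReal.ofReal (A * c ^ (r - (d : ℝ) / 2)))
      ((hu _ (hmaps ht₀)).2.comp h1) (Or.inr ENNReal.ofReal_ne_top)
    rw [mul_zero] at h2
    refine tendsto_of_tendsto_of_tendsto_of_le_of_le tendsto_const_nhds h2 (fun _ => zero_le)
      fun t => ?_
    simp only
    rw [← map_sub]
    exact sobolevNorm_dil_le hr0 hA.le hc _
  · exact ((continuous_const_smul (B : ℂ)).comp (dil (A : ℂ) hc0).continuous).comp_continuousOn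
      (hgc.comp hBc.continuousOn hmaps)
  · filter_upwards [Lp.coeFn_smul (B : ℂ) (dil (A : ℂ) hc0 (g (B * t))),
      coeFn_dil (A : ℂ) hc0 (g (B * t)), coeFn_dil (A : ℂ) hc0 (u (B * t)),
      ae_dilate (hg _ (hmaps ht)) hc0.ne'] with x h1 h2 h3 h4
    rw [h1, Pi.smul_apply, h2, h3, h4, norm_mul, Complex.norm_real, Real.norm_of_nonneg hA.le,
      Real.mul_rpow hA.le (norm_nonneg _), ← hB, smul_eq_mul]
    push_cast
    ring
  · have hint : IntervalIntegrable (fun τ => freeFlow hQ (B * t - τ) (g τ)) volume 0 (B * t) := by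
      apply ContinuousOn.intervalIntegrable
      rw [Set.uIcc_of_le (hmaps ht).1]
      have hg' : ContinuousOn g (Set.Icc 0 (B * t)) :=
        hgc.mono (Set.Icc_subset_Icc_right (hmaps ht).2)
      exact (continuous_freeFlow hQ).comp_continuousOn (f := fun τ => (B * t - τ, g τ))
        ((by fun_prop : Continuous fun τ => B * t - τ).continuousOn.prodMk hg')
    have e1 := hduh _ (hmaps ht)
    simp only
    rw [e1, map_sub, map_smul, toLp_dil𝓢, freeFlow_dil hP hQ hB0.ne' hc0 hPQ,
      ← ContinuousLinearMap.intervalIntegral_comp_comm _ hint]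
    congr 2
    -- The Jacobian of `τ ↦ B τ` is exactly the factor `B` carried by the rescaled nonlinear term.
    have e2 := intervalIntegral.smul_integral_comp_mul_left (a := 0) (b := t)
      (fun τ => dil (A : ℂ) hc0 (freeFlow hQ (B * t - τ) (g τ))) B
    rw [mul_zero] at e2
    rw [← e2, ← intervalIntegral.integral_smul]
    apply intervalIntegral.integral_congr
    intro τ _
    simp only
    rw [freeFlow_eq hP, map_smul, ← freeFlow_eq hP, freeFlow_dil hP hQ hB0.ne' hc0 hPQ, mul_sub]
    rfl


/-! ### Choice of parameters and conclusion. -/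

lemma tendsto_mul_rpow_atTop {κ p : ℝ} (hκ : 0 < κ) (hp : 0 < p) :
    Tendsto (fun j : ℕ => κ * ((j : ℝ) + 1) ^ p) atTop atTop :=
  ((tendsto_rpow_atTop hp).comp (tendsto_natCast_atTop_atTop.atTop_add
    tendsto_const_nhds)).const_mul_atTop hκ

/-- If the rescaled symbols tend to zero, arbitrarily small data lead to arbitrarily large solutions
in arbitrarily small time. -/
theorem exists_inflating_solution (hd : 1 ≤ d) {lam σ s : ℝ} (hlam : lam ≠ 0) (hσ : 0 < σ)
    (hreg : (∃ n : ℕ, σ = n) ∨ ∃ r : ℕ, (d : ℝ) / 2 < r ∧ (r : ℝ) ≤ 2 * σ)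
    {P : Space d → ℝ} (hP : AEMeasurable P volume) (hs : 0 < s) (hsd : s < (d : ℝ) / 2)
    (hP0 : ∀ κ : ℝ, 0 < κ → ∀ᵐ ξ, Tendsto (fun j : ℕ =>
      ((κ * ((j : ℝ) + 1) ^ ((d : ℝ) / 2 - s)) ^ (2 * σ))⁻¹ * P (((j : ℝ) + 1) • ξ)) atTop (𝓝 0))
    {h : ℝ} (hh : 0 < h) :
    ∃ (u₀ : 𝓢(Space d, ℂ)) (u : ℝ → L2 d) (t : ℝ), 0 < t ∧ t ≤ h ∧ IsSolution hP lam σ u₀ t u ∧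
      sobolevNorm s (u₀.toLp 2 volume) ≤ ENNReal.ofReal h ∧
      ENNReal.ofReal h⁻¹ ≤ sobolevNorm s (u t) := by
  -- The solution is built in `H^{k+1}`. For integer `σ` any large order is allowed and `k = d`
  -- suffices; otherwise `k + 1 = r`.
  obtain ⟨k, hk, hkσ⟩ : ∃ k : ℕ, (d : ℝ) / 2 < (k : ℝ) + 1 ∧
      ((∃ n : ℕ, σ = n) ∨ ((k + 1 : ℕ) : ℝ) ≤ 2 * σ) := by
    rcases hreg with hn | ⟨r, hr, hrσ⟩
    · refine ⟨d, ?_, Or.inl hn⟩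
      have : (0 : ℝ) ≤ d := Nat.cast_nonneg d
      linarith
    · obtain ⟨k, rfl⟩ : ∃ k, r = k + 1 := Nat.exists_eq_succ_of_ne_zero (by
        rintro rfl
        have : (0 : ℝ) ≤ (d : ℝ) / 2 := by positivity
        push_cast at hr
        linarith)
      exact ⟨k, by push_cast at hr; exact hr, Or.inr hrσ⟩
  obtain ⟨ρ, hρ, hρk⟩ : ∃ ρ : ℝ, max ((d : ℝ) / 2) k < ρ ∧ ρ < (k : ℝ) + 1 :=
    exists_between (max_lt hk (by linarith))
  obtain ⟨a₀, v, G, hv, hG, hode, hbd, hgrow⟩ := exists_ode_solution hd hlam hσ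
  set N₀ : ℝ := (sobolevNorm s (a₀.toLp 2 volume)).toReal with hN₀
  have hN₀' : sobolevNorm s (a₀.toLp 2 volume) = ENNReal.ofReal N₀ := by
    rw [hN₀, ENNReal.ofReal_toReal]
    rw [sobolevNorm_schwartz]
    exact hs_schwartz_ne_top s a₀
  have hN₀0 : 0 ≤ N₀ := ENNReal.toReal_nonneg
  -- Makes `κ ‖a₀‖_{H^s} ≤ h`.
  set κ : ℝ := h / (N₀ + 1) with hκ
  have hκ0 : 0 < κ := by positivity
  -- The extra `1` pays for the `H^s` distance between the true solution and `v` at time `n`.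
  obtain ⟨n, hn0, hn⟩ := hgrow s hs (ENNReal.ofReal (κ⁻¹ * h⁻¹) + 1) (by finiteness)
  have hT : (0 : ℝ) < n := by exact_mod_cast hn0
  obtain ⟨R, hR, hvR⟩ := hbd (k + 1) n hT.le
  have hp : 0 < (d : ℝ) / 2 - s := by linarith
  set A : ℕ → ℝ := fun j => κ * ((j : ℝ) + 1) ^ ((d : ℝ) / 2 - s) with hA
  have hA0 : ∀ j, 0 < A j := fun j => by positivity
  have hc1 : ∀ j : ℕ, (1 : ℝ) ≤ (j : ℝ) + 1 := fun j => by
    have : (0 : ℝ) ≤ j := Nat.cast_nonneg j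
    linarith
  set Q : ℕ → Space d → ℝ := fun j ξ => (A j ^ (2 * σ))⁻¹ * P (((j : ℝ) + 1) • ξ) with hQdef
  have hQ : ∀ j, AEMeasurable (Q j) volume := fun j =>
    (aemeasurable_dilate hP (by positivity)).const_mul _
  have hnear := exists_isSolution_near_ode (s := s) (lam := lam) (T := n) (R := R) hσ
    ((le_max_left _ _).trans_lt hρ) ((le_max_right _ _).trans hρ.le) hρk hkσ hT.le hR hs.le
    (hsd.trans hk) one_pos a₀ hv (fun t _ => hG t) (fun t _ => hode t)
    (fun t ht => by have := hvR t ht; push_cast at this; exact this) hQ (hP0 κ hκ0)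
  have hAinf : Tendsto (fun j => A j ^ (2 * σ)) atTop atTop :=
    (tendsto_rpow_atTop (by positivity)).comp (tendsto_mul_rpow_atTop hκ0 hp)
  have htime : ∀ᶠ j in atTop, (n : ℝ) / A j ^ (2 * σ) ≤ h :=
    (tendsto_const_nhds.div_atTop hAinf).eventually_le_const hh
  -- The dilation factor `j + 1` is chosen last, after `κ` and `n`, so closeness to `v` is needed
  -- only at a fixed time.
  obtain ⟨j, ⟨u, hu, huv⟩, hj⟩ := (hnear.and htime).exists
  have hAc : A j * ((j : ℝ) + 1) ^ (s - (d : ℝ) / 2) = κ := by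
    rw [hA]
    simp only
    rw [mul_assoc, ← Real.rpow_add (one_pos.trans_le (hc1 j))]
    simp
  have hB0 : 0 < A j ^ (2 * σ) := Real.rpow_pos_of_pos (hA0 j) _
  refine ⟨_, _, (n : ℝ) / A j ^ (2 * σ), div_pos hT hB0, hj,
    IsSolution.dilate hP (hQ j) (hA0 j) (hc1 j) (fun ξ => rfl) hu, ?_, ?_⟩
  · rw [toLp_dil𝓢]
    refine (sobolevNorm_dil_le hs.le (hA0 j).le (hc1 j) _).trans ?_
    rw [hAc, hN₀', ← ENNReal.ofReal_mul hκ0.le]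
    apply ENNReal.ofReal_le_ofReal
    rw [hκ, div_mul_eq_mul_div, div_le_iff₀ (by positivity)]
    nlinarith
  · rw [mul_div_cancel₀ _ hB0.ne']
    refine le_trans ?_ (le_sobolevNorm_dil hs.le (hA0 j).le (one_pos.trans_le (hc1 j)) _)
    rw [hAc]
    have h1 : ENNReal.ofReal (κ⁻¹ * h⁻¹) ≤ homNorm s (u n) := by
      have h2 := hn.le.trans (homNorm_le_add_sub hs.le (v n) (u n))
      have h3 : homNorm s (u n - v n) ≤ 1 := by
        refine (homNorm_le_sobolevNorm hs.le _).trans ?_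
        simpa using huv
      exact (ENNReal.add_le_add_iff_right ENNReal.one_ne_top).1
        (h2.trans (add_le_add le_rfl h3))
    calc ENNReal.ofReal h⁻¹ = ENNReal.ofReal κ * ENNReal.ofReal (κ⁻¹ * h⁻¹) := by
          rw [← ENNReal.ofReal_mul hκ0.le, mul_inv_cancel_left₀ hκ0.ne']
      _ ≤ _ := by gcongr

/-- Norm inflation, when the rescaled symbols tend to zero. -/
theorem normInflation_of_tendsto (hd : 1 ≤ d) {lam σ s : ℝ} (hlam : lam ≠ 0) (hσ : 0 < σ)
    (hreg : (∃ n : ℕ, σ = n) ∨ ∃ r : ℕ, (d : ℝ) / 2 < r ∧ (r : ℝ) ≤ 2 * σ)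
    {P : Space d → ℝ} (hP : AEMeasurable P volume) (hs : 0 < s) (hsd : s < (d : ℝ) / 2)
    (hP0 : ∀ κ : ℝ, 0 < κ → ∀ᵐ ξ, Tendsto (fun j : ℕ =>
      ((κ * ((j : ℝ) + 1) ^ ((d : ℝ) / 2 - s)) ^ (2 * σ))⁻¹ * P (((j : ℝ) + 1) • ξ)) atTop (𝓝 0)) :
    NormInflation hP lam σ s := by
  have key : ∀ h : ℝ, ∃ (u₀ : 𝓢(Space d, ℂ)) (u : ℝ → L2 d) (t : ℝ), 0 < h → 0 < t ∧ t ≤ h ∧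
      IsSolution hP lam σ u₀ t u ∧ sobolevNorm s (u₀.toLp 2 volume) ≤ ENNReal.ofReal h ∧
      ENNReal.ofReal h⁻¹ ≤ sobolevNorm s (u t) := by
    intro h
    by_cases hh : 0 < h
    · obtain ⟨u₀, u, t, H⟩ := exists_inflating_solution hd hlam hσ hreg hP hs hsd hP0 hh
      exact ⟨u₀, u, t, fun _ => H⟩
    · exact ⟨0, 0, 0, fun h' => absurd h' hh⟩
  choose u₀ u t H using key
  have hid : Tendsto (fun h : ℝ => h) (𝓝[>] 0) (𝓝 0) := nhdsWithin_le_nhds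
  have hpos : ∀ᶠ h : ℝ in 𝓝[>] 0, 0 < h := self_mem_nhdsWithin
  -- The solution is required only up to the time of inflation, so `T h = t h`.
  refine ⟨u₀, u, t, t, fun h hh => ⟨(H h hh.1).1, le_rfl, (H h hh.1).2.2.1⟩, ?_, ?_, ?_⟩
  · refine tendsto_of_tendsto_of_tendsto_of_le_of_le' tendsto_const_nhds
      (by simpa using ENNReal.tendsto_ofReal hid) (Eventually.of_forall fun _ => zero_le) ?_
    filter_upwards [hpos] with h hh using (H h hh).2.2.2.1
  · refine tendsto_of_tendsto_of_tendsto_of_le_of_le' tendsto_const_nhds hid ?_ ?_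
    · filter_upwards [hpos] with h hh using (H h hh).1.le
    · filter_upwards [hpos] with h hh using (H h hh).2.1
  · refine tendsto_of_tendsto_of_tendsto_of_le_of_le'
      (ENNReal.tendsto_ofReal_atTop.comp tendsto_inv_nhdsGT_zero) tendsto_const_nhds ?_
      (Eventually.of_forall fun _ => le_top)
    filter_upwards [hpos] with h hh using (H h hh).2.2.2.2

/-- The rescaled symbol is `κ^{-2σ} (j + 1)^{m - 2σ(d/2 - s)} P(ξ)`. The condition on `s` says
precisely that this exponent is negative. -/
lemma tendsto_rescaled_of_homogeneous {P : Space d → ℝ} {m σ s κ : ℝ}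
    (hP : IsHomogeneousSymbol P m) (hσ : 0 < σ) (hs : s < (d : ℝ) / 2 - m / (2 * σ)) (hκ : 0 < κ)
    (ξ : Space d) : Tendsto (fun j : ℕ =>
      ((κ * ((j : ℝ) + 1) ^ ((d : ℝ) / 2 - s)) ^ (2 * σ))⁻¹ * P (((j : ℝ) + 1) • ξ))
      atTop (𝓝 0) := by
  have hq : 0 < ((d : ℝ) / 2 - s) * (2 * σ) - m := by
    have h1 : m / (2 * σ) < (d : ℝ) / 2 - s := by linarith
    rw [div_lt_iff₀ (by positivity)] at h1
    linarith
  have h1 : Tendsto (fun j : ℕ => (κ ^ (2 * σ) *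
      ((j : ℝ) + 1) ^ (((d : ℝ) / 2 - s) * (2 * σ) - m))⁻¹ * P ξ) atTop (𝓝 0) := by
    have := (tendsto_mul_rpow_atTop (Real.rpow_pos_of_pos hκ (2 * σ)) hq).inv_tendsto_atTop.mul_const
      (P ξ)
    simpa using this
  refine h1.congr fun j => ?_
  have hj : (0 : ℝ) < (j : ℝ) + 1 := by positivity
  rw [hP ξ _ hj, Real.mul_rpow hκ.le (by positivity), ← Real.rpow_mul hj.le, Real.rpow_sub hj]
  field_simp

lemma tendsto_rescaled_of_bounded {P : Space d → ℝ} (hP : MemLp P ∞ volume) {σ s κ : ℝ}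
    (hσ : 0 < σ) (hs : s < (d : ℝ) / 2) (hκ : 0 < κ) : ∀ᵐ ξ, Tendsto (fun j : ℕ =>
      ((κ * ((j : ℝ) + 1) ^ ((d : ℝ) / 2 - s)) ^ (2 * σ))⁻¹ * P (((j : ℝ) + 1) • ξ))
      atTop (𝓝 0) := by
  obtain ⟨C, hC⟩ : ∃ C : ℝ, ∀ᵐ ξ, ‖P ξ‖ ≤ C := by
    refine ⟨(eLpNorm P ∞ volume).toReal, ?_⟩
    filter_upwards [enorm_ae_le_eLpNormEssSup P volume] with ξ hξ
    rw [eLpNorm_exponent_top, ← toReal_enorm]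
    exact ENNReal.toReal_mono (by simpa using hP.2.ne) hξ
  -- The essential bound survives each dilation off a null set, and there are countably many `j`.
  have hall : ∀ᵐ ξ, ∀ j : ℕ, ‖P (((j : ℝ) + 1) • ξ)‖ ≤ C :=
    ae_all_iff.2 fun j => ae_dilate hC (by positivity)
  have hlim : Tendsto (fun j : ℕ =>
      ((κ * ((j : ℝ) + 1) ^ ((d : ℝ) / 2 - s)) ^ (2 * σ))⁻¹ * C) atTop (𝓝 0) := by
    have := (((tendsto_rpow_atTop (by positivity : 0 < 2 * σ)).comp
      (tendsto_mul_rpow_atTop hκ (by linarith : 0 < (d : ℝ) / 2 - s))).inv_tendsto_atTop).mul_const C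
    simpa [Function.comp_def] using this
  filter_upwards [hall] with ξ hξ
  refine squeeze_zero_norm (fun j => ?_) hlim
  rw [norm_mul, Real.norm_of_nonneg (by positivity)]
  gcongr
  exact hξ j

end ModifiedDispersion

end

theorem theorem1 (d : ℕ) (hd : 1 ≤ d) (lam : ℝ) (hlam : lam ≠ 0) (σ : ℝ) (hσ : 0 < σ)
    (hreg : (∃ n : ℕ, σ = n) ∨ ∃ r : ℕ, (d : ℝ) / 2 < r ∧ (r : ℝ) ≤ 2 * σ)
    (P : ModifiedDispersion.Space d → ℝ) (hP : AEMeasurable P volume) :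
    (∀ m : ℝ, 1 ≤ m → ModifiedDispersion.IsHomogeneousSymbol P m →
      0 < (d : ℝ) / 2 - m / (2 * σ) →
      ∀ s : ℝ, 0 < s → s < (d : ℝ) / 2 - m / (2 * σ) →
        ModifiedDispersion.NormInflation hP lam σ s) ∧
    (MemLp P ∞ volume →
      ∀ s : ℝ, 0 < s → s < (d : ℝ) / 2 →
        ModifiedDispersion.NormInflation hP lam σ s) := by
  refine ⟨fun m hm hhom _ s hs hsm => ?_, fun hbdd s hs hsd => ?_⟩
  · have hpos : 0 < m / (2 * σ) := by positivity
    exact ModifiedDispersion.normInflation_of_tendsto hd hlam hσ hreg hP hs (by linarith)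
      fun κ hκ => Eventually.of_forall
        (ModifiedDispersion.tendsto_rescaled_of_homogeneous hhom hσ hsm hκ)
  · exact ModifiedDispersion.normInflation_of_tendsto hd hlam hσ hreg hP hs hsd
      fun κ hκ => ModifiedDispersion.tendsto_rescaled_of_bounded hbdd hσ hsd hκ
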